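/- Let $\mathbb K=\mathbb R$ or $\mathbb C$. Manifolds are smooth, Hausdorff, paracompact, finite-dimensional and without boundary; vector bundles are smooth $\mathbb K$-vector bundles of finite rank, and $TX$ stands for $TX\otimes_{\mathbb R}\mathbb K$. Let $G$ be a Lie group with Lie algebra $\mathfrak g$ (read $\mathfrak g$ below as $\mathfrak g\otimes_{\mathbb R}\mathbb K$), let $\pi\colon P\to M$ be a principal $G$-bundle with right action of $G$, and let $L$ be a Lie $\mathbb K$-algebroid over $M$ with anchor $\rho_L\colon L\to TM$. Let $T^LP$ be the pullback over $P$ of $T\pi\colon TP\to\pi^*TM$ along $\pi^*\rho_L\colon\pi^*L\to\pi^*TM$, that is, $$(T^LP)_p=\{(v,l)\in T_pP\times L_{\pi(p)} : T\pi(v)=\rho_L(l)\},$$ with the action of $G$ induced by the tangent maps of the right translations of $P$. Put $\operatorname{At}(P)=(TP)/G$, $\operatorname{At}_L(P)=(T^LP)/G$ and $\operatorname{Ad}(P)=P\times_G\mathfrak g$ (the quotient of $P\times\mathfrak g$ by $(p,x)\cdot g=(pg,\operatorname{Ad}_{g^{-1}}x)$). Let $\sigma\colon\operatorname{At}(P)\to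 TM$ be induced by $T\pi$, let $f_L\colon\operatorname{At}_L(P)\to\operatorname{At}(P)$ and $\sigma_L\colon\operatorname{At}_L(P)\to L$ be induced by the projections of $T^LP$ to $TP$ and $\pi^*L$, and let $\iota\colon\operatorname{Ad}(P)\to\operatorname{At}_L(P)$ send $[p,x]$ to the class of $(x_P(p),0)$, where $x_P$ is the fundamental vector field of $x$. Then $\operatorname{Ad}(P)$, $\operatorname{At}(P)$ and $\operatorname{At}_L(P)$ are vector bundles over $M$ (the smooth sections of a quotient bundle being those that correspond to smooth $G$-invariant sections over $P$), the maps $\iota,\sigma_L,f_L,\sigma$ are vector-bundle maps, the sequence $$0\to\operatorname{Ad}(P)\xrightarrow{\ \iota\ }\operatorname{At}_L(P)\xrightarrow{\ \sigma_L\ }L\to0$$ is exact, and $(f_L,\sigma_L)$ identifies $\operatorname{At}_L(P)$ with the pullback of $\sigma$ and $\rho_L$, fibrewise and on smooth local sections. Moreover, the following data are in bijective correspondence: 1. $L$-connections on $P$, i.e. $G$-equivariant vector-bundle maps $h\colon\pi^*L\to TP$ over $\operatorname{id}_P$ such that $T\pi(h_p(l))=\rho_L(l)$ for all $p\in P$,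 $l\in L_{\pi(p)}$; 2. (a) vector-bundle maps $s\colon L\to\operatorname{At}_L(P)$ with $\sigma_L\circ s=\operatorname{id}$ (right splittings); (b) vector-bundle maps $\theta\colon\operatorname{At}_L(P)\to\operatorname{Ad}(P)$ with $\theta\circ\iota=\operatorname{id}$ (left splittings); 3. vector-bundle isomorphisms $\Phi\colon\operatorname{At}_L(P)\to\operatorname{Ad}(P)\oplus L$ such that $\Phi(\iota(a))=a\oplus0$ and $\sigma_L(\Phi^{-1}(0\oplus l))=l$ for all $a\in\operatorname{Ad}(P)$, $l\in L$ (decompositions); 4. vector-bundle maps $\bar s\colon L\to\operatorname{At}(P)$ with $\sigma\circ\bar s=\rho_L$. The bijections are given by $\bar s(l)=[h_p(l)]$ for $p\in P$, $l\in L_{\pi(p)}$; by $\bar s=f_L\circ s$; by $\iota\circ\theta+s\circ\sigma_L=\operatorname{id}$; and by $\Phi=\theta\oplus\sigma_L$, $\Phi^{-1}(a\oplus l)=\iota(a)+s(l)$. -/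

import Mathlib

open scoped Manifold ContDiff TensorProduct
open Bundle MulOpposite

namespace LAtiyah

noncomputable section

universe u v w w'

/-! ### Smooth `K`-vector bundles over real manifolds (`K = ℝ` or `ℂ`) -/

section VectorBundles

variable (K : Type*) [RCLike K] {E H : Type*} [NormedAddCommGroup E] [NormedSpace ℝ E]
  [TopologicalSpace H] (I : ModelWithCorners ℝ E H) {X : Type*} [TopologicalSpace X]
  [ChartedSpace H X]

/-- The real vector space underlying a `K`-vector space. -/
@[reducible] def realModule (V : Type*) [AddCommGroup V] [Module K V] : Module ℝ V :=
  Module.compHom V (algebraMap ℝ K)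

/-- A structure of smooth `K`-vector bundle (of finite rank) over the real manifold `X` on the
family of `K`-vector spaces `V`: the local trivializations are `K`-linear on the fibres, and the
transition functions are smooth (in the sense of real manifolds). -/
structure VectorBundleStructure (V : X → Type*) [∀ x, AddCommGroup (V x)]
    [∀ x, Module K (V x)] where
  rank : ℕ
  [topTotal : TopologicalSpace (TotalSpace (Fin rank → K) V)]
  [topFiber : ∀ x, TopologicalSpace (V x)]
  [fiberBundle : FiberBundle (Fin rank → K) V]
  linear : VectorBundle K (Fin rank → K) V
  linearReal : letI : ∀ x, Module ℝ (V x) := fun x => realModule K (V x)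
    VectorBundle ℝ (Fin rank → K) V
  smooth : letI : ∀ x, Module ℝ (V x) := fun x => realModule K (V x)
    ContMDiffVectorBundle ∞ (Fin rank → K) V I

variable {K I}

/-- Smoothness, on the set `W`, of a section `s` along a map `f : Y → X`, that is, of a section of
the pullback bundle `f^* V`. -/
def VectorBundleStructure.IsSmoothAlong {V : X → Type*} [∀ x, AddCommGroup (V x)]
    [∀ x, Module K (V x)] (S : VectorBundleStructure K I V) {E' H' : Type*}
    [NormedAddCommGroup E'] [NormedSpace ℝ E'] [TopologicalSpace H']
    (I' : ModelWithCorners ℝ E' H') {Y : Type*} [TopologicalSpace Y] [ChartedSpace H' Y]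
    (f : Y → X) (s : ∀ y, V (f y)) (W : Set Y) : Prop :=
  letI := S.topTotal
  letI := S.topFiber
  letI := S.fiberBundle
  ContMDiffOn I' (I.prod 𝓘(ℝ, Fin S.rank → K)) ∞
    (fun y => (⟨f y, s y⟩ : TotalSpace (Fin S.rank → K) V)) W

end VectorBundles

/-- A family of `K`-vector spaces over `X`, together with the knowledge of which sections are smooth
on which open sets. -/
structure SmoothFamily (K : Type u) [RCLike K] (X : Type v) where
  Fiber : X → Type w
  [addCommGroup : ∀ x, AddCommGroup (Fiber x)]
  [module : ∀ x, Module K (Fiber x)]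
  IsSmoothOn : (∀ x, Fiber x) → Set X → Prop

attribute [instance] SmoothFamily.addCommGroup SmoothFamily.module

section Families

variable {K : Type*} [RCLike K] {X : Type*}

/-- A family with smooth sections is a smooth vector bundle if there is a smooth vector bundle
structure on it whose smooth local sections are the given ones. -/
def SmoothFamily.IsVectorBundle {E H : Type*} [NormedAddCommGroup E] [NormedSpace ℝ E]
    [TopologicalSpace H] [TopologicalSpace X] [ChartedSpace H X] (A : SmoothFamily K X)
    (I : ModelWithCorners ℝ E H) : Prop :=
  ∃ S : VectorBundleStructure K I A.Fiber, ∀ (U : Set X), IsOpen U → ∀ s : ∀ x, A.Fiber x,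
    A.IsSmoothOn s U ↔ S.IsSmoothAlong I id s U

/-- The Whitney sum. -/
def SmoothFamily.sum (A : SmoothFamily.{_, _, w} K X) (B : SmoothFamily.{_, _, w'} K X) :
    SmoothFamily K X where
  Fiber x := A.Fiber x × B.Fiber x
  IsSmoothOn s U := A.IsSmoothOn (fun x => (s x).1) U ∧ B.IsSmoothOn (fun x => (s x).2) U

/-- Fibrewise linear maps over the identity of the base. -/
abbrev FibreMap (A : SmoothFamily.{_, _, w} K X) (B : SmoothFamily.{_, _, w'} K X) :=
  ∀ x, A.Fiber x →ₗ[K] B.Fiber x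

/-- A fibrewise linear map is a vector bundle map if it sends smooth local sections to smooth
local sections. -/
def IsBundleMap [TopologicalSpace X] {A : SmoothFamily.{_, _, w} K X}
    {B : SmoothFamily.{_, _, w'} K X} (φ : FibreMap A B) : Prop :=
  ∀ U : Set X, IsOpen U → ∀ s, A.IsSmoothOn s U → B.IsSmoothOn (fun x => φ x (s x)) U

end Families

/-! ### The tangent bundle with coefficients in `K` -/

section Tangent

variable (K : Type*) [RCLike K]

/-- `z ⊗ v ↦ re z • v`. -/
def tensorRe (V : Type*) [AddCommGroup V] [Module ℝ V] : K ⊗[ℝ] V →ₗ[ℝ] V :=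
  (TensorProduct.lid ℝ V).toLinearMap ∘ₗ (RCLike.reLm (K := K)).rTensor V

/-- `z ⊗ v ↦ im z • v`. -/
def tensorIm (V : Type*) [AddCommGroup V] [Module ℝ V] : K ⊗[ℝ] V →ₗ[ℝ] V :=
  (TensorProduct.lid ℝ V).toLinearMap ∘ₗ (RCLike.imLm (K := K)).rTensor V

variable {E H : Type*} [NormedAddCommGroup E] [NormedSpace ℝ E] [TopologicalSpace H]
  (I : ModelWithCorners ℝ E H) (X : Type*) [TopologicalSpace X] [ChartedSpace H X]
  {E' H' : Type*} [NormedAddCommGroup E'] [NormedSpace ℝ E'] [TopologicalSpace H']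
  (I' : ModelWithCorners ℝ E' H') {Y : Type*} [TopologicalSpace Y] [ChartedSpace H' Y]

/-- `T_K X = TX ⊗_ℝ K`. A section is smooth if its real and imaginary parts are smooth vector
fields. -/
def tangentK [IsManifold I ∞ X] : SmoothFamily K X where
  Fiber x := K ⊗[ℝ] TangentSpace I x
  IsSmoothOn s W :=
    haveI : IsManifold I 1 X := IsManifold.of_le (n := ∞) (by simp)
    ContMDiffOn I I.tangent ∞
      (fun x => (⟨x, tensorRe K (TangentSpace I x) (s x)⟩ : TangentBundle I X)) W ∧
    ContMDiffOn I I.tangent ∞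
      (fun x => (⟨x, tensorIm K (TangentSpace I x) (s x)⟩ : TangentBundle I X)) W

variable {X}

/-- The tangent map of `f` at `x`, extended `K`-linearly. -/
def tangentMapK (f : X → Y) (x : X) :
    K ⊗[ℝ] TangentSpace I x →ₗ[K] K ⊗[ℝ] TangentSpace I' (f x) :=
  (mfderiv I I' f x).toLinearMap.baseChange K

theorem tangentMapK_comp {E'' H'' : Type*} [NormedAddCommGroup E''] [NormedSpace ℝ E'']
    [TopologicalSpace H''] (I'' : ModelWithCorners ℝ E'' H'') {Z : Type*} [TopologicalSpace Z]
    [ChartedSpace H'' Z] {f : X → Y} {g : Y → Z} (x : X) (hg : MDifferentiableAt I' I'' g (f x))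
    (hf : MDifferentiableAt I I' f x) (v : K ⊗[ℝ] TangentSpace I x) :
    tangentMapK K I I'' (g ∘ f) x v =
      tangentMapK K I' I'' g (f x) (tangentMapK K I I' f x v) := by
  rw [tangentMapK, mfderiv_comp x hg hf]
  change LinearMap.baseChange K
    ((mfderiv I' I'' g (f x)).toLinearMap ∘ₗ (mfderiv I I' f x).toLinearMap) v = _
  rw [LinearMap.baseChange_comp]
  rfl

variable {K}

/-- The derivative of a `K`-valued function in the direction of a vector in `TX ⊗_ℝ K`. -/
def dirDeriv (f : X → K) (x : X) : K ⊗[ℝ] TangentSpace I x →ₗ[K] K :=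
  let df : TangentSpace I x →ₗ[ℝ] K := (mfderiv I 𝓘(ℝ, K) f x).toLinearMap
  df.liftBaseChange K

end Tangent

/-! ### Lie algebroids -/

/-- A Lie `K`-algebroid over the manifold `M`. The bracket lives on the space of smooth global
sections. Its `K`-bilinearity is contained in the additivity, the antisymmetry and the Leibniz
rule for constant functions. That the anchor is a homomorphism of Lie algebras is expressed
through the action of vector fields on smooth functions. -/
structure LieAlgebroid (K : Type*) [RCLike K] {E H : Type*} [NormedAddCommGroup E]
    [NormedSpace ℝ E] [TopologicalSpace H] (I : ModelWithCorners ℝ E H) (M : Type*)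
    [TopologicalSpace M] [ChartedSpace H M] [IsManifold I ∞ M] where
  Fiber : M → Type w
  [addCommGroup : ∀ m, AddCommGroup (Fiber m)]
  [module : ∀ m, Module K (Fiber m)]
  bundle : VectorBundleStructure K I Fiber
  anchor : ∀ m, Fiber m →ₗ[K] K ⊗[ℝ] TangentSpace I m
  anchor_smooth : ∀ U : Set M, IsOpen U → ∀ s, bundle.IsSmoothAlong I id s U →
    (tangentK K I M).IsSmoothOn (fun m => anchor m (s m)) U
  bracket : {s : ∀ m, Fiber m // bundle.IsSmoothAlong I id s Set.univ} →
    {s : ∀ m, Fiber m // bundle.IsSmoothAlong I id s Set.univ} →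
    {s : ∀ m, Fiber m // bundle.IsSmoothAlong I id s Set.univ}
  add_bracket : ∀ r s t k, r.1 = s.1 + t.1 →
    (bracket r k).1 = (bracket s k).1 + (bracket t k).1
  bracket_add : ∀ r s t k, r.1 = s.1 + t.1 →
    (bracket k r).1 = (bracket k s).1 + (bracket k t).1
  bracket_self : ∀ s, (bracket s s).1 = 0
  jacobi : ∀ r s t, (bracket r (bracket s t)).1 =
    (bracket (bracket r s) t).1 + (bracket s (bracket r t)).1
  leibniz : ∀ (f : M → K), ContMDiff I 𝓘(ℝ, K) ∞ f → ∀ r s t, (∀ m, t.1 m = f m • s.1 m) →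
    ∀ m, (bracket r t).1 m =
      dirDeriv I f m (anchor m (r.1 m)) • s.1 m + f m • (bracket r s).1 m
  anchor_bracket : ∀ (f : M → K), ContMDiff I 𝓘(ℝ, K) ∞ f → ∀ r s m,
    dirDeriv I f m (anchor m ((bracket r s).1 m)) =
      dirDeriv I (fun m' => dirDeriv I f m' (anchor m' (s.1 m'))) m (anchor m (r.1 m)) -
      dirDeriv I (fun m' => dirDeriv I f m' (anchor m' (r.1 m'))) m (anchor m (s.1 m))

attribute [instance] LieAlgebroid.addCommGroup LieAlgebroid.module

/-- The vector bundle underlying a Lie algebroid. -/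
def LieAlgebroid.family {K : Type*} [RCLike K] {E H : Type*} [NormedAddCommGroup E]
    [NormedSpace ℝ E] [TopologicalSpace H] {I : ModelWithCorners ℝ E H} {M : Type*}
    [TopologicalSpace M] [ChartedSpace H M] [IsManifold I ∞ M] (L : LieAlgebroid K I M) :
    SmoothFamily K M where
  Fiber := L.Fiber
  IsSmoothOn s U := L.bundle.IsSmoothAlong I id s U

/-! ### Principal bundles -/

/-- A (smooth) principal `G`-bundle `P → M`: the right action of `G` on `P` is smooth, and there
are local trivializations `π⁻¹(U) ≃ U × G` that are `G`-equivariant diffeomorphisms over `U`. -/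
structure PrincipalBundle {EM HM EG HG EP HP : Type*}
    [NormedAddCommGroup EM] [NormedSpace ℝ EM] [TopologicalSpace HM]
    [NormedAddCommGroup EG] [NormedSpace ℝ EG] [TopologicalSpace HG]
    [NormedAddCommGroup EP] [NormedSpace ℝ EP] [TopologicalSpace HP]
    (IM : ModelWithCorners ℝ EM HM) (M : Type*) [TopologicalSpace M] [ChartedSpace HM M]
    (IG : ModelWithCorners ℝ EG HG) (G : Type*) [TopologicalSpace G] [ChartedSpace HG G] [Group G]
    (IP : ModelWithCorners ℝ EP HP) (P : Type*) [TopologicalSpace P] [ChartedSpace HP P]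
    [MulAction Gᵐᵒᵖ P] where
  proj : P → M
  contMDiff_proj : ContMDiff IP IM ∞ proj
  contMDiff_act : ContMDiff (IP.prod IG) IP ∞ (fun x : P × G => op x.2 • x.1)
  proj_act : ∀ (g : G) (p : P), proj (op g • p) = proj p
  exists_trivialization : ∀ m : M, ∃ U : Set M, IsOpen U ∧ m ∈ U ∧
    ∃ e : OpenPartialHomeomorph P (M × G), e.source = proj ⁻¹' U ∧ e.target = U ×ˢ Set.univ ∧
      ContMDiffOn IP (IM.prod IG) ∞ e e.source ∧ ContMDiffOn (IM.prod IG) IP ∞ e.symm e.target ∧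
      (∀ p ∈ e.source, (e p).1 = proj p) ∧
      ∀ p ∈ e.source, ∀ g : G, e (op g • p) = ((e p).1, (e p).2 * g)

/-! ### Equivariant bundles over `P` and their quotients -/

/-- A `G`-equivariant bundle over `P`: the right action of `G` on the total space is fibrewise
linear and covers the action on `P`. -/
structure EquivariantFamily (K : Type u) [RCLike K] (G : Type*) [Group G] (P : Type v)
    [MulAction Gᵐᵒᵖ P] extends SmoothFamily.{u, v, w} K P where
  act : ∀ (g : G) (p : P), Fiber p →ₗ[K] Fiber (op g • p)
  act_one : ∀ p v, (⟨op 1 • p, act 1 p v⟩ : Σ p, Fiber p) = ⟨p, v⟩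
  act_mul : ∀ g h p v, (⟨op (g * h) • p, act (g * h) p v⟩ : Σ p, Fiber p) =
    ⟨op h • op g • p, act h (op g • p) (act g p v)⟩

/-- `G`-equivariance of a fibrewise linear map. -/
def IsEquivariant {K : Type*} [RCLike K] {G : Type*} [Group G] {P : Type*} [MulAction Gᵐᵒᵖ P]
    {A : EquivariantFamily.{_, _, w} K G P} {B : EquivariantFamily.{_, _, w'} K G P}
    (φ : FibreMap A.toSmoothFamily B.toSmoothFamily) : Prop :=
  ∀ (g : G) (p : P) (v : A.Fiber p), φ (op g • p) (A.act g p v) = B.act g p (φ p v)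

section Principal

variable {EM HM EG HG EP HP : Type*}
  [NormedAddCommGroup EM] [NormedSpace ℝ EM] [TopologicalSpace HM]
  [NormedAddCommGroup EG] [NormedSpace ℝ EG] [TopologicalSpace HG]
  [NormedAddCommGroup EP] [NormedSpace ℝ EP] [TopologicalSpace HP]
  {IM : ModelWithCorners ℝ EM HM} {M : Type*} [TopologicalSpace M] [ChartedSpace HM M]
  {IG : ModelWithCorners ℝ EG HG} {G : Type*} [TopologicalSpace G] [ChartedSpace HG G] [Group G]
  {IP : ModelWithCorners ℝ EP HP} {P : Type*} [TopologicalSpace P] [ChartedSpace HP P]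
  [MulAction Gᵐᵒᵖ P]

namespace PrincipalBundle

variable (B : PrincipalBundle IM M IG G IP P)

theorem proj_surjective (m : M) : ∃ p, B.proj p = m := by
  obtain ⟨U, -, hm, e, hs, ht, -, -, h1, -⟩ := B.exists_trivialization m
  have hx : (m, (1 : G)) ∈ e.target := by rw [ht]; exact ⟨hm, trivial⟩
  refine ⟨e.symm (m, 1), ?_⟩
  rw [← h1 _ (e.map_target hx), e.right_inv hx]

theorem free (B : PrincipalBundle IM M IG G IP P) {p : P} {g : G} (h : op g • p = p) : g = 1 := by
  obtain ⟨U, -, hm, e, hs, ht, -, -, h1, h2⟩ := B.exists_trivialization (B.proj p)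
  have hp : p ∈ e.source := by rw [hs]; exact hm
  have := h2 p hp g
  rw [h] at this
  have := congrArg Prod.snd this
  simpa using this

theorem transitive {p q : P} (h : B.proj p = B.proj q) : ∃ g : G, op g • p = q := by
  obtain ⟨U, -, hm, e, hs, ht, -, -, h1, h2⟩ := B.exists_trivialization (B.proj p)
  have hp : p ∈ e.source := by rw [hs]; exact hm
  have hq : q ∈ e.source := by rw [hs, Set.mem_preimage, ← h]; exact hm
  refine ⟨(e p).2⁻¹ * (e q).2, e.injOn ?_ hq ?_⟩
  · rw [hs, Set.mem_preimage, B.proj_act]; exact hm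
  · rw [h2 p hp]
    ext
    · simp [h1 p hp, h1 q hq, h]
    · simp

end PrincipalBundle

variable {K : Type*} [RCLike K]

namespace EquivariantFamily

variable (A : EquivariantFamily.{_, _, w} K G P) (B : PrincipalBundle IM M IG G IP P)

/-- The part of the total space lying over `m : M`. -/
abbrev Over (m : M) : Type _ := Σ p : {p : P // B.proj p = m}, A.Fiber p.1

/-- Two vectors are in the same `G`-orbit. -/
def SameOrbit {m : M} (x y : A.Over B m) : Prop :=
  ∃ g : G, (⟨op g • x.1.1, A.act g x.1.1 x.2⟩ : Σ p, A.Fiber p) = ⟨y.1.1, y.2⟩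

theorem act_congr {G : Type*} [Group G] {P : Type*} [MulAction Gᵐᵒᵖ P]
    (A : EquivariantFamily.{_, _, w} K G P) (g : G) {p q : P} {v : A.Fiber p} {w : A.Fiber q}
    (h : (⟨p, v⟩ : Σ p, A.Fiber p) = ⟨q, w⟩) :
    (⟨op g • p, A.act g p v⟩ : Σ p, A.Fiber p) = ⟨op g • q, A.act g q w⟩ := by
  cases h; rfl

/-- The orbit relation of `G` on the part of the total space over `m`. -/
def orbitSetoid (m : M) : Setoid (A.Over B m) where
  r := A.SameOrbit B
  iseqv := by
    refine ⟨fun x => ⟨1, A.act_one _ _⟩, ?_, ?_⟩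
    · rintro x y ⟨g, h⟩
      refine ⟨g⁻¹, ?_⟩
      rw [← A.act_congr g⁻¹ h, ← A.act_mul]
      have : ∀ k : G, k = 1 → (⟨op k • x.1.1, A.act k x.1.1 x.2⟩ : Σ p, A.Fiber p) =
          ⟨x.1.1, x.2⟩ := by
        rintro k rfl; exact A.act_one _ _
      exact this _ (mul_inv_cancel g)
    · rintro x y z ⟨g, h⟩ ⟨k, h'⟩
      exact ⟨g * k, by rw [A.act_mul, A.act_congr k h, h']⟩

/-- The fibre over `m` of the quotient bundle `A / G → M`: the set of `G`-orbits over `m`. -/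
def QuotFiber (m : M) : Type _ := Quotient (A.orbitSetoid B m)

/-- The orbit of a vector `v` at a point `p` over `m`. -/
def orbit {m : M} (p : P) (hp : B.proj p = m) (v : A.Fiber p) : A.QuotFiber B m :=
  Quotient.mk _ ⟨⟨p, hp⟩, v⟩

theorem orbit_eq_iff {m : M} {p q : P} (hp : B.proj p = m) (hq : B.proj q = m)
    (v : A.Fiber p) (w : A.Fiber q) : A.orbit B p hp v = A.orbit B q hq w ↔
      ∃ g : G, (⟨op g • p, A.act g p v⟩ : Σ p, A.Fiber p) = ⟨q, w⟩ :=
  Quotient.eq (r := A.orbitSetoid B m)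

theorem orbit_bijective {m : M} (p : P) (hp : B.proj p = m) :
    Function.Bijective (A.orbit B p hp) := by
  constructor
  · intro v w h
    obtain ⟨g, hg⟩ := (A.orbit_eq_iff B hp hp v w).1 h
    have h1 : g = 1 := B.free (congrArg Sigma.fst hg)
    subst h1
    rw [A.act_one] at hg
    simpa using hg
  · rintro ⟨⟨q, hq⟩, w⟩
    obtain ⟨g, hg⟩ := B.transitive (hq.trans hp.symm)
    subst hg
    exact ⟨A.act g q w, ((A.orbit_eq_iff B hq hp _ _).2 ⟨g, rfl⟩).symm⟩

/-- Any point `p` over `m` identifies the fibre at `p` with the fibre of the quotient at `m`. -/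
def orbitEquiv {m : M} (p : P) (hp : B.proj p = m) : A.Fiber p ≃ A.QuotFiber B m :=
  Equiv.ofBijective _ (A.orbit_bijective B p hp)

/-- A point of `P` over `m`. -/
def point (m : M) : P := (B.proj_surjective m).choose

theorem proj_point (m : M) : B.proj (point B m) = m := (B.proj_surjective m).choose_spec

instance (m : M) : AddCommGroup (A.QuotFiber B m) :=
  (A.orbitEquiv B (point B m) (proj_point B m)).symm.addCommGroup

/-- The vector space structure on the fibre of the quotient. It makes `A.orbit B p hp` linear for
every `p` over `m`, see `orbitLinear`. -/
instance (m : M) : Module K (A.QuotFiber B m) :=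
  (A.orbitEquiv B (point B m) (proj_point B m)).symm.module K

/-- Passing to orbits is a linear isomorphism from the fibre at `p` to the fibre of the quotient
bundle. -/
def orbitLinear {m : M} (p : P) (hp : B.proj p = m) : A.Fiber p ≃ₗ[K] A.QuotFiber B m :=
  { A.orbitEquiv B p hp with
    map_add' := by
      obtain ⟨g, hg⟩ := B.transitive (hp.trans (proj_point B m).symm)
      have key : ∀ v, A.orbitEquiv B p hp v =
          A.orbitEquiv B (op g • p) (by rw [B.proj_act, hp]) (A.act g p v) := fun v =>
        (A.orbit_eq_iff B _ _ _ _).2 ⟨g, rfl⟩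
      generalize_proofs h1 at key
      intro v w
      change A.orbitEquiv B p hp _ = A.orbitEquiv B p hp _ + A.orbitEquiv B p hp _
      rw [key, key, key, map_add]
      have h2 := proj_point B m
      have e0 : ∀ x y : A.QuotFiber B m, x + y = A.orbitEquiv B (point B m) h2
        ((A.orbitEquiv B (point B m) h2).symm x + (A.orbitEquiv B (point B m) h2).symm y) :=
        fun _ _ => rfl
      rw [e0]
      generalize point B m = q at hg h2
      subst hg
      simp
    map_smul' := by
      obtain ⟨g, hg⟩ := B.transitive (hp.trans (proj_point B m).symm)
      have key : ∀ v, A.orbitEquiv B p hp v =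
          A.orbitEquiv B (op g • p) (by rw [B.proj_act, hp]) (A.act g p v) := fun v =>
        (A.orbit_eq_iff B _ _ _ _).2 ⟨g, rfl⟩
      generalize_proofs h1 at key
      intro c w
      change A.orbitEquiv B p hp _ = c • A.orbitEquiv B p hp _
      rw [key, key, map_smul]
      have h2 := proj_point B m
      have e0 : ∀ x : A.QuotFiber B m, c • x = A.orbitEquiv B (point B m) h2
        (c • (A.orbitEquiv B (point B m) h2).symm x) :=
        fun _ => rfl
      rw [e0]
      generalize point B m = q at hg h2
      subst hg
      simp }

@[simp] theorem orbitLinear_apply {m : M} (p : P) (hp : B.proj p = m) (v : A.Fiber p) :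
    A.orbitLinear B p hp v = A.orbit B p hp v := rfl

/-- The quotient bundle `A / G` over `M`. A section over `U` is smooth if the `G`-invariant section
of `A` over `π⁻¹(U)` that it corresponds to is smooth. -/
def quot : SmoothFamily K M where
  Fiber := A.QuotFiber B
  IsSmoothOn s U :=
    A.IsSmoothOn (fun p => (A.orbitLinear B p rfl).symm (s (B.proj p))) (B.proj ⁻¹' U)

theorem orbit_act {m : M} (p : P) (hp : B.proj p = m) (g : G) (hg : B.proj (op g • p) = m)
    (v : A.Fiber p) : A.orbit B (op g • p) hg (A.act g p v) = A.orbit B p hp v :=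
  ((A.orbit_eq_iff B _ _ _ _).2 ⟨g, rfl⟩).symm

variable {A} in
/-- The map `A / G → W` induced by a `G`-invariant, fibrewise linear map `A → W` over `P → M`. -/
def descend {W : M → Type*} [∀ m, AddCommGroup (W m)] [∀ m, Module K (W m)]
    (φ : ∀ p, A.Fiber p →ₗ[K] W (B.proj p))
    (hφ : ∀ (g : G) (p : P) (v : A.Fiber p), (⟨B.proj (op g • p), φ (op g • p) (A.act g p v)⟩ :
      Σ m, W m) = ⟨B.proj p, φ p v⟩) (m : M) : A.QuotFiber B m →ₗ[K] W m :=
  have map : ∀ x : A.QuotFiber B m, ∃ p hp v, x = A.orbit B p hp v := by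
    rintro ⟨⟨p, hp⟩, v⟩; exact ⟨p, hp, v, rfl⟩
  let f : A.QuotFiber B m → W m := Quotient.lift (fun x : A.Over B m => x.1.2 ▸ φ x.1.1 x.2) (by
    rintro ⟨⟨p, hp⟩, v⟩ ⟨⟨q, hq⟩, w⟩ ⟨g, hg⟩
    cases hg
    subst hp
    have aux : ∀ (m' m : M) (h : m' = m) (x : W m') (y : W m),
        (⟨m', x⟩ : Σ m, W m) = ⟨m, y⟩ → y = h ▸ x := by
      rintro _ _ rfl x y h
      simpa using h.symm
    exact aux _ _ hq _ _ (hφ g p v))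
  have hf : ∀ p hp v, f (A.orbit B p hp v) = hp ▸ φ p v := fun _ _ _ => rfl
  { toFun := f
    map_add' := by
      intro x y
      obtain ⟨p, hp, v, rfl⟩ := map x
      obtain ⟨w, rfl⟩ := (A.orbit_bijective B p hp).2 y
      rw [← A.orbitLinear_apply, ← A.orbitLinear_apply, ← map_add]
      simp only [A.orbitLinear_apply, hf]
      subst hp
      simp
    map_smul' := by
      intro c x
      obtain ⟨p, hp, v, rfl⟩ := map x
      rw [← A.orbitLinear_apply, ← map_smul]
      simp only [A.orbitLinear_apply, hf]
      subst hp
      simp }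

@[simp] theorem descend_orbit {W : M → Type*} [∀ m, AddCommGroup (W m)] [∀ m, Module K (W m)]
    (φ : ∀ p, A.Fiber p →ₗ[K] W (B.proj p)) (hφ) (p : P) (v : A.Fiber p) :
    descend B φ hφ (B.proj p) (A.orbit B p rfl v) = φ p v := rfl

/-- The map `A / G → A' / G` induced by a `G`-equivariant map `A → A'`. -/
def quotMap {A : EquivariantFamily.{_, _, w} K G P} {A' : EquivariantFamily.{_, _, w'} K G P}
    (φ : FibreMap A.toSmoothFamily A'.toSmoothFamily) (hφ : IsEquivariant φ) :
    FibreMap (A.quot B) (A'.quot B) :=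
  descend B (W := A'.QuotFiber B) (fun p => (A'.orbitLinear B p rfl).toLinearMap ∘ₗ φ p) (by
    intro g p v
    simp only [LinearMap.comp_apply, LinearEquiv.coe_coe, orbitLinear_apply, hφ g p v]
    have : ∀ (m : M) (h : B.proj (op g • p) = m) (h' : B.proj p = m),
        A'.orbit B (op g • p) h (A'.act g p (φ p v)) = A'.orbit B p h' (φ p v) :=
      fun m h h' => A'.orbit_act B p h' g h (φ p v)
    have h2 := this _ (B.proj_act g p) rfl
    rw [← h2]
    have : ∀ (m : M) (h : B.proj (op g • p) = m) (x : A'.Fiber (op g • p)),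
      (⟨B.proj (op g • p), A'.orbit B _ rfl x⟩ : Σ m, A'.QuotFiber B m) =
        ⟨m, A'.orbit B _ h x⟩ := by
      rintro m rfl x; rfl
    exact this _ _ _)

end EquivariantFamily

/-! ### The bundles of the Atiyah sequences -/

section Atiyah

theorem PrincipalBundle.mdifferentiable_smul (B : PrincipalBundle IM M IG G IP P) (g : G) :
    MDifferentiable IP IP (fun q : P => op g • q) := by
  have : ContMDiff IP IP ∞ (fun q : P => op g • q) :=
    B.contMDiff_act.comp (contMDiff_id.prodMk contMDiff_const)
  exact this.mdifferentiable (by simp)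

theorem PrincipalBundle.mdifferentiable_orbit (B : PrincipalBundle IM M IG G IP P) (p : P) :
    MDifferentiable IG IP (fun g : G => op g • p) := by
  have : ContMDiff IG IP ∞ (fun g : G => op g • p) :=
    B.contMDiff_act.comp (contMDiff_const.prodMk contMDiff_id)
  exact this.mdifferentiable (by simp)

theorem PrincipalBundle.mdifferentiable_proj (B : PrincipalBundle IM M IG G IP P) :
    MDifferentiable IP IM B.proj :=
  B.contMDiff_proj.mdifferentiable (by simp)

section

variable [IsManifold IP ∞ P]

variable (K) in
/-- `T_K P` with the action of `G` by the tangent maps of the right translations. -/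
def tangentE (B : PrincipalBundle IM M IG G IP P) : EquivariantFamily K G P where
  toSmoothFamily := tangentK K IP P
  act g p := tangentMapK K IP IP (fun q : P => op g • q) p
  act_one p v := by
    have aux : ∀ f : P → P, f = id →
        (⟨f p, tangentMapK K IP IP f p v⟩ : Σ p, K ⊗[ℝ] TangentSpace IP p) = ⟨p, v⟩ := by
      rintro _ rfl
      have : (mfderiv IP IP (id : P → P) p).toLinearMap = LinearMap.id := by
        rw [mfderiv_id]; rfl
      simp only [tangentMapK, this, LinearMap.baseChange_id]
      rfl
    exact aux _ (by funext q; simp)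
  act_mul g h p v := by
    have aux : ∀ f : P → P, f = (fun q : P => op h • q) ∘ (fun q : P => op g • q) →
        (⟨f p, tangentMapK K IP IP f p v⟩ : Σ p, K ⊗[ℝ] TangentSpace IP p) =
          ⟨op h • op g • p, tangentMapK K IP IP (fun q : P => op h • q) (op g • p)
            (tangentMapK K IP IP (fun q : P => op g • q) p v)⟩ := by
      rintro _ rfl
      exact congrArg (Sigma.mk (op h • op g • p)) (tangentMapK_comp K IP IP IP
        (f := fun q : P => op g • q) (g := fun q : P => op h • q) p
        (B.mdifferentiable_smul h (op g • p)) (B.mdifferentiable_smul g p) v)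
    exact aux _ (by funext q; simp [mul_smul])

end

section

set_option linter.unusedSectionVars false

variable [LieGroup IG ∞ G]

variable (IG G) in
/-- `Ad_{g⁻¹}`, the derivative of `h ↦ g⁻¹ h g` at the identity. -/
def adInv (g : G) : GroupLieAlgebra IG G →ₗ[ℝ] GroupLieAlgebra IG G :=
  let d : EG →L[ℝ] EG := mfderiv IG IG (fun h : G => g⁻¹ * h * g) 1
  d.toLinearMap

theorem mdifferentiable_conj (g : G) : MDifferentiable IG IG (fun h : G => g⁻¹ * h * g) := by
  have : ContMDiff IG IG ∞ (fun h : G => g⁻¹ * h * g) :=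
    (contMDiff_const.mul contMDiff_id).mul contMDiff_const
  exact this.mdifferentiable (by simp)

theorem adInv_one : adInv IG G 1 = LinearMap.id := by
  have aux : ∀ f : G → G, f = id →
      (mfderiv IG IG f 1 : EG →L[ℝ] EG) = ContinuousLinearMap.id ℝ EG := by
    rintro _ rfl; exact mfderiv_id
  ext x
  exact congrArg (fun l : EG →L[ℝ] EG => l x) (aux _ (by funext h; simp))

theorem adInv_mul (g h : G) : adInv IG G (g * h) = adInv IG G h ∘ₗ adInv IG G g := by
  have e : (fun k : G => (g * h)⁻¹ * k * (g * h)) =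
      (fun k : G => h⁻¹ * k * h) ∘ (fun k : G => g⁻¹ * k * g) := by
    funext k; simp [mul_assoc]
  have h1 : g⁻¹ * 1 * g = 1 := by simp
  have := mfderiv_comp (1 : G) (mdifferentiable_conj (IG := IG) h (g⁻¹ * 1 * g))
    (mdifferentiable_conj (IG := IG) g 1)
  rw [← e, h1] at this
  ext x
  exact congrArg (fun l : EG →L[ℝ] EG => l x) this

variable (K IG G IP P) in
/-- The trivial bundle `P × 𝔤_K`, `𝔤_K = 𝔤 ⊗_ℝ K`, with the action
`(p, x) · g = (p · g, Ad_{g⁻¹} x)`. -/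
def adjointE : EquivariantFamily K G P where
  Fiber _ := K ⊗[ℝ] GroupLieAlgebra IG G
  IsSmoothOn s W :=
    ContMDiffOn IP 𝓘(ℝ, EG) ∞
      (fun p => (show EG from tensorRe K (GroupLieAlgebra IG G) (s p))) W ∧
    ContMDiffOn IP 𝓘(ℝ, EG) ∞
      (fun p => (show EG from tensorIm K (GroupLieAlgebra IG G) (s p))) W
  act g _ := (adInv IG G g).baseChange K
  act_one p v := by
    rw [adInv_one, LinearMap.baseChange_id]
    simp
  act_mul g h p v := by
    rw [adInv_mul, LinearMap.baseChange_comp]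
    simp [mul_smul]

end

variable (IG G IP) in
/-- The fundamental vector field of `x : 𝔤` at `p`: the derivative of `g ↦ p · g` at the identity
(a vector at `p · 1 = p`). -/
def fundamental (p : P) : GroupLieAlgebra IG G →ₗ[ℝ] TangentSpace IP p :=
  let d : EG →L[ℝ] EP := mfderiv IG IP (fun g : G => op g • p) 1
  d.toLinearMap

theorem mfderiv_proj_fundamental (B : PrincipalBundle IM M IG G IP P) (p : P) :
    (mfderiv IP IM B.proj p).toLinearMap ∘ₗ fundamental IG G IP p = 0 := by
  have h1 : op (1 : G) • p = p := by simp
  have := mfderiv_comp (1 : G) (B.mdifferentiable_proj (op (1 : G) • p))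
    (B.mdifferentiable_orbit p 1)
  have e : B.proj ∘ (fun g : G => op g • p) = fun _ => B.proj p := by
    funext g; exact B.proj_act g p
  rw [e, mfderiv_const, h1] at this
  ext x
  exact (congrArg (fun l : EG →L[ℝ] EM => l x) this).symm

theorem fundamental_act [LieGroup IG ∞ G] (B : PrincipalBundle IM M IG G IP P) (g : G) (p : P) :
    fundamental IG G IP (op g • p) ∘ₗ adInv IG G g =
      (mfderiv IP IP (fun q : P => op g • q) p).toLinearMap ∘ₗ fundamental IG G IP p := by
  have h1 : op (1 : G) • p = p := by simp
  have h2 : g⁻¹ * 1 * g = 1 := by simp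
  have a := mfderiv_comp (1 : G) (B.mdifferentiable_smul g (op (1 : G) • p))
    (B.mdifferentiable_orbit p 1)
  have b := mfderiv_comp (1 : G) (B.mdifferentiable_orbit (op g • p) (g⁻¹ * 1 * g))
    (mdifferentiable_conj (IG := IG) g 1)
  have e : (fun k : G => op k • op g • p) ∘ (fun h : G => g⁻¹ * h * g) =
      (fun q : P => op g • q) ∘ (fun h : G => op h • p) := by
    funext h
    simp [mul_smul]
  rw [e, a, h1, h2] at b
  ext x
  exact (congrArg (fun l : EG →L[ℝ] EP => l x) b).symm

set_option linter.unusedSectionVars false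

variable [IsManifold IM ∞ M] (B : PrincipalBundle IM M IG G IP P) (L : LieAlgebroid.{w} K IM M)

/-- The identification of the fibres of `L` over equal points. -/
def castL {m m' : M} (h : m = m') : L.Fiber m →ₗ[K] L.Fiber m' := h ▸ LinearMap.id

theorem sigma_castL {m m' : M} (h : m = m') (l : L.Fiber m) :
    (⟨m', castL L h l⟩ : Σ m, L.Fiber m) = ⟨m, l⟩ := by
  subst h; rfl

theorem castL_castL {m m' m'' : M} (h : m = m') (h' : m' = m'') (l : L.Fiber m) :
    castL L h' (castL L h l) = castL L (h.trans h') l := by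
  subst h; subst h'; rfl

theorem sigma_pullback {p q : P} (h : p = q) (h' : B.proj p = B.proj q)
    (l : L.Fiber (B.proj p)) : (⟨q, castL L h' l⟩ : Σ p, L.Fiber (B.proj p)) = ⟨p, l⟩ := by
  subst h; rfl

/-- The pullback bundle `π^* L` with its action of `G`. -/
def pullbackE : EquivariantFamily K G P where
  Fiber p := L.Fiber (B.proj p)
  IsSmoothOn s W := L.bundle.IsSmoothAlong IP B.proj s W
  act g p := castL L (B.proj_act g p).symm
  act_one p v := sigma_pullback B L (by simp) _ v
  act_mul g h p v := by
    have : ∀ (q r : P) (e : q = r) (h1 : B.proj p = B.proj q) (h2 : B.proj p = B.proj r),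
        (⟨q, castL L h1 v⟩ : Σ p, L.Fiber (B.proj p)) = ⟨r, castL L h2 v⟩ := by
      rintro q _ rfl h1 h2; rfl
    rw [castL_castL]
    exact this _ _ (by simp [mul_smul]) _ _

/-- The fibre at `p` of `T^L P`, the pullback of `Tπ : TP → π^* TM` along the anchor
`π^* L → π^* TM`. -/
def TLFiber (p : P) : Submodule K ((K ⊗[ℝ] TangentSpace IP p) × L.Fiber (B.proj p)) where
  carrier := {x | tangentMapK K IP IM B.proj p x.1 = L.anchor (B.proj p) x.2}
  add_mem' := by
    intro x y hx hy
    change _ = _ at hx hy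
    change tangentMapK K IP IM B.proj p (x.1 + y.1) = L.anchor (B.proj p) (x.2 + y.2)
    rw [map_add, map_add, hx, hy]
  zero_mem' := by
    change tangentMapK K IP IM B.proj p 0 = L.anchor (B.proj p) 0
    rw [map_zero, map_zero]
  smul_mem' := by
    intro c x hx
    change _ = _ at hx
    change tangentMapK K IP IM B.proj p (c • x.1) = L.anchor (B.proj p) (c • x.2)
    rw [map_smul, map_smul, hx]

/-- `Tπ` is invariant under the action of `G` on `TP`. -/
theorem tangentMapK_proj_act (g : G) (p : P) (v : K ⊗[ℝ] TangentSpace IP p) :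
    (⟨B.proj (op g • p), tangentMapK K IP IM B.proj (op g • p)
      (tangentMapK K IP IP (fun q : P => op g • q) p v)⟩ : Σ m, K ⊗[ℝ] TangentSpace IM m) =
      ⟨B.proj p, tangentMapK K IP IM B.proj p v⟩ := by
  have aux : ∀ f : P → M, f = B.proj ∘ (fun q : P => op g • q) →
      (⟨B.proj (op g • p), tangentMapK K IP IM B.proj (op g • p)
        (tangentMapK K IP IP (fun q : P => op g • q) p v)⟩ : Σ m, K ⊗[ℝ] TangentSpace IM m) =
      ⟨f p, tangentMapK K IP IM f p v⟩ := by
    rintro _ rfl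
    rw [tangentMapK_comp K IP IP IM p (B.mdifferentiable_proj (op g • p))
      (B.mdifferentiable_smul g p)]
    rfl
  exact aux _ (by funext q; exact (B.proj_act g q).symm)

theorem act_mem_TLFiber (g : G) (p : P) (x : (K ⊗[ℝ] TangentSpace IP p) × L.Fiber (B.proj p))
    (hx : x ∈ TLFiber B L p) : (tangentMapK K IP IP (fun q : P => op g • q) p x.1,
      castL L (B.proj_act g p).symm x.2) ∈ TLFiber B L (op g • p) := by
  change _ = _ at hx
  change tangentMapK K IP IM B.proj (op g • p) _ = L.anchor (B.proj (op g • p)) _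
  have h := tangentMapK_proj_act (K := K) B g p x.1
  rw [hx] at h
  have aux : ∀ (m : M) (e : B.proj p = m) (y : K ⊗[ℝ] TangentSpace IM m),
      (⟨m, y⟩ : Σ m, K ⊗[ℝ] TangentSpace IM m) = ⟨B.proj p, L.anchor _ x.2⟩ →
      y = L.anchor m (castL L e x.2) := by
    rintro m rfl y h
    exact eq_of_heq (Sigma.mk.inj h).2
  exact aux _ _ _ h

theorem sigma_TLFiber_ext {p q : P} {x : TLFiber B L p} {y : TLFiber B L q}
    (h1 : (⟨p, x.1.1⟩ : Σ p, K ⊗[ℝ] TangentSpace IP p) = ⟨q, y.1.1⟩)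
    (h2 : (⟨p, x.1.2⟩ : Σ p, L.Fiber (B.proj p)) = ⟨q, y.1.2⟩) :
    (⟨p, x⟩ : Σ p, TLFiber B L p) = ⟨q, y⟩ := by
  obtain rfl : p = q := congrArg Sigma.fst h1
  obtain ⟨⟨x1, x2⟩, hx⟩ := x
  obtain ⟨⟨y1, y2⟩, hy⟩ := y
  obtain rfl : x1 = y1 := by simpa using h1
  obtain rfl : x2 = y2 := by simpa using h2
  rfl

variable [IsManifold IP ∞ P]

/-- The bundle `T^L P` over `P` with its action of `G`. -/
def TL : EquivariantFamily K G P where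
  Fiber p := TLFiber B L p
  IsSmoothOn s W := (tangentE K B).IsSmoothOn (fun p => (s p).1.1) W ∧
    (pullbackE B L).IsSmoothOn (fun p => (s p).1.2) W
  act g p := ((tangentMapK K IP IP (fun q : P => op g • q) p).prodMap
    (castL L (B.proj_act g p).symm)).restrict (act_mem_TLFiber B L g p)
  act_one p v := sigma_TLFiber_ext B L ((tangentE K B).act_one p v.1.1)
    ((pullbackE B L).act_one p v.1.2)
  act_mul g h p v := sigma_TLFiber_ext B L ((tangentE K B).act_mul g h p v.1.1)
    ((pullbackE B L).act_mul g h p v.1.2)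

variable (K) in
/-- `At(P) = (TP) / G`. -/
def At : SmoothFamily K M := (tangentE K B).quot B

/-- `At_L(P) = (T^L P) / G`. -/
def AtL : SmoothFamily K M := (TL B L).quot B

variable (K) in
/-- The anchor `At(P) → TM` induced by `Tπ : TP → TM`. -/
def atAnchor : FibreMap (At K B) (tangentK K IM M) :=
  EquivariantFamily.descend (A := tangentE K B) B (W := fun m => K ⊗[ℝ] TangentSpace IM m)
    (fun p => tangentMapK K IP IM B.proj p) (tangentMapK_proj_act B)

/-- `f_L : At_L(P) → At(P)`, induced by the projection `T^L P → TP`. -/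
def fL : FibreMap (AtL B L) (At K B) :=
  EquivariantFamily.quotMap B (A := TL B L) (A' := tangentE K B)
    (fun p => LinearMap.fst K (K ⊗[ℝ] TangentSpace IP p) (L.Fiber (B.proj p)) ∘ₗ
      (TLFiber B L p).subtype) (fun _ _ _ => rfl)

/-- `σ_L : At_L(P) → L`, induced by the projection `T^L P → π^* L`. -/
def sigmaL : FibreMap (AtL B L) L.family :=
  EquivariantFamily.descend (A := TL B L) B (W := L.Fiber)
    (fun p => LinearMap.snd K (K ⊗[ℝ] TangentSpace IP p) (L.Fiber (B.proj p)) ∘ₗ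
      (TLFiber B L p).subtype) (fun g p _ => sigma_castL L (B.proj_act g p).symm _)

variable [LieGroup IG ∞ G]

variable (K) in
/-- `Ad(P) = P ×_G 𝔤_K`. -/
def Ad : SmoothFamily K M := (adjointE IG G IP P K).quot B

theorem fundamental_mem_TLFiber (p : P) (x : K ⊗[ℝ] GroupLieAlgebra IG G) :
    ((fundamental IG G IP p).baseChange K x, (0 : L.Fiber (B.proj p))) ∈ TLFiber B L p := by
  change tangentMapK K IP IM B.proj p _ = L.anchor (B.proj p) 0
  rw [map_zero, tangentMapK, ← LinearMap.comp_apply, ← LinearMap.baseChange_comp,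
    mfderiv_proj_fundamental]
  simp

/-- `P × 𝔤_K → T^L P`, sending `(p, x)` to the value at `p` of the fundamental vector field of
`x`. -/
def iotaP : FibreMap (adjointE IG G IP P K).toSmoothFamily (TL B L).toSmoothFamily :=
  fun p => LinearMap.codRestrict (TLFiber B L p)
    (LinearMap.inl K (K ⊗[ℝ] TangentSpace IP p) (L.Fiber (B.proj p)) ∘ₗ
      (fundamental IG G IP p).baseChange K) (fundamental_mem_TLFiber B L p)

theorem isEquivariant_iotaP : IsEquivariant (iotaP B L) := by
  intro g p x
  refine Subtype.ext (Prod.ext ?_ ?_)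
  · have := congrArg (fun l : GroupLieAlgebra IG G →ₗ[ℝ] TangentSpace IP (op g • p) =>
      l.baseChange K x) (fundamental_act B g p)
    simp only [LinearMap.baseChange_comp] at this
    exact this
  · exact (map_zero (castL L (B.proj_act g p).symm)).symm

/-- `ι : Ad(P) → At_L(P)`. -/
def iota : FibreMap (Ad K B) (AtL B L) :=
  EquivariantFamily.quotMap B (iotaP B L) (isEquivariant_iotaP B L)

/-! ### The equivalent data -/

/-- `L`-connections on `P`: `G`-equivariant vector bundle maps `h : π^* L → TP` over `P` such that
`Tπ ∘ h` is the anchor. -/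
def Connection : Type _ :=
  {h : FibreMap (pullbackE B L).toSmoothFamily (tangentE K B).toSmoothFamily //
    IsBundleMap h ∧ IsEquivariant h ∧
    ∀ (p : P) (l : L.Fiber (B.proj p)),
      tangentMapK K IP IM B.proj p (h p l) = L.anchor (B.proj p) l}

/-- Vector bundle maps `s : L → At_L(P)` with `σ_L ∘ s = id`. -/
def RightSplitting : Type _ :=
  {s : FibreMap L.family (AtL B L) // IsBundleMap s ∧ ∀ m l, sigmaL B L m (s m l) = l}

/-- Vector bundle maps `θ : At_L(P) → Ad(P)` with `θ ∘ ι = id`. -/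
def LeftSplitting : Type _ :=
  {θ : FibreMap (AtL B L) (Ad K B) // IsBundleMap θ ∧ ∀ m a, θ m (iota B L m a) = a}

/-- Vector bundle isomorphisms `Φ : At_L(P) → Ad(P) ⊕ L` under which `ι` becomes the inclusion of
`Ad(P)` and the restriction of `σ_L` to `L` becomes the identity. -/
def Decomposition : Type _ :=
  {Φ : ∀ m, (AtL B L).Fiber m ≃ₗ[K] ((Ad K B).sum L.family).Fiber m //
    IsBundleMap (A := AtL B L) (B := (Ad K B).sum L.family) (fun m => (Φ m).toLinearMap) ∧
    IsBundleMap (A := (Ad K B).sum L.family) (B := AtL B L) (fun m => (Φ m).symm.toLinearMap) ∧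
    (∀ m a, Φ m (iota B L m a) = (a, 0)) ∧
    ∀ m l, sigmaL B L m ((Φ m).symm (0, l)) = l}

/-- Vector bundle maps `s̄ : L → At(P)` whose composition with `At(P) → TM` is the anchor. -/
def AnchoredMap : Type _ :=
  {s : FibreMap L.family (At K B) // IsBundleMap s ∧ ∀ m l, atAnchor K B m (s m l) = L.anchor m l}

end Atiyah

end Principal

end

end LAtiyah

open LAtiyah

namespace LAtiyah

noncomputable section

universe u v w w'

/-! ### Families with local frames are vector bundles -/

section LocalFrames

variable {K : Type*} [RCLike K] {E H : Type*} [NormedAddCommGroup E] [NormedSpace ℝ E]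
  [TopologicalSpace H] {I : ModelWithCorners ℝ E H} {X : Type*} [TopologicalSpace X]
  [ChartedSpace H X]

/-! Everything local rests on one construction. A local trivialization over `U` has a group
component `t.grp` on `π⁻¹(U)`. Differentiating `q ↦ t.grp q * (t.grp p)⁻¹` at `q = p` gives a
𝔤-valued form `t.form p`. Unlike a connection form in the usual convention, it is invariant under
right translations and not merely Ad-equivariant, so its values on invariant vector fields descend
to functions on the base. Together with `Tπ` it identifies `T_pP` with `T_{π(p)}M × 𝔤`, the inverse
being `t.lift p`. Both directions depend smoothly on `p`, because derivatives of a smooth family of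
maps are smooth in the parameter (`contMDiffOn_mfderiv_param`). Hence a section of `T_K P` is smooth
exactly when its projection and its form value are (`tangentK_isSmoothOn_iff`).

This yields frames with `G`-invariant coordinates. For `TP` one uses coordinates on `TM` and the
form. For `T^LP` coordinates on `L` replace those on `TM`, the projection to `TM` being then
determined by the smooth anchor. For `P × 𝔤` one uses the form on fundamental vectors, where it is
`Ad_{t.grp p}` and so invertible. Invariant frames descend to the quotient (`quotFrame`), since a
function on `U` is smooth if and only if its pullback to `π⁻¹(U)` is, as the local section `t.sec`
shows. A family with local frames whose smooth sections are detected by coordinates is a smooth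
vector bundle (`SmoothFamily.IsLocallyFree.isVectorBundle`).

A point `p` over `m` identifies the fibres at `m` of `Ad(P)`, `At(P)`, `At_L(P)` with `𝔤_K`, `T_pP`,
`(T^LP)_p`. The pullback property is then the definition of `T^LP`, and exactness says that the
vectors killed by `Tπ` are the fundamental ones.

The correspondences are linear algebra in each fibre; only smoothness needs thought. A connection is
tested on frames of `π^*L` pulled back from `M`, where invariance reduces it to smoothness of `s̄`.
A right splitting is smooth when its two pullback components are. The left splitting attached to `s`
is smooth because `ι` reflects smoothness of sections (`isSmoothOn_iota_iff`). Conversely, `s` built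
from `θ` is smooth because smooth sections of `L` lift locally to `At_L(P)` (`exists_lift_sigmaL`).
-/

/-- A frame over `U` of a family with smooth sections, given by the coordinates and the linear
combinations: a section is smooth if and only if its coordinates are. -/
structure FrameOn (A : SmoothFamily K X) (I : ModelWithCorners ℝ E H) (ι : Type*) [Fintype ι]
    (U : Set X) where
  coord : ∀ x, A.Fiber x →ₗ[K] (ι → K)
  comb : ∀ x, (ι → K) →ₗ[K] A.Fiber x
  comb_coord : ∀ x ∈ U, ∀ v, comb x (coord x v) = v
  coord_comb : ∀ x ∈ U, ∀ c, coord x (comb x c) = c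
  smooth_iff : ∀ W ⊆ U, IsOpen W → ∀ s, A.IsSmoothOn s W ↔
    ContMDiffOn I 𝓘(ℝ, ι → K) ∞ (fun x => coord x (s x)) W

/-- Smoothness of sections of `A` is a local property. -/
structure SmoothFamily.IsLocal (A : SmoothFamily K X) : Prop where
  mono : ∀ {s : ∀ x, A.Fiber x} {U V : Set X}, A.IsSmoothOn s U → V ⊆ U → A.IsSmoothOn s V
  of_forall_nhds : ∀ {s : ∀ x, A.Fiber x} {U : Set X},
    (∀ x ∈ U, ∃ V, IsOpen V ∧ x ∈ V ∧ A.IsSmoothOn s V) → A.IsSmoothOn s U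

/-- Smoothness of sections of `A` is local, and `A` has local frames indexed by `ι`. -/
structure SmoothFamily.IsLocallyFree (A : SmoothFamily K X) (I : ModelWithCorners ℝ E H)
    (ι : Type*) [Fintype ι] : Prop extends A.IsLocal where
  exists_frame : ∀ x, ∃ U, IsOpen U ∧ x ∈ U ∧ Nonempty (FrameOn A I ι U)

theorem contMDiffOn_of_forall_nhds {E' H' : Type*} [NormedAddCommGroup E'] [NormedSpace ℝ E']
    [TopologicalSpace H'] {I' : ModelWithCorners ℝ E' H'} {Y : Type*} [TopologicalSpace Y]
    [ChartedSpace H' Y] {f : X → Y} {U : Set X}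
    (h : ∀ x ∈ U, ∃ V, IsOpen V ∧ x ∈ V ∧ ContMDiffOn I I' ∞ f V) : ContMDiffOn I I' ∞ f U := by
  intro x hx
  obtain ⟨V, hV, hxV, hf⟩ := h x hx
  exact (hf.contMDiffAt (hV.mem_nhds hxV)).contMDiffWithinAt

/-- A basis of the finite-dimensional source turns an operator-valued map into a finite tuple of
vector-valued maps. This upgrades pointwise smoothness of transition functions to smoothness as maps
into the space of operators. -/
theorem contMDiffOn_clm_of_apply {F F' : Type*} [NormedAddCommGroup F] [NormedSpace ℝ F]
    [NormedAddCommGroup F'] [NormedSpace ℝ F'] [FiniteDimensional ℝ F] {f : X → F →L[ℝ] F'}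
    {U : Set X} (h : ∀ y, ContMDiffOn I 𝓘(ℝ, F') ∞ (fun x => f x y) U) :
    ContMDiffOn I 𝓘(ℝ, F →L[ℝ] F') ∞ f U := by
  let d := Module.finrank ℝ F
  have hd : d = Module.finrank ℝ (Fin d → ℝ) := (Module.finrank_fin_fun ℝ).symm
  let e₁ := ContinuousLinearEquiv.ofFinrankEq hd
  let e₂ := (e₁.arrowCongr (1 : F' ≃L[ℝ] F')).trans (ContinuousLinearEquiv.piRing (Fin d))
  have h2 : ContMDiffOn I 𝓘(ℝ, Fin d → F') ∞ (e₂ ∘ f) U := by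
    refine contMDiffOn_pi_space.2 fun i => ?_
    exact h (e₁.symm (Pi.single i 1))
  have h3 := (e₂.symm.contDiff (n := ∞)).contMDiff.comp_contMDiffOn h2
  exact h3.congr fun x _ => (e₂.symm_apply_apply (f x)).symm

namespace FrameOn

variable {A : SmoothFamily.{_, _, w} K X} {ι : Type*} [Fintype ι] {U U' : Set X}

/-- The transition functions between frames are smooth. -/
theorem contMDiffOn_coord_comb (e : FrameOn A I ι U) {ι' : Type*} [Fintype ι']
    (e' : FrameOn A I ι' U') (hU : IsOpen U) (hU' : IsOpen U') (c : ι → K) :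
    ContMDiffOn I 𝓘(ℝ, ι' → K) ∞ (fun x => e'.coord x (e.comb x c)) (U ∩ U') := by
  -- The combination with constant coefficients `c` is a smooth section by the criterion for `e`;
  -- the criterion for `e'` then makes its other coordinates smooth.
  rw [← e'.smooth_iff _ Set.inter_subset_right (hU.inter hU') (fun x => e.comb x c),
    e.smooth_iff _ Set.inter_subset_left (hU.inter hU')]
  exact (contMDiffOn_const (c := c)).congr fun x hx => e.coord_comb x hx.1 c

/-- The frame indexed by `ι'` obtained from a bijection `ι ≃ ι'`. -/
def reindex (e : FrameOn A I ι U) {ι' : Type*} [Fintype ι'] (σ : ι ≃ ι') :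
    FrameOn A I ι' U where
  coord x := (LinearEquiv.funCongrLeft K K σ.symm).toLinearMap ∘ₗ e.coord x
  comb x := e.comb x ∘ₗ (LinearEquiv.funCongrLeft K K σ).toLinearMap
  comb_coord x hx v := by
    rw [← e.comb_coord x hx v]
    simp [LinearMap.funLeft, Function.comp_def, e.coord_comb x hx]
  coord_comb x hx v := by
    simp [LinearMap.funLeft, Function.comp_def, e.coord_comb x hx]
  smooth_iff W hW hWo s := by
    rw [e.smooth_iff W hW hWo, contMDiffOn_pi_space, contMDiffOn_pi_space, ← σ.forall_congr_right]
    simp [LinearMap.funLeft]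

end FrameOn

/-- The natural frames are indexed by disjoint unions, while the model fibre of a
`VectorBundleStructure` is indexed by some `Fin rank`. -/
theorem SmoothFamily.IsLocallyFree.reindex {A : SmoothFamily.{_, _, w} K X} {ι ι' : Type*}
    [Fintype ι] [Fintype ι'] (h : A.IsLocallyFree I ι) (σ : ι ≃ ι') : A.IsLocallyFree I ι' where
  toIsLocal := h.toIsLocal
  exists_frame x := by
    obtain ⟨U, hU, hx, ⟨e⟩⟩ := h.exists_frame x
    exact ⟨U, hU, hx, ⟨e.reindex σ⟩⟩

/-! The vector bundle structure of a locally free family. -/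

section Prebundle

variable {A : SmoothFamily.{_, _, w} K X} {n : ℕ}

/-- The pretrivialization defined by a frame. -/
def FrameOn.pretrivialization {U : Set X} (e : FrameOn A I (Fin n) U) (hU : IsOpen U) :
    Pretrivialization (Fin n → K) (π (Fin n → K) A.Fiber) where
  toFun z := (z.1, e.coord z.1 z.2)
  invFun y := ⟨y.1, e.comb y.1 y.2⟩
  source := TotalSpace.proj ⁻¹' U
  target := U ×ˢ Set.univ
  map_source' z hz := ⟨hz, trivial⟩
  map_target' y hy := hy.1
  left_inv' := by
    rintro ⟨x, v⟩ hx
    simp only [e.comb_coord x hx]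
  right_inv' := by
    rintro ⟨x, c⟩ ⟨hx, -⟩
    simp only [e.coord_comb x hx]
  open_target := hU.prod isOpen_univ
  baseSet := U
  open_baseSet := hU
  source_eq := rfl
  target_eq := rfl
  proj_toFun z _ := rfl

theorem FrameOn.pretrivialization_symm_apply {U : Set X} (e : FrameOn A I (Fin n) U)
    (hU : IsOpen U) {x : X} (hx : x ∈ U) (c : Fin n → K) :
    (e.pretrivialization hU).symm x c = e.comb x c := by
  rw [Pretrivialization.symm_apply _ hx]
  rfl

variable (h : A.IsLocallyFree I (Fin n))

/-- The domain of a frame near `x`. -/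
def SmoothFamily.IsLocallyFree.dom (x : X) : Set X := (h.exists_frame x).choose

theorem SmoothFamily.IsLocallyFree.isOpen_dom (x : X) : IsOpen (h.dom x) :=
  (h.exists_frame x).choose_spec.1

theorem SmoothFamily.IsLocallyFree.mem_dom (x : X) : x ∈ h.dom x :=
  (h.exists_frame x).choose_spec.2.1

/-- A frame near `x`. -/
def SmoothFamily.IsLocallyFree.frame (x : X) : FrameOn A I (Fin n) (h.dom x) :=
  (h.exists_frame x).choose_spec.2.2.some

/-- The topology on the fibre given by the coordinates. -/
@[reducible] def SmoothFamily.IsLocallyFree.topFiber (x : X) : TopologicalSpace (A.Fiber x) :=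
  TopologicalSpace.induced ((h.frame x).coord x) inferInstance

/-- The vector prebundle over the field `R` defined by local frames. -/
@[reducible] def SmoothFamily.IsLocallyFree.prebundle (R : Type*) [NontriviallyNormedField R]
    [CompleteSpace R] [NormedSpace R (Fin n → K)] [FiniteDimensional R (Fin n → K)]
    [∀ x, Module R (A.Fiber x)]
    (hc : ∀ {U : Set X} (e : FrameOn A I (Fin n) U) x (r : R) v,
      e.coord x (r • v) = r • e.coord x v)
    (hc' : ∀ {U : Set X} (e : FrameOn A I (Fin n) U) x (r : R) v,
      e.comb x (r • v) = r • e.comb x v) :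
    letI := h.topFiber
    VectorPrebundle R (Fin n → K) A.Fiber :=
  letI := h.topFiber
  { pretrivializationAtlas := Set.range fun x => (h.frame x).pretrivialization (h.isOpen_dom x)
    pretrivialization_linear' := by
      rintro _ ⟨x, rfl⟩
      exact ⟨fun y _ => ⟨fun v w => map_add _ v w, fun r v => hc (h.frame x) y r v⟩⟩
    pretrivializationAt x := (h.frame x).pretrivialization (h.isOpen_dom x)
    mem_base_pretrivializationAt := h.mem_dom
    pretrivialization_mem_atlas x := ⟨x, rfl⟩
    exists_coordChange := by
      rintro _ ⟨x, rfl⟩ _ ⟨x', rfl⟩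
      let f (b : X) : (Fin n → K) →ₗ[R] (Fin n → K) :=
        { toFun c := (h.frame x').coord b ((h.frame x).comb b c)
          map_add' := by simp
          map_smul' r c := by simp [hc, hc'] }
      refine ⟨fun b => (f b).toContinuousLinearMap, ?_, ?_⟩
      -- The model fibre is finite-dimensional over `R`, so continuity in operator norm is
      -- continuity on each vector.
      · rw [continuousOn_clm_apply]
        intro c
        exact ((h.frame x).contMDiffOn_coord_comb (h.frame x') (h.isOpen_dom x) (h.isOpen_dom x')
          c).continuousOn
      · rintro b ⟨hb, -⟩ c
        exact congrArg (fun z => (h.frame x').coord b z)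
          ((h.frame x).pretrivialization_symm_apply (h.isOpen_dom x) hb c).symm
    -- The fibre topology is induced by the coordinates of the frame chosen at the same point `x`,
    -- so the fibre inclusion read in that frame is inducing.
    totalSpaceMk_isInducing x :=
      (isInducing_prodMkRight x).comp ⟨rfl⟩ }

theorem FrameOn.coord_real_smul {U : Set X} (e : FrameOn A I (Fin n) U) (x : X) (r : ℝ)
    (v : A.Fiber x) : letI := realModule K (A.Fiber x)
    e.coord x (r • v) = r • e.coord x v := by
  let := realModule K (A.Fiber x)
  have : r • v = (algebraMap ℝ K r) • v := rfl
  rw [this, map_smul, algebraMap_smul]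

theorem FrameOn.comb_real_smul {U : Set X} (e : FrameOn A I (Fin n) U) (x : X) (r : ℝ)
    (c : Fin n → K) : letI := realModule K (A.Fiber x)
    e.comb x (r • c) = r • e.comb x c := by
  let := realModule K (A.Fiber x)
  have : ∀ v : A.Fiber x, r • v = (algebraMap ℝ K r) • v := fun _ => rfl
  rw [this, ← map_smul, algebraMap_smul]

/-- The vector prebundle over `K` defined by local frames. -/
@[reducible] def SmoothFamily.IsLocallyFree.prebundleK : letI := h.topFiber
    VectorPrebundle K (Fin n → K) A.Fiber :=
  h.prebundle K (fun e x r v => map_smul (e.coord x) r v) (fun e x r v => map_smul (e.comb x) r v)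

/-- The vector prebundle over `ℝ` defined by local frames. -/
@[reducible] def SmoothFamily.IsLocallyFree.prebundleR : letI := h.topFiber
    letI : ∀ x, Module ℝ (A.Fiber x) := fun x => realModule K (A.Fiber x)
    VectorPrebundle ℝ (Fin n → K) A.Fiber :=
  letI : ∀ x, Module ℝ (A.Fiber x) := fun x => realModule K (A.Fiber x)
  h.prebundle ℝ (fun e x r v => e.coord_real_smul x r v) (fun e x r v => e.comb_real_smul x r v)

theorem SmoothFamily.IsLocallyFree.isContMDiff_prebundleR : letI := h.topFiber
    letI : ∀ x, Module ℝ (A.Fiber x) := fun x => realModule K (A.Fiber x)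
    h.prebundleR.IsContMDiff I ∞ := by
  let := h.topFiber
  let : ∀ x, Module ℝ (A.Fiber x) := fun x => realModule K (A.Fiber x)
  constructor
  rintro _ ⟨x, rfl⟩ _ ⟨x', rfl⟩
  let f (b : X) : (Fin n → K) →ₗ[ℝ] (Fin n → K) :=
    { toFun c := (h.frame x').coord b ((h.frame x).comb b c)
      map_add' := by simp
      map_smul' r c := by simp [FrameOn.coord_real_smul, FrameOn.comb_real_smul] }
  refine ⟨fun b => (f b).toContinuousLinearMap, ?_, ?_⟩
  · refine contMDiffOn_clm_of_apply fun c => ?_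
    exact (h.frame x).contMDiffOn_coord_comb (h.frame x') (h.isOpen_dom x) (h.isOpen_dom x') c
  · rintro b ⟨hb, -⟩ c
    exact congrArg (fun z => (h.frame x').coord b z)
      ((h.frame x).pretrivialization_symm_apply (h.isOpen_dom x) hb c).symm

/-- The vector bundle structure defined by local frames. -/
def SmoothFamily.IsLocallyFree.vectorBundleStructure : VectorBundleStructure K I A.Fiber :=
  letI := h.topFiber
  { rank := n
    topTotal := h.prebundleK.totalSpaceTopology
    topFiber := h.topFiber
    fiberBundle := h.prebundleK.toFiberBundle
    linear := h.prebundleK.toVectorBundle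
    -- The prebundles over `K` and over `ℝ` have the same pretrivializations, so the topology and
    -- fibre bundle structure taken from the first serve the second as well.
    linearReal := by
      let : ∀ x, Module ℝ (A.Fiber x) := fun x => realModule K (A.Fiber x)
      exact h.prebundleR.toVectorBundle
    smooth := by
      let : ∀ x, Module ℝ (A.Fiber x) := fun x => realModule K (A.Fiber x)
      have := h.isContMDiff_prebundleR
      exact h.prebundleR.contMDiffVectorBundle I }

/-- Inside the domain of the chosen frame at `x`, both notions say that the coordinates in that
frame are smooth, because `trivializationAt` at `x` is the trivialization built from it. Both
notions are local, which gives the general case. -/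
theorem SmoothFamily.IsLocallyFree.isSmoothOn_iff (U : Set X) (hU : IsOpen U)
    (s : ∀ x, A.Fiber x) :
    A.IsSmoothOn s U ↔ h.vectorBundleStructure.IsSmoothAlong I id s U := by
  let := h.topFiber
  let : ∀ x, Module ℝ (A.Fiber x) := fun x => realModule K (A.Fiber x)
  let := h.prebundleR.totalSpaceTopology
  let := h.prebundleR.toFiberBundle
  have : VectorBundle ℝ (Fin n → K) A.Fiber := h.prebundleR.toVectorBundle
  have := h.isContMDiff_prebundleR
  have : ContMDiffVectorBundle ∞ (Fin n → K) A.Fiber I := h.prebundleR.contMDiffVectorBundle I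
  have key (x : X) (W : Set X) (hW : IsOpen W) (hWx : W ⊆ h.dom x) : A.IsSmoothOn s W ↔
      ContMDiffOn I (I.prod 𝓘(ℝ, Fin n → K)) ∞
        (fun y => (⟨y, s y⟩ : TotalSpace (Fin n → K) A.Fiber)) W := by
    rw [(h.frame x).smooth_iff W hWx hW]
    have : MemTrivializationAtlas (trivializationAt (Fin n → K) A.Fiber x) :=
      ⟨trivialization_mem_atlas _ _ x⟩
    exact ((trivializationAt (Fin n → K) A.Fiber x).contMDiffOn_section_iff hW hWx).symm
  change _ ↔ ContMDiffOn I (I.prod 𝓘(ℝ, Fin n → K)) ∞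
    (fun y => (⟨y, s y⟩ : TotalSpace (Fin n → K) A.Fiber)) U
  constructor
  · intro hs
    refine contMDiffOn_of_forall_nhds fun x hx => ⟨U ∩ h.dom x, hU.inter (h.isOpen_dom x),
      ⟨hx, h.mem_dom x⟩, ?_⟩
    exact (key x _ (hU.inter (h.isOpen_dom x)) Set.inter_subset_right).1
      (h.mono hs Set.inter_subset_left)
  · intro hs
    refine h.of_forall_nhds fun x hx => ⟨U ∩ h.dom x, hU.inter (h.isOpen_dom x),
      ⟨hx, h.mem_dom x⟩, ?_⟩
    exact (key x _ (hU.inter (h.isOpen_dom x)) Set.inter_subset_right).2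
      (hs.mono Set.inter_subset_left)

end Prebundle

theorem SmoothFamily.IsLocallyFree.isVectorBundle {A : SmoothFamily.{_, _, w} K X} {ι : Type*}
    [Fintype ι] (h : A.IsLocallyFree I ι) : A.IsVectorBundle I :=
  ⟨(h.reindex (Fintype.equivFin ι)).vectorBundleStructure,
    (h.reindex (Fintype.equivFin ι)).isSmoothOn_iff⟩

end LocalFrames

end

end LAtiyah

namespace LAtiyah

noncomputable section

universe u v w w'

/-! ### Sections along a map in local coordinates -/

section Along

variable {K : Type*} [RCLike K] {E H : Type*} [NormedAddCommGroup E] [NormedSpace ℝ E]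
  [TopologicalSpace H] {I : ModelWithCorners ℝ E H} {X : Type*} [TopologicalSpace X]
  [ChartedSpace H X] {E' H' : Type*} [NormedAddCommGroup E'] [NormedSpace ℝ E']
  [TopologicalSpace H'] {I' : ModelWithCorners ℝ E' H'} {Y : Type*} [TopologicalSpace Y]
  [ChartedSpace H' Y]

namespace VectorBundleStructure

variable {V : X → Type*} [∀ x, AddCommGroup (V x)] [∀ x, Module K (V x)]
  (S : VectorBundleStructure K I V)

/-- The domain of a trivialization near `x₀`. -/
def dom (x₀ : X) : Set X :=
  letI := S.topTotal
  letI := S.topFiber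
  letI := S.fiberBundle
  (trivializationAt (Fin S.rank → K) V x₀).baseSet

theorem isOpen_dom (x₀ : X) : IsOpen (S.dom x₀) :=
  letI := S.topTotal
  letI := S.topFiber
  letI := S.fiberBundle
  (trivializationAt (Fin S.rank → K) V x₀).open_baseSet

theorem mem_dom (x₀ : X) : x₀ ∈ S.dom x₀ :=
  letI := S.topTotal
  letI := S.topFiber
  letI := S.fiberBundle
  mem_baseSet_trivializationAt _ _ x₀

/-- The coordinates of a trivialization near `x₀`. -/
def coord (x₀ x : X) : V x →ₗ[K] (Fin S.rank → K) :=
  letI := S.topTotal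
  letI := S.topFiber
  letI := S.fiberBundle
  letI := S.linear
  (trivializationAt (Fin S.rank → K) V x₀).linearMapAt K x

/-- The linear combinations in the local frame given by a trivialization near `x₀`. -/
def comb (x₀ x : X) : (Fin S.rank → K) →ₗ[K] V x :=
  letI := S.topTotal
  letI := S.topFiber
  letI := S.fiberBundle
  letI := S.linear
  (trivializationAt (Fin S.rank → K) V x₀).symmₗ K x

theorem comb_coord {x₀ x : X} (hx : x ∈ S.dom x₀) (v : V x) :
    S.comb x₀ x (S.coord x₀ x v) = v :=
  letI := S.topTotal
  letI := S.topFiber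
  letI := S.fiberBundle
  letI := S.linear
  Trivialization.symmₗ_linearMapAt _ hx v

theorem coord_comb {x₀ x : X} (hx : x ∈ S.dom x₀) (c : Fin S.rank → K) :
    S.coord x₀ x (S.comb x₀ x c) = c :=
  letI := S.topTotal
  letI := S.topFiber
  letI := S.fiberBundle
  letI := S.linear
  Trivialization.linearMapAt_symmₗ _ hx c

theorem isSmoothAlong_iff {x₀ : X} {f : Y → X} {W : Set Y} (hf : ContMDiffOn I' I ∞ f W)
    (hW : W ⊆ f ⁻¹' S.dom x₀) (s : ∀ y, V (f y)) : S.IsSmoothAlong I' f s W ↔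
      ContMDiffOn I' 𝓘(ℝ, Fin S.rank → K) ∞ (fun y => S.coord x₀ (f y) (s y)) W := by
  let := S.topTotal
  let := S.topFiber
  let := S.fiberBundle
  have := S.linear
  let : ∀ x, Module ℝ (V x) := fun x => realModule K (V x)
  have := S.linearReal
  have := S.smooth
  have h := (trivializationAt (Fin S.rank → K) V x₀).contMDiffOn_iff (IM := I') (IB := I)
    (n := ∞) (f := fun y => (⟨f y, s y⟩ : TotalSpace (Fin S.rank → K) V)) (s := W)
    (fun y hy => (Trivialization.mem_source _).2 (hW hy))
  -- Smoothness into the total space splits into smoothness of the base map, which is `hf`, and of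
  -- the fibre coordinate.
  refine h.trans ((and_iff_right hf).trans (contMDiffOn_congr fun y hy => ?_))
  exact Trivialization.coe_linearMapAt_of_mem _ (R := K) (hW hy) ▸ rfl

theorem IsSmoothAlong.mono {S : VectorBundleStructure K I V} {f : Y → X} {s : ∀ y, V (f y)}
    {W W' : Set Y} (h : S.IsSmoothAlong I' f s W) (h' : W' ⊆ W) :
    S.IsSmoothAlong I' f s W' := by
  let := S.topTotal
  let := S.topFiber
  let := S.fiberBundle
  exact ContMDiffOn.mono (f := fun y => (⟨f y, s y⟩ : TotalSpace (Fin S.rank → K) V)) h h'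

theorem isSmoothAlong_of_forall_nhds {f : Y → X} {s : ∀ y, V (f y)} {W : Set Y}
    (h : ∀ y ∈ W, ∃ W', IsOpen W' ∧ y ∈ W' ∧ S.IsSmoothAlong I' f s W') :
    S.IsSmoothAlong I' f s W := by
  let := S.topTotal
  let := S.topFiber
  let := S.fiberBundle
  exact contMDiffOn_of_forall_nhds h

end VectorBundleStructure

/-! ### Complexified vectors in coordinates -/

section Tensor

variable {V ι : Type*} [AddCommGroup V] [Module ℝ V] [Fintype ι] (b : Module.Basis ι ℝ V)

variable (K) in
/-- The coordinates of `K ⊗ V` given by a basis of `V`. -/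
def tensorCoord : K ⊗[ℝ] V ≃ₗ[K] (ι → K) := (Algebra.TensorProduct.basis K b).equivFun

theorem re_tensorCoord (z : K ⊗[ℝ] V) (i : ι) :
    RCLike.re (tensorCoord K b z i) = b.coord i (tensorRe K V z) := by
  induction z with
  | zero => simp
  | tmul a v => simp [tensorCoord, tensorRe, mul_comm]
  | add z w hz hw => simp only [map_add, Pi.add_apply, hz, hw]

theorem im_tensorCoord (z : K ⊗[ℝ] V) (i : ι) :
    RCLike.im (tensorCoord K b z i) = b.coord i (tensorIm K V z) := by
  induction z with
  | zero => simp
  | tmul a v => simp [tensorCoord, tensorIm, mul_comm]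
  | add z w hz hw => simp only [map_add, Pi.add_apply, hz, hw]

theorem tensorCoord_apply (z : K ⊗[ℝ] V) (i : ι) : tensorCoord K b z i =
    (b.coord i (tensorRe K V z) : K) + (b.coord i (tensorIm K V z) : K) * RCLike.I := by
  rw [← re_tensorCoord, ← im_tensorCoord, RCLike.re_add_im]

/-- Naturality of the real part; with its imaginary counterpart it reduces smoothness questions
about a base-changed map to the underlying real map. -/
theorem tensorRe_baseChange {V' : Type*} [AddCommGroup V'] [Module ℝ V'] (f : V →ₗ[ℝ] V')
    (z : K ⊗[ℝ] V) : tensorRe K V' (f.baseChange K z) = f (tensorRe K V z) := by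
  induction z with
  | zero => simp
  | tmul a v => simp [tensorRe]
  | add z w hz hw => simp only [map_add, hz, hw]

theorem tensorIm_baseChange {V' : Type*} [AddCommGroup V'] [Module ℝ V'] (f : V →ₗ[ℝ] V')
    (z : K ⊗[ℝ] V) : tensorIm K V' (f.baseChange K z) = f (tensorIm K V z) := by
  induction z with
  | zero => simp
  | tmul a v => simp [tensorIm]
  | add z w hz hw => simp only [map_add, hz, hw]

/-- A map to `K ⊗ V` has smooth coordinates if and only if its real and imaginary parts are
smooth. -/
theorem contMDiffOn_tensorCoord_iff {F ι : Type*} [NormedAddCommGroup F] [NormedSpace ℝ F]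
    [Fintype ι] (b : Module.Basis ι ℝ F) {s : Y → K ⊗[ℝ] F} {W : Set Y} :
    ContMDiffOn I' 𝓘(ℝ, ι → K) ∞ (fun y => tensorCoord K b (s y)) W ↔
      ContMDiffOn I' 𝓘(ℝ, F) ∞ (fun y => tensorRe K F (s y)) W ∧
      ContMDiffOn I' 𝓘(ℝ, F) ∞ (fun y => tensorIm K F (s y)) W := by
  have : FiniteDimensional ℝ F := b.finiteDimensional_of_finite
  have hb (g : Y → F) : ContMDiffOn I' 𝓘(ℝ, F) ∞ g W ↔
      ∀ i, ContMDiffOn I' 𝓘(ℝ, ℝ) ∞ (fun y => b.coord i (g y)) W := by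
    constructor
    · intro hg i
      exact (b.coord i).toContinuousLinearMap.contMDiff.comp_contMDiffOn hg
    · intro hg
      have : ContMDiffOn I' 𝓘(ℝ, F) ∞ (fun y => ∑ i, b.coord i (g y) • b i) W :=
        contMDiffOn_finsetSum fun i _ => (hg i).smul contMDiffOn_const
      exact this.congr fun y _ => (b.sum_repr (g y)).symm
  rw [contMDiffOn_pi_space, hb, hb, ← forall_and]
  refine forall_congr' fun i => ?_
  constructor
  · intro h
    refine ⟨?_, ?_⟩
    · simp only [← re_tensorCoord]
      exact (RCLike.reCLM (K := K)).contMDiff.comp_contMDiffOn h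
    · simp only [← im_tensorCoord]
      exact (RCLike.imCLM (K := K)).contMDiff.comp_contMDiffOn h
  · rintro ⟨h1, h2⟩
    simp only [tensorCoord_apply]
    refine ((RCLike.ofRealCLM (K := K)).contMDiff.comp_contMDiffOn h1).add ?_
    have h3 := (((ContinuousLinearMap.mul ℝ K).flip RCLike.I) ∘L
      RCLike.ofRealCLM (K := K)).contMDiff.comp_contMDiffOn h2
    exact h3

end Tensor

/-! ### Local coordinates for the tangent bundle with coefficients in `K` along a map. -/

section TangentAlong

variable [IsManifold I ∞ X]

variable (I) in
/-- Smoothness on `W` of a section `s` of `T_K X` along `f`. -/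
def TangentSmoothAlong (I' : ModelWithCorners ℝ E' H') (f : Y → X)
    (s : ∀ y, K ⊗[ℝ] TangentSpace I (f y)) (W : Set Y) : Prop :=
  have : IsManifold I 1 X := IsManifold.of_le (n := ∞) (by simp)
  ContMDiffOn I' I.tangent ∞
    (fun y => (⟨f y, tensorRe K (TangentSpace I (f y)) (s y)⟩ : TangentBundle I X)) W ∧
  ContMDiffOn I' I.tangent ∞
    (fun y => (⟨f y, tensorIm K (TangentSpace I (f y)) (s y)⟩ : TangentBundle I X)) W

theorem TangentSmoothAlong.mono {f : Y → X} {s : ∀ y, K ⊗[ℝ] TangentSpace I (f y)}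
    {W W' : Set Y} (h : TangentSmoothAlong I I' f s W) (h' : W' ⊆ W) :
    TangentSmoothAlong I I' f s W' :=
  ⟨h.1.mono h', h.2.mono h'⟩

theorem tangentSmoothAlong_of_forall_nhds {f : Y → X} {s : ∀ y, K ⊗[ℝ] TangentSpace I (f y)}
    {W : Set Y} (h : ∀ y ∈ W, ∃ W', IsOpen W' ∧ y ∈ W' ∧ TangentSmoothAlong I I' f s W') :
    TangentSmoothAlong I I' f s W := by
  constructor
  · exact contMDiffOn_of_forall_nhds fun y hy =>
      let ⟨W', h1, h2, h3⟩ := h y hy; ⟨W', h1, h2, h3.1⟩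
  · exact contMDiffOn_of_forall_nhds fun y hy =>
      let ⟨W', h1, h2, h3⟩ := h y hy; ⟨W', h1, h2, h3.2⟩

theorem TangentSmoothAlong.comp {E'' H'' : Type*}
    [NormedAddCommGroup E''] [NormedSpace ℝ E''] [TopologicalSpace H'']
    {I'' : ModelWithCorners ℝ E'' H''} {Z : Type*} [TopologicalSpace Z] [ChartedSpace H'' Z]
    {f : Y → X} {s : ∀ y, K ⊗[ℝ] TangentSpace I (f y)} {W : Set Y}
    (h : TangentSmoothAlong I I' f s W) {g : Z → Y}
    {W' : Set Z} (hg : ContMDiffOn I'' I' ∞ g W') (hgW : W' ⊆ g ⁻¹' W) :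
    TangentSmoothAlong I I'' (f ∘ g) (fun z => s (g z)) W' :=
  ⟨h.1.comp hg hgW, h.2.comp hg hgW⟩

variable (K I) in
/-- The coordinates of `T_K X` given by a chart at `x₀`. -/
def tangentCoord [FiniteDimensional ℝ E] (x₀ x : X) :
    K ⊗[ℝ] TangentSpace I x →ₗ[K] (Fin (Module.finrank ℝ E) → K) :=
  have : IsManifold I 1 X := IsManifold.of_le (n := ∞) (by simp)
  (tensorCoord K (Module.finBasis ℝ E)).toLinearMap ∘ₗ
    ((trivializationAt E (TangentSpace I : X → Type _) x₀).linearMapAt ℝ x).baseChange K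

variable (K I) in
/-- The linear combinations in the frame of `T_K X` given by a chart at `x₀`. -/
def tangentComb [FiniteDimensional ℝ E] (x₀ x : X) :
    (Fin (Module.finrank ℝ E) → K) →ₗ[K] K ⊗[ℝ] TangentSpace I x :=
  have : IsManifold I 1 X := IsManifold.of_le (n := ∞) (by simp)
  ((trivializationAt E (TangentSpace I : X → Type _) x₀).symmₗ ℝ x).baseChange K ∘ₗ
    (tensorCoord K (Module.finBasis ℝ E)).symm.toLinearMap

variable [FiniteDimensional ℝ E]

theorem tangentComb_coord {x₀ x : X} (hx : x ∈ (chartAt H x₀).source)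
    (v : K ⊗[ℝ] TangentSpace I x) : tangentComb K I x₀ x (tangentCoord K I x₀ x v) = v := by
  have : IsManifold I 1 X := IsManifold.of_le (n := ∞) (by simp)
  have h : (trivializationAt E (TangentSpace I : X → Type _) x₀).symmₗ ℝ x ∘ₗ
      (trivializationAt E (TangentSpace I : X → Type _) x₀).linearMapAt ℝ x = LinearMap.id :=
    LinearMap.ext fun v => Trivialization.symmₗ_linearMapAt _ (by simpa using hx) v
  simp only [tangentComb, tangentCoord, LinearMap.comp_apply, LinearEquiv.coe_coe,
    LinearEquiv.symm_apply_apply]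
  rw [← LinearMap.comp_apply, ← LinearMap.baseChange_comp, h, LinearMap.baseChange_id]
  rfl

theorem tangentCoord_comb {x₀ x : X} (hx : x ∈ (chartAt H x₀).source)
    (c : Fin (Module.finrank ℝ E) → K) :
    tangentCoord K I x₀ x (tangentComb K I x₀ x c) = c := by
  have : IsManifold I 1 X := IsManifold.of_le (n := ∞) (by simp)
  have h : (trivializationAt E (TangentSpace I : X → Type _) x₀).linearMapAt ℝ x ∘ₗ
      (trivializationAt E (TangentSpace I : X → Type _) x₀).symmₗ ℝ x = LinearMap.id :=
    LinearMap.ext fun v => Trivialization.linearMapAt_symmₗ _ (by simpa using hx) v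
  simp only [tangentComb, tangentCoord, LinearMap.comp_apply, LinearEquiv.coe_coe]
  rw [← LinearMap.comp_apply (LinearMap.baseChange K _), ← LinearMap.baseChange_comp, h,
    LinearMap.baseChange_id]
  exact LinearEquiv.apply_symm_apply _ _

theorem tangentSmoothAlong_iff {x₀ : X} {f : Y → X} {W : Set Y} (hf : ContMDiffOn I' I ∞ f W)
    (hW : W ⊆ f ⁻¹' (chartAt H x₀).source) (s : ∀ y, K ⊗[ℝ] TangentSpace I (f y)) :
    TangentSmoothAlong I I' f s W ↔ ContMDiffOn I' 𝓘(ℝ, Fin (Module.finrank ℝ E) → K) ∞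
      (fun y => tangentCoord K I x₀ (f y) (s y)) W := by
  have : IsManifold I 1 X := IsManifold.of_le (n := ∞) (by simp)
  have key (v : ∀ y, TangentSpace I (f y)) : ContMDiffOn I' I.tangent ∞
      (fun y => (⟨f y, v y⟩ : TangentBundle I X)) W ↔ ContMDiffOn I' 𝓘(ℝ, E) ∞
      (fun y => (trivializationAt E (TangentSpace I : X → Type _) x₀).linearMapAt ℝ (f y) (v y))
      W := by
    have h := (trivializationAt E (TangentSpace I : X → Type _) x₀).contMDiffOn_iff
      (IM := I') (IB := I) (n := ∞) (f := fun y => (⟨f y, v y⟩ : TangentBundle I X)) (s := W)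
      (fun y hy => (Trivialization.mem_source _).2 (by simpa using hW hy))
    refine h.trans ((and_iff_right hf).trans (contMDiffOn_congr fun y hy => ?_))
    rw [Trivialization.coe_linearMapAt_of_mem _ (by simpa using hW hy)]
  simp only [tangentCoord, LinearMap.comp_apply, LinearEquiv.coe_coe]
  rw [contMDiffOn_tensorCoord_iff]
  simp only [tensorRe_baseChange, tensorIm_baseChange]
  exact and_congr (key _) (key _)

end TangentAlong

end Along

end

end LAtiyah

namespace LAtiyah

noncomputable section

universe u v w w'

/-! ### Derivatives depending on parameters -/

section Derivatives

open scoped Topology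

variable {E H : Type*} [NormedAddCommGroup E] [NormedSpace ℝ E]
  [TopologicalSpace H] {I : ModelWithCorners ℝ E H} {X : Type*} [TopologicalSpace X]
  [ChartedSpace H X] {E' H' : Type*} [NormedAddCommGroup E'] [NormedSpace ℝ E']
  [TopologicalSpace H'] {I' : ModelWithCorners ℝ E' H'} {Y : Type*} [TopologicalSpace Y]
  [ChartedSpace H' Y] {E'' H'' : Type*} [NormedAddCommGroup E''] [NormedSpace ℝ E'']
  [TopologicalSpace H''] {I'' : ModelWithCorners ℝ E'' H''} {Z : Type*} [TopologicalSpace Z]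
  [ChartedSpace H'' Z]

variable (I I') in
/-- The derivative of a map between manifolds, as a map between the model spaces. -/
def modelDeriv (f : X → Y) (x : X) : E →L[ℝ] E' := mfderiv I I' f x

/-- The chain rule between fixed model spaces. Keeping `y` apart from `f x` and asking only for
equality of germs lets base points that agree only propositionally, and identities that hold only
near `x`, be used without transport. -/
theorem modelDeriv_comp {f : X → Y} {g : Y → Z} {h : X → Z} {x : X} {y : Y} (hy : f x = y)
    (hg : MDifferentiableAt I' I'' g y) (hf : MDifferentiableAt I I' f x)
    (hh : h =ᶠ[𝓝 x] g ∘ f) :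
    modelDeriv I I'' h x = (modelDeriv I' I'' g y).comp (modelDeriv I I' f x) := by
  subst hy
  have h1 := hh.mfderiv_eq (I := I) (I' := I'')
  rw [mfderiv_comp x hg hf] at h1
  exact h1

/-- Every tangent space is definitionally the model space, so one `v` makes sense at both points. -/
theorem tangentBundle_mk_congr {x y : X} (h : x = y) (v : E) :
    (⟨x, v⟩ : TangentBundle I X) = ⟨y, v⟩ := by
  subst h; rfl

variable [IsManifold I 1 X] [IsManifold I' 1 Y]

/-- The derivative of `f n` at `g n`, applied to a vector depending smoothly on `n`, depends
smoothly on `n`. -/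
theorem contMDiffOn_mfderiv_param [IsManifold I'' 1 Z] {f : Z → X → Y} {g : Z → X}
    {v : ∀ n, TangentSpace I (g n)}
    {W : Set Z} (hW : IsOpen W)
    (hf : ∀ n ∈ W, ContMDiffAt (I''.prod I) I' ∞ (Function.uncurry f) (n, g n))
    (hg : ContMDiffOn I'' I ∞ g W)
    (hv : ContMDiffOn I'' I.tangent ∞ (fun n => (⟨g n, v n⟩ : TangentBundle I X)) W) :
    ContMDiffOn I'' I'.tangent ∞
      (fun n => (⟨f n (g n), mfderiv I I' (f n) (g n) (v n)⟩ : TangentBundle I' Y)) W := by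
  intro n hn
  have hWn := hW.mem_nhds hn
  have hgn := hg.contMDiffAt hWn
  -- The derivative depends smoothly on the parameter when written in bundle coordinates around the
  -- moving source and target points; applying it to `v` then stays smooth.
  have h1 := ContMDiffAt.mfderiv (m := ∞) (n := ∞) f g (hf n hn) hgn (by simp)
  refine ContMDiffAt.contMDiffWithinAt ?_
  exact ContMDiffAt.clm_apply_of_inCoordinates (E₁ := (TangentSpace I : X → Type _))
    (E₂ := (TangentSpace I' : Y → Type _)) (b₁ := g) (b₂ := fun n => f n (g n))
    (v := v) (ϕ := fun n => mfderiv I I' (f n) (g n)) h1 (hv.contMDiffAt hWn)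
    (ContMDiffAt.comp n (hf n hn) (contMDiffAt_id.prodMk hgn))

/-- Smoothness of a map to the tangent space at a point `x`. -/
theorem contMDiffOn_tangentBundle_const_iff [IsManifold I ∞ X] (x : X) {v : Z → E} {W : Set Z} :
    ContMDiffOn I'' I.tangent ∞ (fun n => (⟨x, v n⟩ : TangentBundle I X)) W ↔
      ContMDiffOn I'' 𝓘(ℝ, E) ∞ v W := by
  have h := (trivializationAt E (TangentSpace I : X → Type _) x).contMDiffOn_iff
    (IM := I'') (IB := I) (n := ∞) (f := fun n => (⟨x, v n⟩ : TangentBundle I X)) (s := W)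
    (fun y hy => (Trivialization.mem_source _).2 (by simp))
  refine h.trans ((and_iff_right contMDiffOn_const).trans (contMDiffOn_congr fun y hy => ?_))
  -- The trivialization centred at `x` is the identity on the tangent space at `x` itself.
  exact tangentCoordChange_self (I := I) (mem_extChartAt_source x)

end Derivatives

/-! ### Local trivializations of principal bundles and their flat connection forms. -/

section Principal

open scoped Topology

variable {EM HM EG HG EP HP : Type*}
  [NormedAddCommGroup EM] [NormedSpace ℝ EM] [TopologicalSpace HM]
  [NormedAddCommGroup EG] [NormedSpace ℝ EG] [TopologicalSpace HG]
  [NormedAddCommGroup EP] [NormedSpace ℝ EP] [TopologicalSpace HP]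
  {IM : ModelWithCorners ℝ EM HM} {M : Type*} [TopologicalSpace M] [ChartedSpace HM M]
  {IG : ModelWithCorners ℝ EG HG} {G : Type*} [TopologicalSpace G] [ChartedSpace HG G] [Group G]
  {IP : ModelWithCorners ℝ EP HP} {P : Type*} [TopologicalSpace P] [ChartedSpace HP P]
  [MulAction Gᵐᵒᵖ P]

/-- A local trivialization of a principal bundle over `U`. -/
structure PrincipalBundle.LocalTriv (B : PrincipalBundle IM M IG G IP P) (U : Set M) where
  e : OpenPartialHomeomorph P (M × G)
  isOpen : IsOpen U
  source_eq : e.source = B.proj ⁻¹' U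
  target_eq : e.target = U ×ˢ Set.univ
  contMDiffOn : ContMDiffOn IP (IM.prod IG) ∞ e e.source
  contMDiffOn_symm : ContMDiffOn (IM.prod IG) IP ∞ e.symm e.target
  fst_apply : ∀ p ∈ e.source, (e p).1 = B.proj p
  apply_act : ∀ p ∈ e.source, ∀ g : G, e (op g • p) = ((e p).1, (e p).2 * g)

namespace PrincipalBundle

variable {B : PrincipalBundle IM M IG G IP P}

theorem exists_localTriv (B : PrincipalBundle IM M IG G IP P) (m : M) :
    ∃ U : Set M, IsOpen U ∧ m ∈ U ∧ Nonempty (B.LocalTriv U) := by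
  obtain ⟨U, hU, hm, e, h1, h2, h3, h4, h5, h6⟩ := B.exists_trivialization m
  exact ⟨U, hU, hm, ⟨⟨e, hU, h1, h2, h3, h4, h5, h6⟩⟩⟩

namespace LocalTriv

variable {U : Set M} (t : B.LocalTriv U)

theorem isOpen_preimage (t : B.LocalTriv U) : IsOpen (B.proj ⁻¹' U) := by
  rw [← t.source_eq]; exact t.e.open_source

/-- The component in `G` of the trivialization. -/
def grp (p : P) : G := (t.e p).2

/-- The local section given by the trivialization. -/
def sec (m : M) : P := t.e.symm (m, 1)

theorem mem_target {m : M} (hm : m ∈ U) (g : G) : (m, g) ∈ t.e.target := by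
  rw [t.target_eq]; exact ⟨hm, trivial⟩

theorem proj_symm {m : M} (hm : m ∈ U) (g : G) : B.proj (t.e.symm (m, g)) = m := by
  rw [← t.fst_apply _ (t.e.map_target (t.mem_target hm g)), t.e.right_inv (t.mem_target hm g)]

theorem grp_symm {m : M} (hm : m ∈ U) (g : G) : t.grp (t.e.symm (m, g)) = g := by
  rw [grp, t.e.right_inv (t.mem_target hm g)]

theorem symm_proj_grp {p : P} (hp : B.proj p ∈ U) : t.e.symm (B.proj p, t.grp p) = p := by
  have hp' : p ∈ t.e.source := by rw [t.source_eq]; exact hp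
  rw [← t.fst_apply p hp', grp]
  exact t.e.left_inv hp'

theorem grp_act {p : P} (hp : B.proj p ∈ U) (g : G) : t.grp (op g • p) = t.grp p * g := by
  rw [grp, t.apply_act p (by rw [t.source_eq]; exact hp) g]; rfl

theorem proj_sec {m : M} (hm : m ∈ U) : B.proj (t.sec m) = m := t.proj_symm hm 1

theorem contMDiffOn_grp : ContMDiffOn IP IG ∞ t.grp (B.proj ⁻¹' U) := by
  rw [← t.source_eq]; exact contMDiff_snd.comp_contMDiffOn t.contMDiffOn

theorem contMDiffOn_sec : ContMDiffOn IM IP ∞ t.sec U :=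
  t.contMDiffOn_symm.comp (contMDiff_id.prodMk contMDiff_const).contMDiffOn
    fun _ hm => t.mem_target hm 1

theorem contMDiffAt_grp {p : P} (hp : B.proj p ∈ U) : ContMDiffAt IP IG ∞ t.grp p :=
  t.contMDiffOn_grp.contMDiffAt (t.isOpen_preimage.mem_nhds hp)

theorem contMDiffAt_symm {x : M × G} (hx : x.1 ∈ U) :
    ContMDiffAt (IM.prod IG) IP ∞ t.e.symm x :=
  t.contMDiffOn_symm.contMDiffAt (t.e.open_target.mem_nhds (t.mem_target hx x.2))

/-- The right invariant flat connection form given by the trivialization. -/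
def form (p : P) : EP →L[ℝ] EG := modelDeriv IP IG (fun q => t.grp q * (t.grp p)⁻¹) p

/-- The inverse of the pair consisting of `Tπ` and the connection form. -/
def lift (p : P) : EM × EG →L[ℝ] EP :=
  modelDeriv (IM.prod IG) IP (fun x : M × G => t.e.symm (x.1, x.2 * t.grp p)) (B.proj p, 1)

variable [LieGroup IG ∞ G]

theorem contMDiffAt_grp_mul {p : P} (hp : B.proj p ∈ U) (g : G) :
    ContMDiffAt IP IG ∞ (fun q => t.grp q * g) p :=
  (t.contMDiffAt_grp hp).mul contMDiffAt_const

theorem contMDiffAt_symm_mul {x : M × G} (hx : x.1 ∈ U) (g : G) :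
    ContMDiffAt (IM.prod IG) IP ∞ (fun x : M × G => t.e.symm (x.1, x.2 * g)) x :=
  ContMDiffAt.comp x (t.contMDiffAt_symm (x := (x.1, x.2 * g)) hx)
    (contMDiffAt_fst.prodMk (contMDiffAt_snd.mul contMDiffAt_const))

/-- The factors `g` cancel in `t.grp (q·g) * (t.grp (p·g))⁻¹`. This invariance is why the group
component is translated back to `1` from the right. -/
theorem form_act {p : P} (hp : B.proj p ∈ U) (g : G) :
    (t.form (op g • p)).comp (modelDeriv IP IP (fun q : P => op g • q) p) = t.form p := by
  have hp' : B.proj (op g • p) ∈ U := by rwa [B.proj_act]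
  refine (modelDeriv_comp rfl ((t.contMDiffAt_grp_mul hp' _).mdifferentiableAt (by simp))
    (B.mdifferentiable_smul g p) ?_).symm
  filter_upwards [t.isOpen_preimage.mem_nhds hp] with q hq
  simp [t.grp_act hp, t.grp_act hq, mul_assoc]

/-- Along the orbit of `p` the map being differentiated is conjugation `h ↦ t.grp p * h * (t.grp
p)⁻¹`. The result is therefore `Ad_{t.grp p}`, in the inverse convention of `adInv`. -/
theorem form_fundamental {p : P} (hp : B.proj p ∈ U) (x : EG) :
    t.form p (fundamental IG G IP p x) = adInv IG G (t.grp p)⁻¹ x := by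
  have h := modelDeriv_comp (h := fun h : G => (t.grp p)⁻¹⁻¹ * h * (t.grp p)⁻¹)
    (show op (1 : G) • p = p by simp)
    ((t.contMDiffAt_grp_mul hp (t.grp p)⁻¹).mdifferentiableAt (by simp))
    (B.mdifferentiable_orbit p 1) (.of_eq (by funext h; simp [t.grp_act hp]))
  exact congrArg (fun l : EG →L[ℝ] EG => l x) h.symm

/-- The maps `x ↦ t.e.symm (x.1, x.2 * t.grp p)` and `q ↦ (π q, t.grp q * (t.grp p)⁻¹)` are mutually
inverse near `(π p, 1)` and `p`. Differentiating the two components of one composite gives this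
lemma and `form_lift`; the other composite gives `lift_proj_form`. -/
theorem proj_lift {p : P} (hp : B.proj p ∈ U) (y : EM × EG) :
    modelDeriv IP IM B.proj p (t.lift p y) = y.1 := by
  have h := modelDeriv_comp (h := (Prod.fst : M × G → M)) (x := (B.proj p, (1 : G))) (y := p)
    (by simp [t.symm_proj_grp hp]) (B.mdifferentiable_proj p)
    ((t.contMDiffAt_symm_mul (x := (B.proj p, (1 : G))) hp (t.grp p)).mdifferentiableAt (by simp))
    (by
      filter_upwards [(t.isOpen.preimage continuous_fst).mem_nhds hp] with x hx
      exact (t.proj_symm hx _).symm)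
  have h2 : modelDeriv (IM.prod IG) IM (Prod.fst : M × G → M) (B.proj p, (1 : G)) =
    ContinuousLinearMap.fst ℝ EM EG := mfderiv_fst
  rw [h2] at h
  exact congrArg (fun l : EM × EG →L[ℝ] EM => l y) h.symm

theorem form_lift {p : P} (hp : B.proj p ∈ U) (y : EM × EG) :
    t.form p (t.lift p y) = y.2 := by
  have h := modelDeriv_comp (h := (Prod.snd : M × G → G)) (x := (B.proj p, (1 : G))) (y := p)
    (by simp [t.symm_proj_grp hp])
    ((t.contMDiffAt_grp_mul hp (t.grp p)⁻¹).mdifferentiableAt (by simp))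
    ((t.contMDiffAt_symm_mul (x := (B.proj p, (1 : G))) hp (t.grp p)).mdifferentiableAt (by simp))
    (by
      filter_upwards [(t.isOpen.preimage continuous_fst).mem_nhds hp] with x hx
      simp [t.grp_symm hx])
  have h2 : modelDeriv (IM.prod IG) IG (Prod.snd : M × G → G) (B.proj p, (1 : G)) =
    ContinuousLinearMap.snd ℝ EM EG := mfderiv_snd
  rw [h2] at h
  exact congrArg (fun l : EM × EG →L[ℝ] EG => l y) h.symm

theorem lift_proj_form {p : P} (hp : B.proj p ∈ U) (v : EP) :
    t.lift p (modelDeriv IP IM B.proj p v, t.form p v) = v := by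
  have h := modelDeriv_comp (h := (id : P → P)) (x := p) (y := (B.proj p, (1 : G)))
    (f := fun q => (B.proj q, t.grp q * (t.grp p)⁻¹)) (by simp)
    ((t.contMDiffAt_symm_mul (x := (B.proj p, (1 : G))) hp (t.grp p)).mdifferentiableAt (by simp))
    ((B.mdifferentiable_proj p).prodMk
      ((t.contMDiffAt_grp_mul hp (t.grp p)⁻¹).mdifferentiableAt (by simp)))
    (by
      filter_upwards [t.isOpen_preimage.mem_nhds hp] with q hq
      simp [t.symm_proj_grp hq])
  have h1 : modelDeriv IP IP (id : P → P) p = ContinuousLinearMap.id ℝ EP := mfderiv_id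
  have h2 : modelDeriv IP (IM.prod IG) (fun q => (B.proj q, t.grp q * (t.grp p)⁻¹)) p =
    (modelDeriv IP IM B.proj p).prod (t.form p) :=
    mfderiv_prodMk (B.mdifferentiable_proj p)
      ((t.contMDiffAt_grp_mul hp (t.grp p)⁻¹).mdifferentiableAt (by simp))
  rw [h1, h2] at h
  exact congrArg (fun l : EP →L[ℝ] EP => l v) h.symm

variable [IsManifold IP ∞ P]

/-- The form at `p` is the derivative at `q = p` of a map jointly smooth in `(p, q)`. Its value at
`q = p` is always `1`, so the derivative takes values in the fixed space `T_1G`, and smoothness in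
the tangent bundle becomes smoothness of a map to the model space. -/
theorem contMDiffOn_form {W : Set P} (hW : IsOpen W) (hWU : W ⊆ B.proj ⁻¹' U)
    {v : ∀ p, TangentSpace IP p}
    (hv : have : IsManifold IP 1 P := IsManifold.of_le (n := ∞) (by simp)
      ContMDiffOn IP IP.tangent ∞ (fun p => (⟨p, v p⟩ : TangentBundle IP P)) W) :
    ContMDiffOn IP 𝓘(ℝ, EG) ∞ (fun p => t.form p (v p)) W := by
  have : IsManifold IP 1 P := IsManifold.of_le (n := ∞) (by simp)
  have : IsManifold IG 1 G := IsManifold.of_le (n := ∞) (by simp)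
  rw [← contMDiffOn_tangentBundle_const_iff (I := IG) (1 : G)]
  refine (contMDiffOn_mfderiv_param (I := IP) (I' := IG) (g := id)
    (f := fun p q => t.grp q * (t.grp p)⁻¹) hW ?_ contMDiffOn_id hv).congr ?_
  · intro p hp
    exact (ContMDiffAt.comp (p, p) (t.contMDiffAt_grp (hWU hp)) contMDiffAt_snd).mul
      (ContMDiffAt.comp (p, p) (t.contMDiffAt_grp (hWU hp)) contMDiffAt_fst).inv
  · intro p hp
    exact tangentBundle_mk_congr (by simp) _

theorem contMDiffOn_lift [IsManifold IM ∞ M] {W : Set P} (hW : IsOpen W) (hWU : W ⊆ B.proj ⁻¹' U)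
    {u : ∀ p, TangentSpace IM (B.proj p)} {x : P → EG}
    (hu : have : IsManifold IM 1 M := IsManifold.of_le (n := ∞) (by simp)
      ContMDiffOn IP IM.tangent ∞ (fun p => (⟨B.proj p, u p⟩ : TangentBundle IM M)) W)
    (hx : ContMDiffOn IP 𝓘(ℝ, EG) ∞ x W) :
    have : IsManifold IP 1 P := IsManifold.of_le (n := ∞) (by simp)
    ContMDiffOn IP IP.tangent ∞ (fun p => (⟨p, t.lift p (u p, x p)⟩ : TangentBundle IP P)) W := by
  have : IsManifold IP 1 P := IsManifold.of_le (n := ∞) (by simp)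
  have : IsManifold IM 1 M := IsManifold.of_le (n := ∞) (by simp)
  have : IsManifold IG 1 G := IsManifold.of_le (n := ∞) (by simp)
  -- The vector to be lifted is a tangent vector of `M × G` at `(π p, 1)`, assembled from a section
  -- of `TM` along `π` and a map to the fixed space `T_1G`.
  have h1 : ContMDiffOn IP (IM.prod IG).tangent ∞ (fun p =>
      (⟨(B.proj p, (1 : G)), (u p, x p)⟩ : TangentBundle (IM.prod IG) (M × G))) W :=
    (contMDiff_equivTangentBundleProd_symm (I := IM) (M := M) (I' := IG) (M' := G)
      (n := ∞)).comp_contMDiffOn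
      (hu.prodMk ((contMDiffOn_tangentBundle_const_iff (I := IG) (1 : G)).2 hx))
  refine (contMDiffOn_mfderiv_param (I := IM.prod IG) (I' := IP)
    (f := fun p (x : M × G) => t.e.symm (x.1, x.2 * t.grp p)) hW ?_
    (B.contMDiff_proj.contMDiffOn.prodMk contMDiffOn_const) h1).congr ?_
  · intro p hp
    refine ContMDiffAt.comp (p, (B.proj p, (1 : G))) (t.contMDiffAt_symm
      (x := (B.proj p, 1 * t.grp p)) (hWU hp)) ?_
    exact contMDiffAt_snd.fst.prodMk (contMDiffAt_snd.snd.mul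
      (ContMDiffAt.comp (g := t.grp) (f := Prod.fst) (p, (B.proj p, (1 : G)))
        (t.contMDiffAt_grp (hWU hp)) contMDiffAt_fst))
  · intro p hp
    exact tangentBundle_mk_congr (by simp [t.symm_proj_grp (hWU hp)]) _

end LocalTriv

variable (B)
variable [IsManifold IP ∞ P]

theorem contMDiffOn_mfderiv_proj [IsManifold IM ∞ M] {W : Set P} (hW : IsOpen W)
    {v : ∀ p, TangentSpace IP p}
    (hv : have : IsManifold IP 1 P := IsManifold.of_le (n := ∞) (by simp)
      ContMDiffOn IP IP.tangent ∞ (fun p => (⟨p, v p⟩ : TangentBundle IP P)) W) :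
    have : IsManifold IM 1 M := IsManifold.of_le (n := ∞) (by simp)
    ContMDiffOn IP IM.tangent ∞
      (fun p => (⟨B.proj p, mfderiv IP IM B.proj p (v p)⟩ : TangentBundle IM M)) W := by
  have : IsManifold IP 1 P := IsManifold.of_le (n := ∞) (by simp)
  have : IsManifold IM 1 M := IsManifold.of_le (n := ∞) (by simp)
  exact contMDiffOn_mfderiv_param (I := IP) (I' := IM) (g := id) (f := fun _ => B.proj) hW
    (fun p hp => ContMDiffAt.comp (p, p) B.contMDiff_proj.contMDiffAt contMDiffAt_snd)
    contMDiffOn_id hv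

/-- The fundamental vector is a derivative at `1` of orbit maps, which form a family smooth in `p`
because the action is smooth. -/
theorem contMDiffOn_fundamental (B : PrincipalBundle IM M IG G IP P) [LieGroup IG ∞ G]
    {W : Set P} (hW : IsOpen W) {x : P → EG}
    (hx : ContMDiffOn IP 𝓘(ℝ, EG) ∞ x W) :
    have : IsManifold IP 1 P := IsManifold.of_le (n := ∞) (by simp)
    ContMDiffOn IP IP.tangent ∞
      (fun p => (⟨p, fundamental IG G IP p (x p)⟩ : TangentBundle IP P)) W := by
  have : IsManifold IP 1 P := IsManifold.of_le (n := ∞) (by simp)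
  have : IsManifold IG 1 G := IsManifold.of_le (n := ∞) (by simp)
  refine (contMDiffOn_mfderiv_param (I := IG) (I' := IP) (g := fun _ => (1 : G))
    (f := fun p g => op g • p) hW (fun p _ => B.contMDiff_act (p, 1)) contMDiffOn_const
    ((contMDiffOn_tangentBundle_const_iff (I := IG) (1 : G)).2 hx)).congr ?_
  intro p hp
  exact tangentBundle_mk_congr (by simp) _

end PrincipalBundle

end Principal

end

end LAtiyah

namespace LAtiyah

noncomputable section

universe u v w w'

/-! ### Sections and bundle maps in local frames -/

section Frames

variable {K : Type*} [RCLike K] {E H : Type*} [NormedAddCommGroup E] [NormedSpace ℝ E]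
  [TopologicalSpace H] {I : ModelWithCorners ℝ E H} {X : Type*} [TopologicalSpace X]
  [ChartedSpace H X]

theorem contMDiffOn_pi_smul {ι : Type*} [Fintype ι] {c : X → K} {g : X → ι → K} {W : Set X}
    (hc : ContMDiffOn I 𝓘(ℝ, K) ∞ c W) (hg : ContMDiffOn I 𝓘(ℝ, ι → K) ∞ g W) :
    ContMDiffOn I 𝓘(ℝ, ι → K) ∞ (fun x => c x • g x) W := by
  rw [contMDiffOn_pi_space] at hg ⊢
  intro i
  exact (contDiff_mul (𝕜 := ℝ) (𝔸 := K) (n := ∞)).contMDiff.comp_contMDiffOn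
    (hc.prodMk_space (hg i))

/-- A frame consisting of two parts. -/
def FrameOn.ofPair {A : SmoothFamily.{_, _, w} K X} {ι ι' : Type*} [Fintype ι] [Fintype ι']
    {U : Set X} (c : ∀ x, A.Fiber x →ₗ[K] (ι → K)) (c' : ∀ x, A.Fiber x →ₗ[K] (ι' → K))
    (d : ∀ x, (ι → K) →ₗ[K] A.Fiber x) (d' : ∀ x, (ι' → K) →ₗ[K] A.Fiber x)
    (h : ∀ x ∈ U, ∀ v, d x (c x v) + d' x (c' x v) = v)
    (hcd : ∀ x ∈ U, ∀ a a', c x (d x a + d' x a') = a)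
    (hcd' : ∀ x ∈ U, ∀ a a', c' x (d x a + d' x a') = a')
    (hs : ∀ W ⊆ U, IsOpen W → ∀ s, A.IsSmoothOn s W ↔
      ContMDiffOn I 𝓘(ℝ, ι → K) ∞ (fun x => c x (s x)) W ∧
      ContMDiffOn I 𝓘(ℝ, ι' → K) ∞ (fun x => c' x (s x)) W) :
    FrameOn A I (ι ⊕ ι') U where
  coord x := (LinearEquiv.sumArrowLequivProdArrow ι ι' K K).symm.toLinearMap ∘ₗ
    (c x).prod (c' x)
  comb x := (d x).coprod (d' x) ∘ₗ (LinearEquiv.sumArrowLequivProdArrow ι ι' K K).toLinearMap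
  comb_coord x hx v := by simpa using h x hx v
  coord_comb x hx a := by
    simp only [LinearMap.comp_apply, LinearMap.prod_apply, Function.prod_apply,
      LinearMap.coprod_apply, hcd x hx, hcd' x hx, LinearEquiv.coe_coe]
    exact (LinearEquiv.sumArrowLequivProdArrow ι ι' K K).symm_apply_apply a
  smooth_iff W hW hWo s := by
    rw [hs W hW hWo, contMDiffOn_pi_space, contMDiffOn_pi_space, contMDiffOn_pi_space, Sum.forall]
    rfl

theorem FrameOn.ofPair_coord {A : SmoothFamily.{_, _, w} K X} {ι ι' : Type*} [Fintype ι]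
    [Fintype ι'] {U : Set X} {c : ∀ x, A.Fiber x →ₗ[K] (ι → K)}
    {c' : ∀ x, A.Fiber x →ₗ[K] (ι' → K)} {d : ∀ x, (ι → K) →ₗ[K] A.Fiber x}
    {d' : ∀ x, (ι' → K) →ₗ[K] A.Fiber x} (h) (hcd) (hcd') (hs) (x : X) (v : A.Fiber x) :
    (FrameOn.ofPair (I := I) (U := U) c c' d d' h hcd hcd' hs).coord x v =
      Sum.elim (c x v) (c' x v) :=
  rfl

namespace SmoothFamily.IsLocallyFree

variable {A : SmoothFamily.{_, _, w} K X} {ι : Type*} [Fintype ι] {U : Set X}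

theorem isSmoothOn_of_frame (hA : A.IsLocallyFree I ι) {s : ∀ x, A.Fiber x} (hU : IsOpen U)
    (h : ∀ (V : Set X) (e : FrameOn A I ι V), IsOpen V →
      ContMDiffOn I 𝓘(ℝ, ι → K) ∞ (fun x => e.coord x (s x)) (U ∩ V)) : A.IsSmoothOn s U := by
  refine hA.of_forall_nhds fun x hx => ?_
  obtain ⟨V, hV, hxV, ⟨e⟩⟩ := hA.exists_frame x
  exact ⟨U ∩ V, hU.inter hV, ⟨hx, hxV⟩,
    (e.smooth_iff _ Set.inter_subset_right (hU.inter hV) s).2 (h V e hV)⟩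

theorem contMDiffOn_coord (hA : A.IsLocallyFree I ι) {s : ∀ x, A.Fiber x} (hU : IsOpen U)
    (hs : A.IsSmoothOn s U) {V : Set X} (e : FrameOn A I ι V) (hV : IsOpen V) :
    ContMDiffOn I 𝓘(ℝ, ι → K) ∞ (fun x => e.coord x (s x)) (U ∩ V) :=
  (e.smooth_iff _ Set.inter_subset_right (hU.inter hV) s).1 (hA.mono hs Set.inter_subset_left)

theorem zero (hA : A.IsLocallyFree I ι) (hU : IsOpen U) : A.IsSmoothOn (fun _ => 0) U :=
  hA.isSmoothOn_of_frame hU fun V e hV => by simpa using contMDiffOn_const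

theorem add (hA : A.IsLocallyFree I ι) (hU : IsOpen U) {s t : ∀ x, A.Fiber x}
    (hs : A.IsSmoothOn s U) (ht : A.IsSmoothOn t U) : A.IsSmoothOn (fun x => s x + t x) U :=
  hA.isSmoothOn_of_frame hU fun V e hV => by
    simp only [map_add]
    exact (hA.contMDiffOn_coord hU hs e hV).add (hA.contMDiffOn_coord hU ht e hV)

theorem sub (hA : A.IsLocallyFree I ι) (hU : IsOpen U) {s t : ∀ x, A.Fiber x}
    (hs : A.IsSmoothOn s U) (ht : A.IsSmoothOn t U) : A.IsSmoothOn (fun x => s x - t x) U :=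
  hA.isSmoothOn_of_frame hU fun V e hV => by
    simp only [map_sub]
    exact (hA.contMDiffOn_coord hU hs e hV).sub (hA.contMDiffOn_coord hU ht e hV)

end SmoothFamily.IsLocallyFree

/-- A fibrewise linear map is a bundle map if it is smooth on the members of local frames. -/
theorem isBundleMap_of_frame {A : SmoothFamily.{_, _, w} K X} {B : SmoothFamily.{_, _, w'} K X}
    (hA : A.IsLocal) {ι ι' : Type*} [Fintype ι] [Fintype ι'] [DecidableEq ι]
    (hB : B.IsLocallyFree I ι') (φ : FibreMap A B)
    (h : ∀ x, ∃ U, IsOpen U ∧ x ∈ U ∧ ∃ e : FrameOn A I ι U,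
      ∀ i, B.IsSmoothOn (fun y => φ y (e.comb y (Pi.single i 1))) U) : IsBundleMap φ := by
  intro W hW s hs
  refine hB.of_forall_nhds fun x hx => ?_
  obtain ⟨U, hU, hxU, e, he⟩ := h x
  refine ⟨W ∩ U, hW.inter hU, ⟨hx, hxU⟩, ?_⟩
  refine hB.isSmoothOn_of_frame (hW.inter hU) fun V e' hV => ?_
  have h1 := (e.smooth_iff _ Set.inter_subset_right (hW.inter hU) s).1
    (hA.mono hs Set.inter_subset_left)
  have h2 : ContMDiffOn I 𝓘(ℝ, ι' → K) ∞ (fun y => ∑ i, e.coord y (s y) i •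
      e'.coord y (φ y (e.comb y (Pi.single i 1)))) (W ∩ U ∩ V) := by
    refine contMDiffOn_finsetSum fun i _ => contMDiffOn_pi_smul ?_ ?_
    · exact (contMDiffOn_pi_space.1 h1 i).mono Set.inter_subset_left
    · exact (hB.contMDiffOn_coord hU (he i) e' hV).mono
        (Set.inter_subset_inter_left _ Set.inter_subset_right)
  refine h2.congr fun y hy => ?_
  -- Expanding `s` in the frame and using linearity writes its image as a sum of smooth coefficients
  -- times the images of frame members.
  conv_lhs => rw [← e.comb_coord y hy.1.2 (s y), pi_eq_sum_univ' (e.coord y (s y))]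
  simp only [map_sum, map_smul]

end Frames

/-! ### The tangent bundle along a map -/

section TangentAlong

variable {K : Type*} [RCLike K] {E H : Type*} [NormedAddCommGroup E] [NormedSpace ℝ E]
  [TopologicalSpace H] {I : ModelWithCorners ℝ E H} {X : Type*} [TopologicalSpace X]
  [ChartedSpace H X] {E' H' : Type*} [NormedAddCommGroup E'] [NormedSpace ℝ E']
  [TopologicalSpace H'] {I' : ModelWithCorners ℝ E' H'} {Y : Type*} [TopologicalSpace Y]
  [ChartedSpace H' Y]

variable {V : X → Type*} [∀ x, AddCommGroup (V x)] [∀ x, Module K (V x)]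

variable (I') in
/-- The pullback of a vector bundle along `f : Y → X`. -/
def VectorBundleStructure.along (S : VectorBundleStructure K I V) (f : Y → X) :
    SmoothFamily K Y where
  Fiber y := V (f y)
  IsSmoothOn s W := S.IsSmoothAlong I' f s W

variable (S : VectorBundleStructure K I V) {f : Y → X} (hf : ContMDiff I' I ∞ f)

/-- The local frame of a pullback bundle defined by a trivialization near `x₀`. -/
def VectorBundleStructure.frameAlong (x₀ : X) :
    FrameOn (S.along I' f) I' (Fin S.rank) (f ⁻¹' S.dom x₀) where
  coord y := S.coord x₀ (f y)
  comb y := S.comb x₀ (f y)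
  comb_coord _ hy v := S.comb_coord hy v
  coord_comb _ hy c := S.coord_comb hy c
  smooth_iff _ hW _ s := S.isSmoothAlong_iff hf.contMDiffOn hW s

theorem VectorBundleStructure.isLocallyFree_along (hf : ContMDiff I' I ∞ f) :
    (S.along I' f).IsLocallyFree I' (Fin S.rank) where
  mono h h' := VectorBundleStructure.IsSmoothAlong.mono h h'
  of_forall_nhds h := S.isSmoothAlong_of_forall_nhds h
  exists_frame y := ⟨f ⁻¹' S.dom (f y), (S.isOpen_dom _).preimage hf.continuous, S.mem_dom _,
    ⟨S.frameAlong hf (f y)⟩⟩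

/-- The members of the local frame given by a trivialization are smooth. -/
theorem VectorBundleStructure.isSmoothAlong_comb (x₀ : X) (c : Fin S.rank → K) :
    S.IsSmoothAlong I id (fun x => S.comb x₀ x c) (S.dom x₀) := by
  refine (S.isSmoothAlong_iff (f := id) (x₀ := x₀) contMDiffOn_id subset_rfl _).2 ?_
  exact (contMDiffOn_const (c := c)).congr fun x hx => S.coord_comb hx c

variable [IsManifold I ∞ X]

variable (K I I') in
/-- The pullback of `T_K X` along `f : Y → X`. -/
def tangentAlong (f : Y → X) : SmoothFamily K Y where
  Fiber y := K ⊗[ℝ] TangentSpace I (f y)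
  IsSmoothOn s W := TangentSmoothAlong I I' f s W

theorem isLocallyFree_tangentAlong [FiniteDimensional ℝ E] {f : Y → X} (hf : ContMDiff I' I ∞ f) :
    (tangentAlong K I I' f).IsLocallyFree I' (Fin (Module.finrank ℝ E)) where
  mono h h' := TangentSmoothAlong.mono h h'
  of_forall_nhds h := tangentSmoothAlong_of_forall_nhds h
  exists_frame y := ⟨f ⁻¹' (chartAt H (f y)).source,
    (chartAt H (f y)).open_source.preimage hf.continuous, mem_chart_source H (f y),
    ⟨{  coord := fun z => tangentCoord K I (f y) (f z)
        comb := fun z => tangentComb K I (f y) (f z)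
        comb_coord := fun _ hz v => tangentComb_coord hz v
        coord_comb := fun _ hz v => tangentCoord_comb hz v
        smooth_iff := fun _ hW _ s => tangentSmoothAlong_iff hf.contMDiffOn hW s }⟩⟩

variable (K I X) in
theorem isLocallyFree_tangentK [FiniteDimensional ℝ E] :
    (tangentK K I X).IsLocallyFree I (Fin (Module.finrank ℝ E)) :=
  isLocallyFree_tangentAlong (f := id) contMDiff_id

/-- The anchor is known to be smooth only on sections over the base. Frame members pulled back from
the base suffice, and their images are pulled back from smooth sections. -/
theorem LieAlgebroid.isBundleMap_anchor [FiniteDimensional ℝ E]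
    (L : LieAlgebroid.{w} K I X) (hf : ContMDiff I' I ∞ f) : IsBundleMap (A := L.bundle.along I' f)
    (B := tangentAlong K I I' f) (fun y => L.anchor (f y)) := by
  refine isBundleMap_of_frame (L.bundle.isLocallyFree_along hf).toIsLocal
    (isLocallyFree_tangentAlong hf) _ fun y => ⟨f ⁻¹' L.bundle.dom (f y),
    (L.bundle.isOpen_dom _).preimage hf.continuous, L.bundle.mem_dom _,
    L.bundle.frameAlong hf (f y), fun i => ?_⟩
  have h := L.anchor_smooth _ (L.bundle.isOpen_dom _) _
    (L.bundle.isSmoothAlong_comb (f y) (Pi.single i 1))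
  exact TangentSmoothAlong.comp (I := I) (f := id) h hf.contMDiffOn subset_rfl

end TangentAlong

/-! ### Quotients of equivariant bundles -/

section Quotient

variable {EM HM EG HG EP HP : Type*}
  [NormedAddCommGroup EM] [NormedSpace ℝ EM] [TopologicalSpace HM]
  [NormedAddCommGroup EG] [NormedSpace ℝ EG] [TopologicalSpace HG]
  [NormedAddCommGroup EP] [NormedSpace ℝ EP] [TopologicalSpace HP]
  {IM : ModelWithCorners ℝ EM HM} {M : Type*} [TopologicalSpace M] [ChartedSpace HM M]
  {IG : ModelWithCorners ℝ EG HG} {G : Type*} [TopologicalSpace G] [ChartedSpace HG G] [Group G]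
  {IP : ModelWithCorners ℝ EP HP} {P : Type*} [TopologicalSpace P] [ChartedSpace HP P]
  [MulAction Gᵐᵒᵖ P] {K : Type*} [RCLike K]

namespace EquivariantFamily

variable {A : EquivariantFamily.{_, _, w} K G P} {A' : EquivariantFamily.{_, _, w'} K G P}
  {B : PrincipalBundle IM M IG G IP P}

variable (A B) in
/-- The linear isomorphism from the fibre at a point over `m` to the fibre of the quotient. -/
def toQuot {m : M} (p : P) (hp : B.proj p = m) : A.Fiber p ≃ₗ[K] (A.quot B).Fiber m :=
  A.orbitLinear B p hp

theorem quot_isSmoothOn_iff {s : ∀ m, (A.quot B).Fiber m} {U : Set M} :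
    (A.quot B).IsSmoothOn s U ↔
      A.IsSmoothOn (fun p => (A.toQuot B p rfl).symm (s (B.proj p))) (B.proj ⁻¹' U) :=
  Iff.rfl

theorem toQuot_act {m : M} (p : P) (hp : B.proj p = m) (g : G) (hg : B.proj (op g • p) = m)
    (v : A.Fiber p) : A.toQuot B (op g • p) hg (A.act g p v) = A.toQuot B p hp v :=
  A.orbit_act B p hp g hg v

theorem toQuot_symm_act {m : M} (p : P) (hp : B.proj p = m) (g : G)
    (hg : B.proj (op g • p) = m) (x : (A.quot B).Fiber m) :
    (A.toQuot B (op g • p) hg).symm x = A.act g p ((A.toQuot B p hp).symm x) := by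
  rw [LinearEquiv.symm_apply_eq, toQuot_act p hp, LinearEquiv.apply_symm_apply]

variable (B) in
/-- The map induced by an invariant map, as a map of families. -/
def quotDescend {W : SmoothFamily.{_, _, w'} K M}
    (φ : ∀ p, A.Fiber p →ₗ[K] W.Fiber (B.proj p))
    (hφ : ∀ (g : G) (p : P) (v : A.Fiber p), (⟨B.proj (op g • p), φ (op g • p) (A.act g p v)⟩ :
      Σ m, W.Fiber m) = ⟨B.proj p, φ p v⟩) : FibreMap (A.quot B) W :=
  descend B φ hφ

theorem quotMap_toQuot (φ : FibreMap A.toSmoothFamily A'.toSmoothFamily)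
    (hφ : IsEquivariant φ) (p : P) (v : A.Fiber p) :
    quotMap B φ hφ (B.proj p) (A.toQuot B p rfl v) = A'.toQuot B p rfl (φ p v) :=
  rfl

theorem toQuot_symm_quotMap (φ : FibreMap A.toSmoothFamily A'.toSmoothFamily)
    (hφ : IsEquivariant φ) (p : P) (x : (A.quot B).Fiber (B.proj p)) :
    (A'.toQuot B p rfl).symm (quotMap B φ hφ (B.proj p) x) =
      φ p ((A.toQuot B p rfl).symm x) := by
  obtain ⟨v, rfl⟩ := (A.toQuot B p rfl).surjective x
  rw [quotMap_toQuot, LinearEquiv.symm_apply_apply, LinearEquiv.symm_apply_apply]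

theorem isSmoothOn_quotMap_iff {φ : FibreMap A.toSmoothFamily A'.toSmoothFamily}
    (hφ : IsEquivariant φ) {s : ∀ m, (A.quot B).Fiber m} {U : Set M} :
    (A'.quot B).IsSmoothOn (fun m => quotMap B φ hφ m (s m)) U ↔
      A'.IsSmoothOn (fun p => φ p ((A.toQuot B p rfl).symm (s (B.proj p)))) (B.proj ⁻¹' U) := by
  rw [quot_isSmoothOn_iff]
  simp only [toQuot_symm_quotMap]

theorem isLocal_quot (hA : A.IsLocal) : (A.quot B).IsLocal where
  mono h h' := hA.mono h (Set.preimage_mono h')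
  of_forall_nhds h := hA.of_forall_nhds fun _ hp =>
    let ⟨_, h1, h2, h3⟩ := h _ hp
    ⟨_, h1.preimage B.contMDiff_proj.continuous, h2, h3⟩

/-- Two points over `m` differ by a group element, and the coordinates are invariant. This makes the
coordinates of the quotient independent of the chosen point. -/
theorem coord_toQuot_symm {ι : Type*} [Fintype ι] {U : Set M}
    (e : FrameOn A.toSmoothFamily IP ι (B.proj ⁻¹' U))
    (he : ∀ p, B.proj p ∈ U → ∀ g v, e.coord (op g • p) (A.act g p v) = e.coord p v)
    {m : M} (hm : m ∈ U) {p q : P} (hp : B.proj p = m) (hq : B.proj q = m)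
    (x : (A.quot B).Fiber m) : e.coord p ((A.toQuot B p hp).symm x) =
      e.coord q ((A.toQuot B q hq).symm x) := by
  obtain ⟨g, rfl⟩ := B.transitive (hq.trans hp.symm)
  rw [toQuot_symm_act q hq, he q (by rwa [hq])]

/-- An invariant frame over the preimage of `U` defines a frame of the quotient over `U`. -/
def quotFrame {ι : Type*} [Fintype ι] {U : Set M} (t : B.LocalTriv U)
    (e : FrameOn A.toSmoothFamily IP ι (B.proj ⁻¹' U))
    (he : ∀ p, B.proj p ∈ U → ∀ g v, e.coord (op g • p) (A.act g p v) = e.coord p v) :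
    FrameOn (A.quot B) IM ι U where
  coord m := e.coord (point B m) ∘ₗ
    (A.toQuot B (point B m) (proj_point B m)).symm.toLinearMap
  comb m := (A.toQuot B (point B m) (proj_point B m)).toLinearMap ∘ₗ e.comb (point B m)
  comb_coord m hm x := by
    have hm' : point B m ∈ B.proj ⁻¹' U := by rwa [Set.mem_preimage, proj_point]
    simp [e.comb_coord _ hm']
  coord_comb m hm c := by
    have hm' : point B m ∈ B.proj ⁻¹' U := by rwa [Set.mem_preimage, proj_point]
    simp [e.coord_comb _ hm']
  smooth_iff W hW hWo s := by
    rw [quot_isSmoothOn_iff, e.smooth_iff _ (Set.preimage_mono hW)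
      (hWo.preimage B.contMDiff_proj.continuous)]
    set c : M → ι → K := fun m => (e.coord (point B m) ∘ₗ
      (A.toQuot B (point B m) (proj_point B m)).symm.toLinearMap) (s m) with c_def
    have hc : ∀ p ∈ B.proj ⁻¹' W,
        e.coord p ((A.toQuot B p rfl).symm (s (B.proj p))) = c (B.proj p) :=
      fun p hp => coord_toQuot_symm e he (hW hp) rfl (proj_point B _) _
    -- The coordinates upstairs are now `c ∘ π`. Composing with the smooth section `t.sec` recovers
    -- smoothness of `c`, and composing with `π` gives the converse.
    rw [contMDiffOn_congr hc]
    constructor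
    · intro h
      refine (h.comp (t.contMDiffOn_sec.mono hW) fun m hm => ?_).congr fun m hm => ?_
      · rwa [Set.mem_preimage, Set.mem_preimage, t.proj_sec (hW hm)]
      · simp [t.proj_sec (hW hm)]
    · intro h
      exact h.comp B.contMDiff_proj.contMDiffOn subset_rfl

theorem quotFrame_coord {ι : Type*} [Fintype ι] {U : Set M} (t : B.LocalTriv U)
    (e : FrameOn A.toSmoothFamily IP ι (B.proj ⁻¹' U))
    (he : ∀ p, B.proj p ∈ U → ∀ g v, e.coord (op g • p) (A.act g p v) = e.coord p v)
    {p : P} (hp : B.proj p ∈ U) (v : A.Fiber p) :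
    (quotFrame t e he).coord (B.proj p) (A.toQuot B p rfl v) = e.coord p v := by
  refine (coord_toQuot_symm e he hp (proj_point B _) rfl _).trans ?_
  rw [LinearEquiv.symm_apply_apply]

end EquivariantFamily

end Quotient

end

end LAtiyah

namespace LAtiyah

noncomputable section

universe u v w w'

set_option linter.unusedSectionVars false

section Atiyah

variable {EM HM EG HG EP HP : Type*}
  [NormedAddCommGroup EM] [NormedSpace ℝ EM] [TopologicalSpace HM]
  [NormedAddCommGroup EG] [NormedSpace ℝ EG] [TopologicalSpace HG]
  [NormedAddCommGroup EP] [NormedSpace ℝ EP] [TopologicalSpace HP]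
  {IM : ModelWithCorners ℝ EM HM} {M : Type*} [TopologicalSpace M] [ChartedSpace HM M]
  {IG : ModelWithCorners ℝ EG HG} {G : Type*} [TopologicalSpace G] [ChartedSpace HG G] [Group G]
  {IP : ModelWithCorners ℝ EP HP} {P : Type*} [TopologicalSpace P] [ChartedSpace HP P]
  [MulAction Gᵐᵒᵖ P] {K : Type*} [RCLike K] {B : PrincipalBundle IM M IG G IP P}

/-! ### Base change of identities between linear maps -/

theorem baseChange_eq_zero {V W : Type*} [AddCommGroup V] [Module ℝ V] [AddCommGroup W]
    [Module ℝ W] {V' : Type*} [AddCommGroup V'] [Module ℝ V'] {f : V →ₗ[ℝ] W} {g : W →ₗ[ℝ] V'}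
    (h : ∀ v, g (f v) = 0) (x : K ⊗[ℝ] V) : g.baseChange K (f.baseChange K x) = 0 := by
  have : g ∘ₗ f = 0 := LinearMap.ext h
  rw [← LinearMap.comp_apply, ← LinearMap.baseChange_comp, this, LinearMap.baseChange_zero]
  rfl

theorem baseChange_eq_self {V W : Type*} [AddCommGroup V] [Module ℝ V] [AddCommGroup W]
    [Module ℝ W] {f : V →ₗ[ℝ] W} {g : W →ₗ[ℝ] V}
    (h : ∀ v, g (f v) = v) (x : K ⊗[ℝ] V) : g.baseChange K (f.baseChange K x) = x := by
  have : g ∘ₗ f = LinearMap.id := LinearMap.ext h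
  rw [← LinearMap.comp_apply, ← LinearMap.baseChange_comp, this, LinearMap.baseChange_id]
  rfl

/-! ### The splitting of `T_K P` given by a local trivialization -/

namespace PrincipalBundle.LocalTriv

variable {U : Set M} (t : B.LocalTriv U)

variable (K) in
/-- The flat connection form with coefficients in `K`. -/
def formK (p : P) : K ⊗[ℝ] TangentSpace IP p →ₗ[K] K ⊗[ℝ] EG :=
  (show TangentSpace IP p →ₗ[ℝ] EG from (t.form p).toLinearMap).baseChange K

variable (K) in
/-- The horizontal lift of the flat connection. -/
def horK (p : P) : K ⊗[ℝ] TangentSpace IM (B.proj p) →ₗ[K] K ⊗[ℝ] TangentSpace IP p :=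
  (show TangentSpace IM (B.proj p) →ₗ[ℝ] TangentSpace IP p from
    (t.lift p).toLinearMap ∘ₗ LinearMap.inl ℝ EM EG).baseChange K

variable (K) in
/-- The vertical lift of the flat connection. -/
def verK (p : P) : K ⊗[ℝ] EG →ₗ[K] K ⊗[ℝ] TangentSpace IP p :=
  (show EG →ₗ[ℝ] TangentSpace IP p from
    (t.lift p).toLinearMap ∘ₗ LinearMap.inr ℝ EM EG).baseChange K

variable [LieGroup IG ∞ G] {p : P}

theorem formK_act (hp : B.proj p ∈ U) (g : G) (v : K ⊗[ℝ] TangentSpace IP p) :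
    t.formK K (op g • p) (tangentMapK K IP IP (fun q : P => op g • q) p v) = t.formK K p v := by
  have h : (show TangentSpace IP (op g • p) →ₗ[ℝ] EG from (t.form (op g • p)).toLinearMap) ∘ₗ
      (mfderiv IP IP (fun q : P => op g • q) p).toLinearMap =
      (show TangentSpace IP p →ₗ[ℝ] EG from (t.form p).toLinearMap) :=
    LinearMap.ext fun v => congrArg (fun l : EP →L[ℝ] EG => l v) (t.form_act hp g)
  rw [formK, formK, tangentMapK, ← LinearMap.comp_apply, ← LinearMap.baseChange_comp, h]

theorem proj_horK (hp : B.proj p ∈ U) (u : K ⊗[ℝ] TangentSpace IM (B.proj p)) :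
    tangentMapK K IP IM B.proj p (t.horK K p u) = u :=
  baseChange_eq_self (fun v => t.proj_lift hp (v, 0)) u

theorem proj_verK (hp : B.proj p ∈ U) (x : K ⊗[ℝ] EG) :
    tangentMapK K IP IM B.proj p (t.verK K p x) = 0 :=
  baseChange_eq_zero (fun v => t.proj_lift hp (0, v)) x

theorem formK_horK (hp : B.proj p ∈ U) (u : K ⊗[ℝ] TangentSpace IM (B.proj p)) :
    t.formK K p (t.horK K p u) = 0 :=
  baseChange_eq_zero (fun v => t.form_lift hp (v, 0)) u

theorem formK_verK (hp : B.proj p ∈ U) (x : K ⊗[ℝ] EG) :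
    t.formK K p (t.verK K p x) = x :=
  baseChange_eq_self (fun v => t.form_lift hp (0, v)) x

theorem horK_add_verK (hp : B.proj p ∈ U) (v : K ⊗[ℝ] TangentSpace IP p) :
    t.horK K p (tangentMapK K IP IM B.proj p v) + t.verK K p (t.formK K p v) = v := by
  induction v with
  | zero => simp
  -- Purely real content: split the pair inside `t.lift p` into its horizontal and vertical parts.
  | tmul a v =>
    have h := t.lift_proj_form hp v
    have h2 : t.lift p (modelDeriv IP IM B.proj p v, 0) + t.lift p (0, t.form p v) = v := by
      rw [← map_add]
      simpa using h
    refine (TensorProduct.tmul_add a _ _).symm.trans ?_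
    exact congrArg (fun x : EP => (a ⊗ₜ[ℝ] (show TangentSpace IP p from x) :
      K ⊗[ℝ] TangentSpace IP p)) h2
  | add v w hv hw =>
    rw [map_add, map_add, map_add, map_add, add_add_add_comm, hv, hw]

variable [IsManifold IM ∞ M] [IsManifold IP ∞ P] [FiniteDimensional ℝ EG]

/-- The coordinates of the flat connection form. -/
def formCoord (p : P) : K ⊗[ℝ] TangentSpace IP p →ₗ[K] (Fin (Module.finrank ℝ EG) → K) :=
  (tensorCoord K (Module.finBasis ℝ EG)).toLinearMap ∘ₗ t.formK K p

theorem contMDiffOn_formCoord_iff {s : ∀ p, K ⊗[ℝ] TangentSpace IP p} {W : Set P} :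
    ContMDiffOn IP 𝓘(ℝ, Fin (Module.finrank ℝ EG) → K) ∞ (fun p => t.formCoord p (s p)) W ↔
      ContMDiffOn IP 𝓘(ℝ, EG) ∞ (fun p => t.form p (tensorRe K (TangentSpace IP p) (s p))) W ∧
      ContMDiffOn IP 𝓘(ℝ, EG) ∞ (fun p => t.form p (tensorIm K (TangentSpace IP p) (s p))) W := by
  refine (contMDiffOn_tensorCoord_iff (s := fun p => t.formK K p (s p)) _).trans ?_
  exact and_congr (contMDiffOn_congr fun _ _ => tensorRe_baseChange _ _)
    (contMDiffOn_congr fun _ _ => tensorIm_baseChange _ _)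

/-- A section of `T_K P` is smooth if and only if its projection to `T_K M` and its image under
the flat connection form are smooth. -/
theorem tangentK_isSmoothOn_iff {W : Set P} (hW : IsOpen W) (hWU : W ⊆ B.proj ⁻¹' U)
    (s : ∀ p, K ⊗[ℝ] TangentSpace IP p) : (tangentK K IP P).IsSmoothOn s W ↔
      TangentSmoothAlong IM IP B.proj (fun p => tangentMapK K IP IM B.proj p (s p)) W ∧
      ContMDiffOn IP 𝓘(ℝ, Fin (Module.finrank ℝ EG) → K) ∞ (fun p => t.formCoord p (s p)) W := by
  have key (v : ∀ p, TangentSpace IP p) :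
      have : IsManifold IP 1 P := IsManifold.of_le (n := ∞) (by simp)
      have : IsManifold IM 1 M := IsManifold.of_le (n := ∞) (by simp)
      ContMDiffOn IP IP.tangent ∞ (fun p => (⟨p, v p⟩ : TangentBundle IP P)) W ↔
        ContMDiffOn IP IM.tangent ∞
          (fun p => (⟨B.proj p, mfderiv IP IM B.proj p (v p)⟩ : TangentBundle IM M)) W ∧
        ContMDiffOn IP 𝓘(ℝ, EG) ∞ (fun p => t.form p (v p)) W := by
    constructor
    · exact fun h => ⟨B.contMDiffOn_mfderiv_proj hW h, t.contMDiffOn_form hW hWU h⟩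
    · intro h
      -- A vector is the lift of its projection and form value, and the lift depends smoothly on the
      -- point.
      refine (t.contMDiffOn_lift hW hWU h.1 h.2).congr fun p hp => ?_
      exact congrArg (fun v : EP => (⟨p, v⟩ : TangentBundle IP P))
        (t.lift_proj_form (hWU hp) (v p)).symm
  rw [contMDiffOn_formCoord_iff]
  have h1 := key fun p => tensorRe K (TangentSpace IP p) (s p)
  have h2 := key fun p => tensorIm K (TangentSpace IP p) (s p)
  unfold TangentSmoothAlong
  simp only [tangentMapK, tensorRe_baseChange, tensorIm_baseChange]
  refine (and_congr h1 h2).trans ?_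
  tauto

end PrincipalBundle.LocalTriv

end Atiyah

end

end LAtiyah

namespace LAtiyah

noncomputable section

universe u v w w'

set_option linter.unusedSectionVars false

section Atiyah

variable {EM HM EG HG EP HP : Type*}
  [NormedAddCommGroup EM] [NormedSpace ℝ EM] [TopologicalSpace HM]
  [NormedAddCommGroup EG] [NormedSpace ℝ EG] [TopologicalSpace HG]
  [NormedAddCommGroup EP] [NormedSpace ℝ EP] [TopologicalSpace HP]
  {IM : ModelWithCorners ℝ EM HM} {M : Type*} [TopologicalSpace M] [ChartedSpace HM M]
  {IG : ModelWithCorners ℝ EG HG} {G : Type*} [TopologicalSpace G] [ChartedSpace HG G] [Group G]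
  {IP : ModelWithCorners ℝ EP HP} {P : Type*} [TopologicalSpace P] [ChartedSpace HP P]
  [MulAction Gᵐᵒᵖ P] {K : Type*} [RCLike K] {B : PrincipalBundle IM M IG G IP P}
  [IsManifold IM ∞ M] [IsManifold IP ∞ P] [FiniteDimensional ℝ EM] [FiniteDimensional ℝ EG]
  [LieGroup IG ∞ G] {L : LieAlgebroid.{w} K IM M}

/-! ### Invariant frames -/

namespace PrincipalBundle.LocalTriv

variable {U : Set M} (t : B.LocalTriv U)

theorem formCoord_verK {p : P} (hp : B.proj p ∈ U) (c : Fin (Module.finrank ℝ EG) → K) :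
    t.formCoord p (t.verK K p ((tensorCoord K (Module.finBasis ℝ EG)).symm c)) = c := by
  rw [formCoord, LinearMap.comp_apply, t.formK_verK hp]
  simp

theorem formCoord_horK {p : P} (hp : B.proj p ∈ U) (u : K ⊗[ℝ] TangentSpace IM (B.proj p)) :
    t.formCoord p (t.horK K p u) = 0 := by
  rw [formCoord, LinearMap.comp_apply, t.formK_horK hp, map_zero]

theorem verK_formCoord (p : P) (v : K ⊗[ℝ] TangentSpace IP p) :
    t.verK K p ((tensorCoord K (Module.finBasis ℝ EG)).symm (t.formCoord p v)) =
      t.verK K p (t.formK K p v) := by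
  simp [formCoord]

theorem formCoord_act {p : P} (hp : B.proj p ∈ U) (g : G) (v : K ⊗[ℝ] TangentSpace IP p) :
    t.formCoord (op g • p) (tangentMapK K IP IP (fun q : P => op g • q) p v) =
      t.formCoord p v := by
  rw [formCoord, formCoord, LinearMap.comp_apply, LinearMap.comp_apply, t.formK_act hp]

variable (K) in
/-- The coordinates of the projection to `T_K M`. -/
def projCoord (B : PrincipalBundle IM M IG G IP P) (m₀ : M) (p : P) :
    K ⊗[ℝ] TangentSpace IP p →ₗ[K] (Fin (Module.finrank ℝ EM) → K) :=
  tangentCoord K IM m₀ (B.proj p) ∘ₗ tangentMapK K IP IM B.proj p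

variable (K) in
/-- The horizontal vector whose projection to `T_K M` has given coordinates. -/
def horComb (m₀ : M) (p : P) :
    (Fin (Module.finrank ℝ EM) → K) →ₗ[K] K ⊗[ℝ] TangentSpace IP p :=
  t.horK K p ∘ₗ tangentComb K IM m₀ (B.proj p)

variable (K) in
/-- The vertical vector on which the flat connection form has given coordinates. -/
def verComb (p : P) : (Fin (Module.finrank ℝ EG) → K) →ₗ[K] K ⊗[ℝ] TangentSpace IP p :=
  t.verK K p ∘ₗ (tensorCoord K (Module.finBasis ℝ EG)).symm.toLinearMap

theorem horComb_add_verComb {m₀ : M} {p : P} (hp : B.proj p ∈ U)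
    (hm : B.proj p ∈ (chartAt HM m₀).source) (v : K ⊗[ℝ] TangentSpace IP p) :
    t.horComb K m₀ p (projCoord K B m₀ p v) + t.verComb K p (t.formCoord p v) = v := by
  simp only [horComb, verComb, projCoord, LinearMap.comp_apply, LinearEquiv.coe_coe,
    tangentComb_coord hm, t.verK_formCoord]
  exact t.horK_add_verK hp v

theorem projCoord_horComb_add_verComb {m₀ : M} {p : P} (hp : B.proj p ∈ U)
    (hm : B.proj p ∈ (chartAt HM m₀).source) (a : Fin (Module.finrank ℝ EM) → K)
    (a' : Fin (Module.finrank ℝ EG) → K) :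
    projCoord K B m₀ p (t.horComb K m₀ p a + t.verComb K p a') = a := by
  rw [map_add]
  simp only [horComb, verComb, projCoord, LinearMap.comp_apply, LinearEquiv.coe_coe,
    t.proj_horK hp, t.proj_verK hp, tangentCoord_comb hm, map_zero, add_zero]

theorem formCoord_horK_add_verComb {p : P} (hp : B.proj p ∈ U)
    (u : K ⊗[ℝ] TangentSpace IM (B.proj p)) (a' : Fin (Module.finrank ℝ EG) → K) :
    t.formCoord p (t.horK K p u + t.verComb K p a') = a' := by
  rw [map_add]
  simp only [verComb, LinearMap.comp_apply, LinearEquiv.coe_coe,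
    t.formCoord_horK hp, t.formCoord_verK hp, zero_add]

/-- The invariant frame of `T_K P` defined by a local trivialization and a chart of `M`. -/
def tangentFrame {m₀ : M} (hU : U ⊆ (chartAt HM m₀).source) :
    FrameOn (tangentE K B).toSmoothFamily IP
      (Fin (Module.finrank ℝ EM) ⊕ Fin (Module.finrank ℝ EG)) (B.proj ⁻¹' U) :=
  FrameOn.ofPair (A := tangentK K IP P) (projCoord K B m₀) (fun p => t.formCoord p)
    (t.horComb K m₀) (t.verComb K)
    (fun _ hp v => t.horComb_add_verComb hp (hU hp) v)
    (fun _ hp a a' => t.projCoord_horComb_add_verComb hp (hU hp) a a')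
    (fun _ hp _ a' => t.formCoord_horK_add_verComb hp _ a')
    (fun W hW hWo s => by
      refine (t.tangentK_isSmoothOn_iff hWo hW s).trans (and_congr_left' ?_)
      exact tangentSmoothAlong_iff B.contMDiff_proj.contMDiffOn
        (hW.trans (Set.preimage_mono hU)) _)

theorem tangentCoord_congr (m₀ : M) {m m' : M} {v : K ⊗[ℝ] TangentSpace IM m}
    {v' : K ⊗[ℝ] TangentSpace IM m'}
    (h : (⟨m, v⟩ : Σ m, K ⊗[ℝ] TangentSpace IM m) = ⟨m', v'⟩) :
    tangentCoord K IM m₀ m v = tangentCoord K IM m₀ m' v' := by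
  cases h; rfl

theorem projCoord_act (m₀ : M) (g : G) (p : P) (v : K ⊗[ℝ] TangentSpace IP p) :
    projCoord K B m₀ (op g • p) (tangentMapK K IP IP (fun q : P => op g • q) p v) =
      projCoord K B m₀ p v := by
  rw [projCoord, projCoord, LinearMap.comp_apply, LinearMap.comp_apply]
  exact tangentCoord_congr m₀ (tangentMapK_proj_act B g p v)

theorem tangentFrame_coord {m₀ : M} (hU : U ⊆ (chartAt HM m₀).source) (p : P)
    (v : K ⊗[ℝ] TangentSpace IP p) :
    (t.tangentFrame hU).coord p v = Sum.elim (projCoord K B m₀ p v) (t.formCoord p v) :=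
  FrameOn.ofPair_coord _ _ _ _ _ _

theorem tangentFrame_act {m₀ : M} (hU : U ⊆ (chartAt HM m₀).source) (p : P)
    (hp : B.proj p ∈ U) (g : G) (v : (tangentE K B).Fiber p) :
    (t.tangentFrame hU).coord (op g • p) ((tangentE K B).act g p v) =
      (t.tangentFrame hU).coord p v := by
  refine (t.tangentFrame_coord hU _ _).trans (Eq.trans ?_ (t.tangentFrame_coord hU _ _).symm)
  exact congrArg₂ Sum.elim (projCoord_act m₀ g p v) (t.formCoord_act hp g v)

variable (L) in
/-- The coordinates of the projection to `L`. -/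
def algebroidCoord (m₀ : M) (p : P) : TLFiber B L p →ₗ[K] (Fin L.bundle.rank → K) :=
  L.bundle.coord m₀ (B.proj p) ∘ₗ
    LinearMap.snd K (K ⊗[ℝ] TangentSpace IP p) (L.Fiber (B.proj p)) ∘ₗ (TLFiber B L p).subtype

variable (L) in
/-- The coordinates of the flat connection form on `T^L P`. -/
def algebroidFormCoord (p : P) : TLFiber B L p →ₗ[K] (Fin (Module.finrank ℝ EG) → K) :=
  t.formCoord p ∘ₗ
    LinearMap.fst K (K ⊗[ℝ] TangentSpace IP p) (L.Fiber (B.proj p)) ∘ₗ (TLFiber B L p).subtype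

open scoped Classical in
variable (L) in
/-- The horizontal vector of `T^L P` whose projection to `L` has given coordinates. -/
def algebroidHorComb (m₀ : M) (p : P) : (Fin L.bundle.rank → K) →ₗ[K] TLFiber B L p :=
  -- Away from `U` the lift need not project to the anchor, so zero is taken there; the frame
  -- identities are required only over `U`.
  if hp : B.proj p ∈ U then
    LinearMap.codRestrict (TLFiber B L p)
      ((t.horK K p ∘ₗ L.anchor (B.proj p) ∘ₗ L.bundle.comb m₀ (B.proj p)).prod
        (L.bundle.comb m₀ (B.proj p))) (fun _ => t.proj_horK hp _)
  else 0

open scoped Classical in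
variable (L) in
/-- The vertical vector of `T^L P` on which the flat connection form has given coordinates. -/
def algebroidVerComb (p : P) : (Fin (Module.finrank ℝ EG) → K) →ₗ[K] TLFiber B L p :=
  if hp : B.proj p ∈ U then
    LinearMap.codRestrict (TLFiber B L p)
      (LinearMap.inl K (K ⊗[ℝ] TangentSpace IP p) (L.Fiber (B.proj p)) ∘ₗ t.verComb K p)
      (fun _ => (t.proj_verK hp _).trans (map_zero _).symm)
  else 0

theorem coe_algebroidHorComb_add_verComb {m₀ : M} {p : P} (hp : B.proj p ∈ U)
    (a : Fin L.bundle.rank → K) (a' : Fin (Module.finrank ℝ EG) → K) :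
    (t.algebroidHorComb L m₀ p a + t.algebroidVerComb L p a').1 =
      (t.horK K p (L.anchor _ (L.bundle.comb m₀ _ a)) + t.verComb K p a',
        L.bundle.comb m₀ _ a) := by
  rw [algebroidHorComb, algebroidVerComb, dif_pos hp, dif_pos hp]
  exact Prod.ext rfl (add_zero _)

theorem algebroidHorComb_add_verComb {m₀ : M} {p : P} (hp : B.proj p ∈ U)
    (hm : B.proj p ∈ L.bundle.dom m₀) (v : TLFiber B L p) :
    t.algebroidHorComb L m₀ p (algebroidCoord L m₀ p v) +
      t.algebroidVerComb L p (t.algebroidFormCoord L p v) = v := by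
  refine Subtype.ext ((t.coe_algebroidHorComb_add_verComb hp _ _).trans ?_)
  have h1 : L.bundle.comb m₀ _ (algebroidCoord L m₀ p v) = v.1.2 := L.bundle.comb_coord hm v.1.2
  have h2 : tangentMapK K IP IM B.proj p v.1.1 = L.anchor (B.proj p) v.1.2 := v.2
  rw [h1, ← h2]
  refine Prod.ext ?_ rfl
  exact (congrArg _ (t.verK_formCoord p v.1.1)).trans (t.horK_add_verK hp v.1.1)

/-- The invariant frame of `T^L P` defined by a local trivialization and a local frame of `L`. -/
def algebroidFrame {m₀ : M} (hU : U ⊆ L.bundle.dom m₀) :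
    FrameOn (TL B L).toSmoothFamily IP
      (Fin L.bundle.rank ⊕ Fin (Module.finrank ℝ EG)) (B.proj ⁻¹' U) :=
  FrameOn.ofPair (A := (TL B L).toSmoothFamily) (algebroidCoord L m₀)
    (fun p => t.algebroidFormCoord L p) (t.algebroidHorComb L m₀) (t.algebroidVerComb L)
    (fun _ hp v => t.algebroidHorComb_add_verComb hp (hU hp) v)
    (fun p hp a a' => by
      have h := congrArg (fun z => L.bundle.coord m₀ (B.proj p) z.2)
        (t.coe_algebroidHorComb_add_verComb (L := L) (m₀ := m₀) hp a a')
      exact h.trans (L.bundle.coord_comb (hU hp) a))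
    (fun p hp a a' => by
      have h := congrArg (fun z => t.formCoord p z.1)
        (t.coe_algebroidHorComb_add_verComb (L := L) (m₀ := m₀) hp a a')
      exact h.trans (t.formCoord_horK_add_verComb hp _ a'))
    (fun W hW hWo s => by
      have h1 := t.tangentK_isSmoothOn_iff hWo hW (fun p => (s p).1.1)
      have h2 := L.bundle.isSmoothAlong_iff (x₀ := m₀) (f := B.proj) (W := W) (I' := IP)
        B.contMDiff_proj.contMDiffOn (hW.trans (Set.preimage_mono hU)) (fun p => (s p).1.2)
      have h3 := L.isBundleMap_anchor B.contMDiff_proj W hWo (fun p => (s p).1.2)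
      -- By definition of `T^LP` the projection to `TM` is the anchor of the `L`-component.
      -- Smoothness of the latter implies that of the former, so the form and the `L`-coordinates
      -- already decide smoothness.
      have h4 : (fun p => tangentMapK K IP IM B.proj p (s p).1.1) =
        fun p => L.anchor (B.proj p) (s p).1.2 := funext fun p => (s p).2
      rw [h4] at h1
      refine (and_congr h1 h2).trans ⟨fun h => ⟨h.2, h.1.2⟩, fun h => ⟨⟨h3 (h2.2 h.1), h.2⟩, h.1⟩⟩)

theorem algebroidFrame_coord {m₀ : M} (hU : U ⊆ L.bundle.dom m₀) (p : P)
    (v : TLFiber B L p) : (t.algebroidFrame hU).coord p v =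
      Sum.elim (L.bundle.coord m₀ (B.proj p) v.1.2) (t.formCoord p v.1.1) :=
  FrameOn.ofPair_coord _ _ _ _ _ _

theorem algebroidFrame_act {m₀ : M} (hU : U ⊆ L.bundle.dom m₀) (p : P)
    (hp : B.proj p ∈ U) (g : G) (v : (TL B L).Fiber p) :
    (t.algebroidFrame hU).coord (op g • p) ((TL B L).act g p v) =
      (t.algebroidFrame hU).coord p v := by
  refine (t.algebroidFrame_coord hU _ _).trans (Eq.trans ?_ (t.algebroidFrame_coord hU _ _).symm)
  refine congrArg₂ Sum.elim ?_ (t.formCoord_act hp g v.1.1)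
  exact congrArg (fun z : Σ m, L.Fiber m => L.bundle.coord m₀ z.1 z.2)
    (sigma_castL L (B.proj_act g p).symm v.1.2)

theorem contMDiffOn_adInv_grp {W : Set P} (hW : IsOpen W) (hWU : W ⊆ B.proj ⁻¹' U) {x : P → EG}
    (hx : ContMDiffOn IP 𝓘(ℝ, EG) ∞ x W) :
    ContMDiffOn IP 𝓘(ℝ, EG) ∞ (fun p => (show EG from adInv IG G (t.grp p) (x p))) W := by
  have : IsManifold IP 1 P := IsManifold.of_le (n := ∞) (by simp)
  have : IsManifold IG 1 G := IsManifold.of_le (n := ∞) (by simp)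
  rw [← contMDiffOn_tangentBundle_const_iff (I := IG) (1 : G)]
  refine (contMDiffOn_mfderiv_param (I'' := IP) (I := IG) (I' := IG) (g := fun _ => (1 : G))
    (f := fun p h => (t.grp p)⁻¹ * h * t.grp p) hW ?_ contMDiffOn_const
    ((contMDiffOn_tangentBundle_const_iff (I := IG) (1 : G)).2 hx)).congr ?_
  · intro p hp
    have h : ContMDiffAt (IP.prod IG) IG ∞ (fun x : P × G => t.grp x.1) (p, (1 : G)) :=
      ContMDiffAt.comp (g := t.grp) (f := Prod.fst) (p, (1 : G))
        (t.contMDiffAt_grp (hWU hp)) contMDiffAt_fst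
    have h' : ContMDiffAt (IP.prod IG) IG ∞ (Prod.snd : P × G → G) (p, (1 : G)) :=
      contMDiffAt_snd
    exact (h.inv.mul h').mul h
  · intro p hp
    exact tangentBundle_mk_congr (by simp) _

theorem _root_.LAtiyah.PrincipalBundle.isSmoothOn_fundamental
    (B : PrincipalBundle IM M IG G IP P) {W : Set P} (hW : IsOpen W)
    {x : P → K ⊗[ℝ] GroupLieAlgebra IG G} (hx : (adjointE IG G IP P K).IsSmoothOn x W) :
    (tangentK K IP P).IsSmoothOn (fun p => (fundamental IG G IP p).baseChange K (x p)) W := by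
  have : IsManifold IP 1 P := IsManifold.of_le (n := ∞) (by simp)
  constructor
  · refine (B.contMDiffOn_fundamental hW hx.1).congr fun p _ => ?_
    rw [tensorRe_baseChange]
  · refine (B.contMDiffOn_fundamental hW hx.2).congr fun p _ => ?_
    rw [tensorIm_baseChange]

theorem adInv_form_fundamental {p : P} (hp : B.proj p ∈ U) (x : GroupLieAlgebra IG G) :
    adInv IG G (t.grp p) (t.form p (fundamental IG G IP p x)) = x := by
  have h := adInv_mul (IG := IG) (t.grp p)⁻¹ (t.grp p)
  rw [inv_mul_cancel, adInv_one] at h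
  exact (congrArg (fun y : EG => adInv IG G (t.grp p) y) (t.form_fundamental hp x)).trans
    (LinearMap.congr_fun h x).symm

theorem form_fundamental_adInv {p : P} (hp : B.proj p ∈ U) (x : GroupLieAlgebra IG G) :
    t.form p (fundamental IG G IP p (adInv IG G (t.grp p) x)) = x := by
  have h := adInv_mul (IG := IG) (t.grp p) (t.grp p)⁻¹
  rw [mul_inv_cancel, adInv_one] at h
  exact (t.form_fundamental hp _).trans (LinearMap.congr_fun h x).symm

/-- The invariant frame of `P × 𝔤` defined by a local trivialization. -/
def adjointFrame : FrameOn (adjointE IG G IP P K).toSmoothFamily IP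
    (Fin (Module.finrank ℝ EG)) (B.proj ⁻¹' U) where
  coord p := t.formCoord p ∘ₗ (fundamental IG G IP p).baseChange K
  -- On fundamental vectors the form is `Ad_{t.grp p}`, so its inverse is `adInv` at `t.grp p`.
  comb p := (show EG →ₗ[ℝ] GroupLieAlgebra IG G from adInv IG G (t.grp p)).baseChange K ∘ₗ
    (tensorCoord K (Module.finBasis ℝ EG)).symm.toLinearMap
  comb_coord p hp x := by
    have h : (show EG →ₗ[ℝ] GroupLieAlgebra IG G from adInv IG G (t.grp p)).baseChange K
        (((show TangentSpace IP p →ₗ[ℝ] EG from (t.form p).toLinearMap) ∘ₗ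
          fundamental IG G IP p).baseChange K x) = x :=
      baseChange_eq_self (fun v => t.adInv_form_fundamental hp v) x
    rw [LinearMap.baseChange_comp] at h
    refine Eq.trans ?_ h
    exact congrArg ((show EG →ₗ[ℝ] GroupLieAlgebra IG G from adInv IG G (t.grp p)).baseChange K)
      ((tensorCoord K (Module.finBasis ℝ EG)).symm_apply_apply _)
  coord_comb p hp c := by
    have h (x : K ⊗[ℝ] EG) : ((show TangentSpace IP p →ₗ[ℝ] EG from (t.form p).toLinearMap) ∘ₗ
          fundamental IG G IP p).baseChange K
        ((show EG →ₗ[ℝ] GroupLieAlgebra IG G from adInv IG G (t.grp p)).baseChange K x) = x :=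
      baseChange_eq_self (fun v => t.form_fundamental_adInv hp v) x
    rw [LinearMap.baseChange_comp] at h
    refine Eq.trans (congrArg (tensorCoord K (Module.finBasis ℝ EG)) (h _)) ?_
    exact (tensorCoord K (Module.finBasis ℝ EG)).apply_symm_apply _
  smooth_iff W hW hWo s := by
    constructor
    · intro h
      exact ((t.tangentK_isSmoothOn_iff hWo hW _).1 (B.isSmoothOn_fundamental hWo h)).2
    · intro h
      -- The real and imaginary parts of `s` are recovered by applying `adInv` at `t.grp p`, smooth
      -- in `p`, to the form of their fundamental vectors.
      have h' := t.contMDiffOn_formCoord_iff.1 h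
      constructor
      · refine (t.contMDiffOn_adInv_grp hWo hW h'.1).congr fun p hp => ?_
        refine (t.adInv_form_fundamental (hW hp) _).symm.trans ?_
        exact congrArg (fun y : EP => adInv IG G (t.grp p) (t.form p y))
          (tensorRe_baseChange _ _).symm
      · refine (t.contMDiffOn_adInv_grp hWo hW h'.2).congr fun p hp => ?_
        refine (t.adInv_form_fundamental (hW hp) _).symm.trans ?_
        exact congrArg (fun y : EP => adInv IG G (t.grp p) (t.form p y))
          (tensorIm_baseChange _ _).symm

/-- By `fundamental_act`, passing to fundamental vectors turns `Ad_{g⁻¹}` into the tangent map of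
translation by `g`, under which the form is invariant. -/
theorem adjointFrame_act (p : P) (hp : B.proj p ∈ U) (g : G)
    (v : (adjointE IG G IP P K).Fiber p) :
    t.adjointFrame.coord (op g • p) ((adjointE IG G IP P K).act g p v) =
      t.adjointFrame.coord p v := by
  have h := congrArg (fun l : GroupLieAlgebra IG G →ₗ[ℝ] TangentSpace IP (op g • p) =>
    l.baseChange K v) (fundamental_act B g p)
  simp only [LinearMap.baseChange_comp] at h
  exact (congrArg (t.formCoord (op g • p)) h).trans (t.formCoord_act hp g _)

/-- The restriction of a local trivialization to an open subset. -/
def restrict {V : Set M} (hV : IsOpen V) (hVU : V ⊆ U) : B.LocalTriv V where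
  e := t.e.restrOpen (B.proj ⁻¹' V) (hV.preimage B.contMDiff_proj.continuous)
  isOpen := hV
  source_eq := by
    rw [OpenPartialHomeomorph.restrOpen_source, t.source_eq]
    exact Set.inter_eq_right.2 (Set.preimage_mono hVU)
  target_eq := by
    ext ⟨m, g⟩
    constructor
    · rintro ⟨h, h'⟩
      have hm : m ∈ U := by
        have h2 : (m, g) ∈ t.e.target := h
        rw [t.target_eq] at h2
        exact h2.1
      have h3 : B.proj (t.e.symm (m, g)) ∈ V := h'
      rw [t.proj_symm hm] at h3
      exact ⟨h3, trivial⟩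
    · rintro ⟨h, -⟩
      refine ⟨t.mem_target (hVU h) g, ?_⟩
      change B.proj (t.e.symm (m, g)) ∈ V
      rwa [t.proj_symm (hVU h)]
  contMDiffOn := t.contMDiffOn.mono fun _ h => h.1
  contMDiffOn_symm := t.contMDiffOn_symm.mono fun _ h => h.1
  fst_apply p hp := t.fst_apply p hp.1
  apply_act p hp := t.apply_act p hp.1

end PrincipalBundle.LocalTriv

/-! ### The vector bundles of the Atiyah sequences -/

/-- Frames of `TM` and of `L` exist only on chart and trivialization domains, so the trivializing
set of `P` has to be shrunk into them. -/
theorem PrincipalBundle.exists_localTriv_subset (B : PrincipalBundle IM M IG G IP P) {m : M}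
    {V : Set M} (hV : IsOpen V) (hm : m ∈ V) :
    ∃ U ⊆ V, IsOpen U ∧ m ∈ U ∧ Nonempty (B.LocalTriv U) := by
  obtain ⟨U, hU, hmU, ⟨t⟩⟩ := B.exists_localTriv m
  exact ⟨U ∩ V, Set.inter_subset_right, hU.inter hV, ⟨hmU, hm⟩,
    ⟨t.restrict (hU.inter hV) Set.inter_subset_left⟩⟩

theorem isLocal_adjointE : (adjointE IG G IP P K).IsLocal where
  mono h h' := ⟨h.1.mono h', h.2.mono h'⟩
  of_forall_nhds h :=
    ⟨contMDiffOn_of_forall_nhds fun x hx => let ⟨V, h1, h2, h3⟩ := h x hx; ⟨V, h1, h2, h3.1⟩,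
      contMDiffOn_of_forall_nhds fun x hx => let ⟨V, h1, h2, h3⟩ := h x hx; ⟨V, h1, h2, h3.2⟩⟩

theorem isLocal_tangentE : (tangentE K B).IsLocal where
  mono h h' := TangentSmoothAlong.mono (f := id) h h'
  of_forall_nhds h := tangentSmoothAlong_of_forall_nhds (f := id) h

theorem isLocal_TL : (TL B L).IsLocal where
  mono h h' := ⟨isLocal_tangentE.mono h.1 h', VectorBundleStructure.IsSmoothAlong.mono h.2 h'⟩
  of_forall_nhds h :=
    ⟨isLocal_tangentE.of_forall_nhds
        fun x hx => let ⟨V, h1, h2, h3⟩ := h x hx; ⟨V, h1, h2, h3.1⟩,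
      L.bundle.isSmoothAlong_of_forall_nhds
        fun x hx => let ⟨V, h1, h2, h3⟩ := h x hx; ⟨V, h1, h2, h3.2⟩⟩

variable (K B) in
theorem isLocallyFree_Ad : (Ad K B).IsLocallyFree IM (Fin (Module.finrank ℝ EG)) where
  toIsLocal := EquivariantFamily.isLocal_quot isLocal_adjointE
  exists_frame m := by
    obtain ⟨U, hU, hm, ⟨t⟩⟩ := B.exists_localTriv m
    exact ⟨U, hU, hm, ⟨EquivariantFamily.quotFrame t t.adjointFrame
      fun p hp g v => t.adjointFrame_act p hp g v⟩⟩

variable (K B) in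
theorem isLocallyFree_At : (At K B).IsLocallyFree IM
    (Fin (Module.finrank ℝ EM) ⊕ Fin (Module.finrank ℝ EG)) where
  toIsLocal := EquivariantFamily.isLocal_quot isLocal_tangentE
  exists_frame m := by
    obtain ⟨U, hUV, hU, hm, ⟨t⟩⟩ := B.exists_localTriv_subset (chartAt HM m).open_source
      (mem_chart_source HM m)
    exact ⟨U, hU, hm, ⟨EquivariantFamily.quotFrame t (t.tangentFrame hUV)
      fun p hp g v => t.tangentFrame_act hUV p hp g v⟩⟩

variable (B L) in
theorem isLocallyFree_AtL : (AtL B L).IsLocallyFree IM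
    (Fin L.bundle.rank ⊕ Fin (Module.finrank ℝ EG)) where
  toIsLocal := EquivariantFamily.isLocal_quot isLocal_TL
  exists_frame m := by
    obtain ⟨U, hUV, hU, hm, ⟨t⟩⟩ := B.exists_localTriv_subset (L.bundle.isOpen_dom m)
      (L.bundle.mem_dom m)
    exact ⟨U, hU, hm, ⟨EquivariantFamily.quotFrame t (t.algebroidFrame hUV)
      fun p hp g v => t.algebroidFrame_act hUV p hp g v⟩⟩

variable (K B) in
theorem isVectorBundle_Ad : (Ad K B).IsVectorBundle IM :=
  (isLocallyFree_Ad K B).isVectorBundle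

variable (K B) in
theorem isVectorBundle_At : (At K B).IsVectorBundle IM :=
  ((isLocallyFree_At K B).reindex finSumFinEquiv).isVectorBundle

variable (B L) in
theorem isVectorBundle_AtL : (AtL B L).IsVectorBundle IM :=
  ((isLocallyFree_AtL B L).reindex finSumFinEquiv).isVectorBundle

end Atiyah

end

end LAtiyah

namespace LAtiyah

noncomputable section

universe u v w w'

set_option linter.unusedSectionVars false

/-- For an abstract family `IsSmoothOn` is a predicate on total sections; local frames are what make
it depend only on values over `U`. -/
theorem SmoothFamily.IsLocallyFree.congr {K : Type*} [RCLike K] {E H : Type*}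
    [NormedAddCommGroup E] [NormedSpace ℝ E] [TopologicalSpace H] {I : ModelWithCorners ℝ E H}
    {X : Type*} [TopologicalSpace X] [ChartedSpace H X] {A : SmoothFamily.{_, _, w} K X}
    {ι : Type*} [Fintype ι] (hA : A.IsLocallyFree I ι) {U : Set X} (hU : IsOpen U)
    {s t : ∀ x, A.Fiber x} (hs : A.IsSmoothOn s U) (h : ∀ x ∈ U, t x = s x) :
    A.IsSmoothOn t U :=
  hA.isSmoothOn_of_frame hU fun V e hV =>
    (hA.contMDiffOn_coord hU hs e hV).congr fun x hx => by rw [h x hx.1]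

section Atiyah

variable {EM HM EG HG EP HP : Type*}
  [NormedAddCommGroup EM] [NormedSpace ℝ EM] [TopologicalSpace HM]
  [NormedAddCommGroup EG] [NormedSpace ℝ EG] [TopologicalSpace HG]
  [NormedAddCommGroup EP] [NormedSpace ℝ EP] [TopologicalSpace HP]
  {IM : ModelWithCorners ℝ EM HM} {M : Type*} [TopologicalSpace M] [ChartedSpace HM M]
  {IG : ModelWithCorners ℝ EG HG} {G : Type*} [TopologicalSpace G] [ChartedSpace HG G] [Group G]
  {IP : ModelWithCorners ℝ EP HP} {P : Type*} [TopologicalSpace P] [ChartedSpace HP P]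
  [MulAction Gᵐᵒᵖ P] {K : Type*} [RCLike K] {B : PrincipalBundle IM M IG G IP P}
  [IsManifold IM ∞ M] [IsManifold IP ∞ P] [FiniteDimensional ℝ EM] [FiniteDimensional ℝ EG]
  [LieGroup IG ∞ G] {L : LieAlgebroid.{w} K IM M}

/-! ### Testing smoothness on `P`. -/

/-- Smoothness of maps on `M` can be tested on `P`. -/
theorem PrincipalBundle.contMDiffOn_comp_proj_iff (B : PrincipalBundle IM M IG G IP P)
    {E' H' : Type*} [NormedAddCommGroup E'] [NormedSpace ℝ E'] [TopologicalSpace H']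
    {I' : ModelWithCorners ℝ E' H'} {N : Type*} [TopologicalSpace N] [ChartedSpace H' N]
    {f : M → N} {U : Set M} (hU : IsOpen U) :
    ContMDiffOn IP I' ∞ (fun p => f (B.proj p)) (B.proj ⁻¹' U) ↔ ContMDiffOn IM I' ∞ f U := by
  constructor
  · intro h
    refine contMDiffOn_of_forall_nhds fun m hm => ?_
    obtain ⟨V, hVU, hV, hmV, ⟨t⟩⟩ := B.exists_localTriv_subset hU hm
    refine ⟨V, hV, hmV, (h.comp t.contMDiffOn_sec fun x hx => ?_).congr fun x hx => ?_⟩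
    · rw [Set.mem_preimage, Set.mem_preimage, t.proj_sec hx]
      exact hVU hx
    · exact (congrArg f (t.proj_sec hx)).symm
  · exact fun h => h.comp B.contMDiff_proj.contMDiffOn subset_rfl

theorem LieAlgebroid.isSmoothOn_pullbackE_iff {U : Set M} (hU : IsOpen U)
    {l : ∀ m, L.Fiber m} :
    (pullbackE B L).IsSmoothOn (fun p => l (B.proj p)) (B.proj ⁻¹' U) ↔
      L.family.IsSmoothOn l U := by
  let := L.bundle.topTotal
  let := L.bundle.topFiber
  let := L.bundle.fiberBundle
  exact B.contMDiffOn_comp_proj_iff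
    (f := fun m => (⟨m, l m⟩ : TotalSpace (Fin L.bundle.rank → K) L.Fiber)) hU

theorem tangentSmoothAlong_proj_iff {U : Set M} (hU : IsOpen U)
    {v : ∀ m, K ⊗[ℝ] TangentSpace IM m} :
    TangentSmoothAlong IM IP B.proj (fun p => v (B.proj p)) (B.proj ⁻¹' U) ↔
      (tangentK K IM M).IsSmoothOn v U := by
  have : IsManifold IM 1 M := IsManifold.of_le (n := ∞) (by simp)
  exact and_congr
    (B.contMDiffOn_comp_proj_iff
      (f := fun m => (⟨m, tensorRe K (TangentSpace IM m) (v m)⟩ : TangentBundle IM M)) hU)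
    (B.contMDiffOn_comp_proj_iff
      (f := fun m => (⟨m, tensorIm K (TangentSpace IM m) (v m)⟩ : TangentBundle IM M)) hU)

/-! ### The fibres of the bundles of the Atiyah sequences -/

variable (K B) in
/-- The tangent space at a point over `m` is the fibre of `At(P)` at `m`. -/
def atEquiv (p : P) : (K ⊗[ℝ] TangentSpace IP p) ≃ₗ[K] (At K B).Fiber (B.proj p) :=
  (tangentE K B).toQuot B p rfl

variable (B L) in
/-- The fibre of `T^L P` at a point over `m` is the fibre of `At_L(P)` at `m`. -/
def atLEquiv (p : P) : TLFiber B L p ≃ₗ[K] (AtL B L).Fiber (B.proj p) :=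
  (TL B L).toQuot B p rfl

theorem atAnchor_atEquiv (p : P) (v : K ⊗[ℝ] TangentSpace IP p) :
    atAnchor K B (B.proj p) (atEquiv K B p v) = tangentMapK K IP IM B.proj p v :=
  rfl

theorem fL_atLEquiv (p : P) (v : TLFiber B L p) :
    fL B L (B.proj p) (atLEquiv B L p v) = atEquiv K B p v.1.1 :=
  rfl

theorem sigmaL_atLEquiv (p : P) (v : TLFiber B L p) :
    sigmaL B L (B.proj p) (atLEquiv B L p v) = v.1.2 :=
  rfl

theorem atEquiv_symm_fL (p : P) (x : (AtL B L).Fiber (B.proj p)) :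
    (atEquiv K B p).symm (fL B L (B.proj p) x) = ((atLEquiv B L p).symm x).1.1 := by
  obtain ⟨v, rfl⟩ := (atLEquiv B L p).surjective x
  rw [fL_atLEquiv, LinearEquiv.symm_apply_apply, LinearEquiv.symm_apply_apply]

theorem sigmaL_eq (p : P) (x : (AtL B L).Fiber (B.proj p)) :
    sigmaL B L (B.proj p) x = ((atLEquiv B L p).symm x).1.2 := by
  obtain ⟨v, rfl⟩ := (atLEquiv B L p).surjective x
  rw [sigmaL_atLEquiv, LinearEquiv.symm_apply_apply]

theorem atAnchor_eq (p : P) (x : (At K B).Fiber (B.proj p)) :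
    atAnchor K B (B.proj p) x =
      tangentMapK K IP IM B.proj p ((atEquiv K B p).symm x) := by
  obtain ⟨v, rfl⟩ := (atEquiv K B p).surjective x
  rw [atAnchor_atEquiv, LinearEquiv.symm_apply_apply]

theorem at_isSmoothOn_iff {U : Set M} {x : ∀ m, (At K B).Fiber m} :
    (At K B).IsSmoothOn x U ↔
      (tangentK K IP P).IsSmoothOn (fun p => (atEquiv K B p).symm (x (B.proj p)))
        (B.proj ⁻¹' U) :=
  Iff.rfl

/-- The smooth sections of `At_L(P)` are those of the pullback of `At(P)` and `L`. -/
theorem atL_isSmoothOn_iff_fL_sigmaL {U : Set M} (hU : IsOpen U) {x : ∀ m, (AtL B L).Fiber m} :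
    (AtL B L).IsSmoothOn x U ↔
      (At K B).IsSmoothOn (fun m => fL B L m (x m)) U ∧
      L.family.IsSmoothOn (fun m => sigmaL B L m (x m)) U := by
  have h1 : (fun p => (atEquiv K B p).symm (fL B L (B.proj p) (x (B.proj p)))) =
      fun p => ((atLEquiv B L p).symm (x (B.proj p))).1.1 := funext fun p => atEquiv_symm_fL p _
  have h2 : (fun p => sigmaL B L (B.proj p) (x (B.proj p))) =
      fun p => ((atLEquiv B L p).symm (x (B.proj p))).1.2 := funext fun p => sigmaL_eq p _
  have h3 := at_isSmoothOn_iff (B := B) (U := U) (x := fun m => fL B L m (x m))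
  have h4 := LieAlgebroid.isSmoothOn_pullbackE_iff (B := B) hU (l := fun m => sigmaL B L m (x m))
  rw [h1] at h3
  rw [h2] at h4
  -- Smoothness in `T^LP` is componentwise by definition. The `TP`-component is smoothness in
  -- `At(P)` verbatim, while the `L`-component needs the descent from `P` to `M`.
  exact (and_congr h3 h4.symm).symm

theorem isBundleMap_fL : IsBundleMap (fL B L) := fun _ hU _ hs =>
  ((atL_isSmoothOn_iff_fL_sigmaL hU).1 hs).1

theorem isBundleMap_sigmaL : IsBundleMap (sigmaL B L) := fun _ hU _ hs =>
  ((atL_isSmoothOn_iff_fL_sigmaL hU).1 hs).2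

/-- After pulling back to `P` the image is `Tπ` of a smooth vector field, and smoothness descends to
`M`. -/
theorem isBundleMap_atAnchor : IsBundleMap (atAnchor K B) := by
  intro U hU x hx
  refine (tangentSmoothAlong_proj_iff (B := B) hU).1 ?_
  simp only [atAnchor_eq]
  have hU' := hU.preimage B.contMDiff_proj.continuous
  have h := at_isSmoothOn_iff.1 hx
  constructor
  · refine (B.contMDiffOn_mfderiv_proj hU' h.1).congr fun p _ => ?_
    exact congrArg (fun z => (⟨B.proj p, z⟩ : TangentBundle IM M)) (tensorRe_baseChange _ _)
  · refine (B.contMDiffOn_mfderiv_proj hU' h.2).congr fun p _ => ?_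
    exact congrArg (fun z => (⟨B.proj p, z⟩ : TangentBundle IM M)) (tensorIm_baseChange _ _)

/-- `At_L(P)` is the pullback of `At(P) → TM` along the anchor of `L`. -/
theorem bijOn_fL_sigmaL (m : M) :
    Set.BijOn (fun x => (fL B L m x, sigmaL B L m x)) Set.univ
      {y | atAnchor K B m y.1 = L.anchor m y.2} := by
  obtain ⟨p, rfl⟩ := B.proj_surjective m
  refine ⟨fun x _ => ?_, fun x _ y _ h => ?_, fun y hy => ?_⟩
  · obtain ⟨v, rfl⟩ := (atLEquiv B L p).surjective x
    exact v.2
  · obtain ⟨v, rfl⟩ := (atLEquiv B L p).surjective x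
    obtain ⟨v', rfl⟩ := (atLEquiv B L p).surjective y
    have h1 : v.1.1 = v'.1.1 := (atEquiv K B p).injective (congrArg Prod.fst h)
    have h2 : v.1.2 = v'.1.2 := (Prod.ext_iff.1 h).2
    exact congrArg _ (Subtype.ext (Prod.ext h1 h2))
  · obtain ⟨a, l⟩ := y
    obtain ⟨v, rfl⟩ := (atEquiv K B p).surjective a
    exact ⟨atLEquiv B L p ⟨(v, l), hy⟩, trivial, rfl⟩

variable (K B) in
/-- The Lie algebra of `G` is identified with the fibre of `Ad(P)` by any point over `m`. -/
def adEquiv (p : P) : (K ⊗[ℝ] GroupLieAlgebra IG G) ≃ₗ[K] (Ad K B).Fiber (B.proj p) :=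
  (adjointE IG G IP P K).toQuot B p rfl

theorem iota_adEquiv (p : P) (x : K ⊗[ℝ] GroupLieAlgebra IG G) :
    iota B L (B.proj p) (adEquiv K B p x) = atLEquiv B L p (iotaP B L p x) :=
  rfl

/-- The adjoint frame's coordinates of `x` are the form coordinates of its fundamental vector, so a
smooth fundamental field forces smooth coordinates. -/
theorem isSmoothOn_fundamental_iff (B : PrincipalBundle IM M IG G IP P) {W : Set P} (hW : IsOpen W)
    {x : P → K ⊗[ℝ] GroupLieAlgebra IG G} :
    (tangentK K IP P).IsSmoothOn (fun p => (fundamental IG G IP p).baseChange K (x p)) W ↔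
      (adjointE IG G IP P K).IsSmoothOn x W := by
  refine ⟨fun h => isLocal_adjointE.of_forall_nhds fun p hp => ?_, B.isSmoothOn_fundamental hW⟩
  obtain ⟨U, hU, hpU, ⟨t⟩⟩ := B.exists_localTriv (B.proj p)
  have hW' := hW.inter (hU.preimage B.contMDiff_proj.continuous)
  refine ⟨W ∩ B.proj ⁻¹' U, hW', ⟨hp, hpU⟩,
    (t.adjointFrame.smooth_iff _ Set.inter_subset_right hW' x).2 ?_⟩
  exact ((t.tangentK_isSmoothOn_iff hW' Set.inter_subset_right _).1
    ((isLocal_tangentE (B := B)).mono h Set.inter_subset_left)).2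

/-- The `L`-component of `ι` vanishes, so only the fundamental vector matters. The direction that
reflects smoothness is what makes left splittings smooth. -/
theorem isSmoothOn_iota_iff {U : Set M} (hU : IsOpen U) {a : ∀ m, (Ad K B).Fiber m} :
    (AtL B L).IsSmoothOn (fun m => iota B L m (a m)) U ↔ (Ad K B).IsSmoothOn a U := by
  have hU' := hU.preimage B.contMDiff_proj.continuous
  refine (EquivariantFamily.isSmoothOn_quotMap_iff (isEquivariant_iotaP B L)).trans ?_
  refine Iff.trans ?_ (isSmoothOn_fundamental_iff B hU')
  exact and_iff_left ((L.bundle.isLocallyFree_along B.contMDiff_proj).zero hU')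

theorem isBundleMap_iota : IsBundleMap (iota B L) := fun _ hU _ hs =>
  (isSmoothOn_iota_iff hU).2 hs

/-! ### Exactness -/

theorem PrincipalBundle.LocalTriv.ext_of_proj_formCoord {U : Set M} (t : B.LocalTriv U) {p : P}
    (hp : B.proj p ∈ U) {v v' : K ⊗[ℝ] TangentSpace IP p}
    (h : tangentMapK K IP IM B.proj p v = tangentMapK K IP IM B.proj p v')
    (h' : t.formCoord p v = t.formCoord p v') : v = v' := by
  rw [← t.horK_add_verK hp v, ← t.horK_add_verK hp v', h, ← t.verK_formCoord p v,
    ← t.verK_formCoord p v', h']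

theorem iota_injective (m : M) : Function.Injective (iota B L m) := by
  obtain ⟨p, rfl⟩ := B.proj_surjective m
  obtain ⟨U, hU, hp, ⟨t⟩⟩ := B.exists_localTriv (B.proj p)
  intro a b h
  obtain ⟨x, rfl⟩ := (adEquiv K B p).surjective a
  obtain ⟨y, rfl⟩ := (adEquiv K B p).surjective b
  rw [iota_adEquiv, iota_adEquiv] at h
  have h1 : (fundamental IG G IP p).baseChange K x = (fundamental IG G IP p).baseChange K y :=
    congrArg (fun z : TLFiber B L p => z.1.1) ((atLEquiv B L p).injective h)
  have h2 (z : K ⊗[ℝ] GroupLieAlgebra IG G) : t.adjointFrame.comb p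
      (t.formCoord p ((fundamental IG G IP p).baseChange K z)) = z :=
    t.adjointFrame.comb_coord p hp z
  rw [← h2 x, ← h2 y, h1]

theorem sigmaL_iota (m : M) (a : (Ad K B).Fiber m) : sigmaL B L m (iota B L m a) = 0 := by
  obtain ⟨p, rfl⟩ := B.proj_surjective m
  obtain ⟨x, rfl⟩ := (adEquiv K B p).surjective a
  rfl

theorem exists_iota_eq {m : M} {x : (AtL B L).Fiber m} (h : sigmaL B L m x = 0) :
    ∃ a, iota B L m a = x := by
  obtain ⟨p, rfl⟩ := B.proj_surjective m
  obtain ⟨U, hU, hp, ⟨t⟩⟩ := B.exists_localTriv (B.proj p)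
  obtain ⟨v, rfl⟩ := (atLEquiv B L p).surjective x
  have h0 : v.1.2 = 0 := h
  have h1 : tangentMapK K IP IM B.proj p v.1.1 = 0 := by
    have h2 : tangentMapK K IP IM B.proj p v.1.1 = L.anchor (B.proj p) v.1.2 := v.2
    rw [h2, h0, map_zero]
  refine ⟨adEquiv K B p (t.adjointFrame.comb p (t.formCoord p v.1.1)), ?_⟩
  -- The candidate is the fundamental vector with the same form value. Both vectors are vertical,
  -- and projection together with form determines a vector.
  refine (iota_adEquiv p _).trans ?_
  refine congrArg _ (Subtype.ext (Prod.ext (t.ext_of_proj_formCoord hp ?_ ?_) h0.symm))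
  · refine ((fundamental_mem_TLFiber B L p _).trans ?_).trans h1.symm
    exact map_zero _
  · exact t.adjointFrame.coord_comb p hp _

theorem exact_iota_sigmaL (m : M) : Function.Exact (iota B L m) (sigmaL B L m) := fun _ =>
  ⟨exists_iota_eq, fun ⟨a, ha⟩ => ha ▸ sigmaL_iota m a⟩

/-- Smooth sections of `L` lift locally to smooth sections of `At_L(P)`. -/
theorem exists_lift_sigmaL {U : Set M} (hU : IsOpen U) {l : ∀ m, L.Fiber m}
    (hl : L.family.IsSmoothOn l U) {m : M} (hm : m ∈ U) :
    ∃ V ⊆ U, IsOpen V ∧ m ∈ V ∧ ∃ x : ∀ m, (AtL B L).Fiber m, (AtL B L).IsSmoothOn x V ∧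
      ∀ m ∈ V, sigmaL B L m (x m) = l m := by
  obtain ⟨V, hV', hV, hmV, ⟨t⟩⟩ := B.exists_localTriv_subset
    (hU.inter (L.bundle.isOpen_dom m)) ⟨hm, L.bundle.mem_dom m⟩
  have hVU : V ⊆ U := fun _ h => (hV' h).1
  have hVd : V ⊆ L.bundle.dom m := fun _ h => (hV' h).2
  have hinv := fun p hp g v => t.algebroidFrame_act (L := L) hVd p hp g v
  let e : FrameOn (AtL B L) IM (Fin L.bundle.rank ⊕ Fin (Module.finrank ℝ EG)) V :=
    EquivariantFamily.quotFrame t (t.algebroidFrame hVd) hinv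
  have he (p : P) (hp : B.proj p ∈ V) (v : TLFiber B L p) :
      e.coord (B.proj p) (atLEquiv B L p v) =
        Sum.elim (L.bundle.coord m (B.proj p) v.1.2) (t.formCoord p v.1.1) :=
    (EquivariantFamily.quotFrame_coord t (t.algebroidFrame hVd) hinv hp v).trans
      (t.algebroidFrame_coord hVd p v)
  -- Vanishing Lie algebra coordinates select the lift that is horizontal for the flat connection.
  refine ⟨V, hVU, hV, hmV, fun m' => e.comb m' (Sum.elim (L.bundle.coord m m' (l m')) 0), ?_, ?_⟩
  · rw [e.smooth_iff V subset_rfl hV]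
    have h1 : ContMDiffOn IM 𝓘(ℝ, Fin L.bundle.rank → K) ∞
        (fun m' => L.bundle.coord m m' (l m')) V :=
      (L.bundle.isSmoothAlong_iff contMDiffOn_id hVd l).1
        (VectorBundleStructure.IsSmoothAlong.mono hl hVU)
    have h2 : ContMDiffOn IM 𝓘(ℝ, Fin L.bundle.rank ⊕ Fin (Module.finrank ℝ EG) → K) ∞
        (fun m' => (Sum.elim (L.bundle.coord m m' (l m')) 0 :
          Fin L.bundle.rank ⊕ Fin (Module.finrank ℝ EG) → K)) V := by
      rw [contMDiffOn_pi_space] at h1 ⊢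
      rintro (i | i)
      · exact h1 i
      · exact contMDiffOn_const
    exact h2.congr fun m' hm' => e.coord_comb m' hm' _
  · intro m' hm'
    obtain ⟨p, rfl⟩ := B.proj_surjective m'
    obtain ⟨v, hv⟩ := (atLEquiv B L p).surjective
      (e.comb (B.proj p) (Sum.elim (L.bundle.coord m (B.proj p) (l (B.proj p))) 0))
    have h1 := (he p hm' v).symm.trans ((congrArg _ hv).trans (e.coord_comb _ hm' _))
    have h2 : L.bundle.coord m (B.proj p) v.1.2 = L.bundle.coord m (B.proj p) (l (B.proj p)) :=
      funext fun i => congrFun h1 (Sum.inl i)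
    have h3 := congrArg (L.bundle.comb m (B.proj p)) h2
    rw [L.bundle.comb_coord (hVd hm'), L.bundle.comb_coord (hVd hm')] at h3
    exact (congrArg (sigmaL B L (B.proj p)) hv).symm.trans h3

/-- The flat horizontal lift of the anchor of `l`, paired with `l`, lies in `T^LP`. -/
theorem sigmaL_surjective (m : M) : Function.Surjective (sigmaL B L m) := by
  obtain ⟨p, rfl⟩ := B.proj_surjective m
  obtain ⟨U, hU, hp, ⟨t⟩⟩ := B.exists_localTriv (B.proj p)
  exact fun l => ⟨atLEquiv B L p ⟨(t.horK K p (L.anchor _ l), l), t.proj_horK hp _⟩, rfl⟩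

end Atiyah

end

end LAtiyah

namespace LAtiyah

noncomputable section

universe u v w w'

set_option linter.unusedSectionVars false

/-! ### Algebraic tools for the correspondences. -/

/-- A functional and bijective relation is the graph of an equivalence. -/
theorem exists_equiv_of_rel {α β : Type*} {R : α → β → Prop} (h1 : ∀ a, ∃ b, R a b)
    (h2 : ∀ b, ∃ a, R a b) (h3 : ∀ a b b', R a b → R a b' → b = b')
    (h4 : ∀ a a' b, R a b → R a' b → a = a') : ∃ e : α ≃ β, ∀ a, R a (e a) := by
  choose f hf using h1
  refine ⟨Equiv.ofBijective f ⟨fun a a' h => h4 a a' (f a) (hf a) (h ▸ hf a'), fun b => ?_⟩, hf⟩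
  obtain ⟨a, ha⟩ := h2 b
  exact ⟨a, h3 a _ _ (hf a) ha⟩

/-- A linear map whose values lie in the range of an injective linear map factors through it. -/
theorem exists_linearMap_comp_eq {K U V W : Type*} [Field K] [AddCommGroup U] [Module K U]
    [AddCommGroup V] [Module K V] [AddCommGroup W] [Module K W] {f : V →ₗ[K] W}
    (hf : Function.Injective f) (g : U →ₗ[K] W) (h : ∀ u, ∃ v, f v = g u) :
    ∃ k : U →ₗ[K] V, ∀ u, f (k u) = g u := by
  refine ⟨(LinearEquiv.ofInjective f hf).symm.toLinearMap ∘ₗ g.codRestrict f.range h, fun u => ?_⟩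
  have := (LinearEquiv.ofInjective f hf).apply_symm_apply (g.codRestrict f.range h u)
  exact congrArg Subtype.val this

section Atiyah

variable {EM HM EG HG EP HP : Type*}
  [NormedAddCommGroup EM] [NormedSpace ℝ EM] [TopologicalSpace HM]
  [NormedAddCommGroup EG] [NormedSpace ℝ EG] [TopologicalSpace HG]
  [NormedAddCommGroup EP] [NormedSpace ℝ EP] [TopologicalSpace HP]
  {IM : ModelWithCorners ℝ EM HM} {M : Type*} [TopologicalSpace M] [ChartedSpace HM M]
  {IG : ModelWithCorners ℝ EG HG} {G : Type*} [TopologicalSpace G] [ChartedSpace HG G] [Group G]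
  {IP : ModelWithCorners ℝ EP HP} {P : Type*} [TopologicalSpace P] [ChartedSpace HP P]
  [MulAction Gᵐᵒᵖ P] {K : Type*} [RCLike K] {B : PrincipalBundle IM M IG G IP P}
  [IsManifold IM ∞ M] [IsManifold IP ∞ P] [FiniteDimensional ℝ EM] [FiniteDimensional ℝ EG]
  [LieGroup IG ∞ G] {L : LieAlgebroid.{w} K IM M}

/-! ### Connections and anchored maps -/

/-- The fibre of `L` is identified with the fibre of the quotient of `π^* L`. -/
theorem bijective_descend_pullbackE (m : M) :
    Function.Bijective (EquivariantFamily.quotDescend (A := pullbackE B L) (W := L.family) B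
      (fun _ => LinearMap.id) (fun g p _ => sigma_castL L (B.proj_act g p).symm _) m) := by
  obtain ⟨p, rfl⟩ := B.proj_surjective m
  refine ⟨fun x y h => ?_, fun l => ⟨(pullbackE B L).toQuot B p rfl l, rfl⟩⟩
  obtain ⟨v, rfl⟩ := ((pullbackE B L).toQuot B p rfl).surjective x
  obtain ⟨v', rfl⟩ := ((pullbackE B L).toQuot B p rfl).surjective y
  exact congrArg _ h

theorem Connection.exists_anchoredMap (h : Connection B L) :
    ∃ s : AnchoredMap B L, ∀ p l, s.1 (B.proj p) l = atEquiv K B p (h.1 p l) := by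
  -- The quotient of `π^*L` by `G` is `L` again, so an equivariant map out of `π^*L` descends to one
  -- out of `L`.
  let c (m : M) := LinearEquiv.ofBijective _ (bijective_descend_pullbackE (B := B) (L := L) m)
  have hc (p : P) (l : L.Fiber (B.proj p)) :
      (c (B.proj p)).symm l = (pullbackE B L).toQuot B p rfl l :=
    (LinearEquiv.symm_apply_eq (c (B.proj p))).2 rfl
  let s : FibreMap L.family (At K B) := fun m =>
    EquivariantFamily.quotMap B h.1 h.2.2.1 m ∘ₗ (c m).symm.toLinearMap
  have hs (p : P) (l : L.Fiber (B.proj p)) : s (B.proj p) l = atEquiv K B p (h.1 p l) :=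
    congrArg (EquivariantFamily.quotMap B h.1 h.2.2.1 (B.proj p)) (hc p l)
  refine ⟨⟨s, fun U hU l hl => ?_, fun m l => ?_⟩, hs⟩
  · rw [at_isSmoothOn_iff]
    have h1 := h.2.1 _ (hU.preimage B.contMDiff_proj.continuous) _
      ((LieAlgebroid.isSmoothOn_pullbackE_iff (B := B) hU).2 hl)
    have h2 : (fun p => (atEquiv K B p).symm (s (B.proj p) (l (B.proj p)))) =
        fun p => h.1 p (l (B.proj p)) :=
      funext fun p => (LinearEquiv.symm_apply_eq _).2 (hs p _)
    rw [h2]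
    exact h1
  · obtain ⟨p, rfl⟩ := B.proj_surjective m
    rw [hs p l]
    exact h.2.2.2 p l

/-- The base point `m` is left free so that the identification of fibres of `L` over equal points
can be eliminated. -/
theorem toQuot_symm_castL (s : FibreMap L.family (At K B)) (g : G) (p : P) {m : M}
    (hp : B.proj p = m) (hg : B.proj (op g • p) = m) (l : L.Fiber (B.proj p)) :
    ((tangentE K B).toQuot B (op g • p) hg).symm (s m (castL L hp l)) =
      (tangentE K B).act g p ((atEquiv K B p).symm (s (B.proj p) l)) := by
  subst hp
  exact EquivariantFamily.toQuot_symm_act p rfl g hg _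

theorem AnchoredMap.exists_connection [FiniteDimensional ℝ EP] (s : AnchoredMap B L) :
    ∃ h : Connection B L, ∀ p l, s.1 (B.proj p) l = atEquiv K B p (h.1 p l) := by
  let h : FibreMap (pullbackE B L).toSmoothFamily (tangentE K B).toSmoothFamily :=
    fun p => (atEquiv K B p).symm.toLinearMap ∘ₗ s.1 (B.proj p)
  have hs (p : P) (l : L.Fiber (B.proj p)) : s.1 (B.proj p) l = atEquiv K B p (h p l) :=
    ((atEquiv K B p).apply_symm_apply _).symm
  refine ⟨⟨h, ?_, fun g p l => ?_, fun p l => ?_⟩, hs⟩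
  -- Smoothness of `s` concerns only sections over open sets of `M`, while a bundle map on `P` must
  -- handle arbitrary sections of `π^*L`. The frames pulled back from `L` bridge the gap.
  · refine isBundleMap_of_frame (A := (pullbackE B L).toSmoothFamily)
      (B := (tangentE K B).toSmoothFamily) (I := IP)
      (L.bundle.isLocallyFree_along B.contMDiff_proj).toIsLocal (isLocallyFree_tangentK K IP P) h
      fun p => ⟨B.proj ⁻¹' L.bundle.dom (B.proj p),
        (L.bundle.isOpen_dom _).preimage B.contMDiff_proj.continuous, L.bundle.mem_dom _,
        L.bundle.frameAlong B.contMDiff_proj (B.proj p), fun i => ?_⟩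
    exact s.2.1 _ (L.bundle.isOpen_dom _) _
      (L.bundle.isSmoothAlong_comb (B.proj p) (Pi.single i 1))
  · exact toQuot_symm_castL s.1 g p (B.proj_act g p).symm rfl l
  · exact ((atAnchor_eq p _).symm).trans (s.2.2 _ l)

/-! ### Splittings -/

theorem fL_sigmaL_injective {m : M} {x y : (AtL B L).Fiber m} (h : fL B L m x = fL B L m y)
    (h' : sigmaL B L m x = sigmaL B L m y) : x = y :=
  (bijOn_fL_sigmaL m).injOn trivial trivial (Prod.ext h h')

theorem AnchoredMap.exists_rightSplitting (s : AnchoredMap B L) :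
    ∃ r : RightSplitting B L, ∀ m l, s.1 m l = fL B L m (r.1 m l) := by
  -- The pair `(s̄(l), l)` satisfies the equation of the pullback, so it has a unique preimage in
  -- `At_L(P)`, linear in `l`.
  have key (m : M) : ∃ k : L.Fiber m →ₗ[K] (AtL B L).Fiber m,
      ∀ l, ((fL B L m).prod (sigmaL B L m)) (k l) = ((s.1 m).prod LinearMap.id) l := by
    refine exists_linearMap_comp_eq (fun x y h => ?_) _ fun l => ?_
    · exact (bijOn_fL_sigmaL m).injOn trivial trivial h
    · obtain ⟨x, -, hx⟩ := (bijOn_fL_sigmaL (B := B) (L := L) m).surjOn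
        (show (s.1 m l, l) ∈ {y | atAnchor K B m y.1 = L.anchor m y.2} from s.2.2 m l)
      exact ⟨x, hx⟩
  choose k hk using key
  have h1 (m : M) (l : L.Fiber m) : fL B L m (k m l) = s.1 m l := (Prod.ext_iff.1 (hk m l)).1
  have h2 (m : M) (l : L.Fiber m) : sigmaL B L m (k m l) = l := (Prod.ext_iff.1 (hk m l)).2
  refine ⟨⟨k, fun U hU l hl => (atL_isSmoothOn_iff_fL_sigmaL hU).2 ⟨?_, ?_⟩, h2⟩,
    fun m l => (h1 m l).symm⟩
  · exact (congrArg (fun x => (At K B).IsSmoothOn x U) (funext fun m => h1 m (l m))).mpr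
      (s.2.1 U hU l hl)
  · exact (congrArg (fun x => L.family.IsSmoothOn x U) (funext fun m => h2 m (l m))).mpr hl

theorem RightSplitting.exists_anchoredMap (r : RightSplitting B L) :
    ∃ s : AnchoredMap B L, ∀ m l, s.1 m l = fL B L m (r.1 m l) :=
  ⟨⟨fun m => fL B L m ∘ₗ r.1 m, fun U hU l hl => isBundleMap_fL U hU _ (r.2.1 U hU l hl),
    fun m l => ((bijOn_fL_sigmaL m).mapsTo (Set.mem_univ (r.1 m l))).trans
      (congrArg (L.anchor m) (r.2.2 m l))⟩, fun _ _ => rfl⟩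

theorem RightSplitting.exists_leftSplitting (s : RightSplitting B L) :
    ∃ θ : LeftSplitting B L, ∀ m x,
      iota B L m (θ.1 m x) + s.1 m (sigmaL B L m x) = x := by
  -- The operator `id - s ∘ σ_L` takes values in the kernel of `σ_L`, hence factors through the
  -- injective `ι`.
  have key (m : M) : ∃ k : (AtL B L).Fiber m →ₗ[K] (Ad K B).Fiber m,
      ∀ x, iota B L m (k x) = ((LinearMap.id : (AtL B L).Fiber m →ₗ[K] (AtL B L).Fiber m) -
        s.1 m ∘ₗ sigmaL B L m) x := by
    refine exists_linearMap_comp_eq (iota_injective m) _ fun x => exists_iota_eq ?_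
    rw [LinearMap.sub_apply, map_sub]
    exact sub_eq_zero.2 (s.2.2 m _).symm
  choose k hk using key
  have hk' (m : M) (x : (AtL B L).Fiber m) :
      iota B L m (k m x) = x - s.1 m (sigmaL B L m x) := hk m x
  refine ⟨⟨k, fun U hU x hx => ?_, fun m a => iota_injective (L := L) m ?_⟩, fun m x => ?_⟩
  · rw [← isSmoothOn_iota_iff (L := L) hU]
    simp only [hk']
    exact (isLocallyFree_AtL B L).sub hU hx (s.2.1 U hU _ (isBundleMap_sigmaL U hU x hx))
  · rw [hk', sigmaL_iota, map_zero, sub_zero]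
  · exact (congrArg (· + _) (hk' m x)).trans (sub_add_cancel _ _)

/-- The difference of two such elements is `ι a` by exactness, and `a = θ (ι a) = 0`. -/
theorem LeftSplitting.injective (θ : LeftSplitting B L) {m : M} {x y : (AtL B L).Fiber m}
    (h : θ.1 m x = θ.1 m y) (h' : sigmaL B L m x = sigmaL B L m y) : x = y := by
  obtain ⟨a, ha⟩ := exists_iota_eq (x := x - y) (by rw [map_sub, h', sub_self])
  have h1 := θ.2.2 m a
  rw [ha, map_sub, h, sub_self] at h1
  rw [← sub_eq_zero, ← ha, ← h1, map_zero]

theorem LeftSplitting.exists_rightSplitting (θ : LeftSplitting B L) :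
    ∃ s : RightSplitting B L, ∀ m x,
      iota B L m (θ.1 m x) + s.1 m (sigmaL B L m x) = x := by
  have hθ (m : M) (x : (AtL B L).Fiber m) : θ.1 m (x - iota B L m (θ.1 m x)) = 0 := by
    rw [map_sub, θ.2.2, sub_self]
  have hσ (m : M) (x : (AtL B L).Fiber m) :
      sigmaL B L m (x - iota B L m (θ.1 m x)) = sigmaL B L m x := by
    rw [map_sub, sigmaL_iota, sub_zero]
  -- The splitting sends `l` to the unique element of `ker θ` above `l`; any preimage `x` is
  -- corrected to `x - ι (θ x)`.
  have key (m : M) : ∃ k : L.Fiber m →ₗ[K] (AtL B L).Fiber m,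
      ∀ l, ((θ.1 m).prod (sigmaL B L m)) (k l) =
        ((0 : L.Fiber m →ₗ[K] (Ad K B).Fiber m).prod LinearMap.id) l := by
    refine exists_linearMap_comp_eq (fun x y h => ?_) _ fun l => ?_
    · exact θ.injective (Prod.ext_iff.1 h).1 (Prod.ext_iff.1 h).2
    · obtain ⟨x, hx⟩ := sigmaL_surjective (B := B) m l
      exact ⟨x - iota B L m (θ.1 m x), Prod.ext (hθ m x) ((hσ m x).trans hx)⟩
  choose k hk using key
  have h1 (m : M) (l : L.Fiber m) : θ.1 m (k m l) = 0 := (Prod.ext_iff.1 (hk m l)).1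
  have h2 (m : M) (l : L.Fiber m) : sigmaL B L m (k m l) = l := (Prod.ext_iff.1 (hk m l)).2
  have h3 (m : M) (x : (AtL B L).Fiber m) :
      k m (sigmaL B L m x) = x - iota B L m (θ.1 m x) :=
    θ.injective ((h1 m _).trans (hθ m x).symm) ((h2 m _).trans (hσ m x).symm)
  refine ⟨⟨k, fun U hU l hl => (isLocallyFree_AtL B L).of_forall_nhds fun m hm => ?_, h2⟩,
    fun m x => ?_⟩
  -- With a smooth local lift `x` of `l`, the section in question is `x - ι (θ x)`, visibly smooth.
  · obtain ⟨V, hVU, hV, hmV, x, hx, hxl⟩ := exists_lift_sigmaL (B := B) hU hl hm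
    refine ⟨V, hV, hmV, (isLocallyFree_AtL B L).congr hV
      ((isLocallyFree_AtL B L).sub hV hx (isBundleMap_iota V hV _ (θ.2.1 V hV x hx)))
      fun m' hm' => ?_⟩
    exact (congrArg (k m') (hxl m' hm')).symm.trans (h3 m' _)
  · exact (congrArg (_ + ·) (h3 m x)).trans (add_sub_cancel _ _)

/-! ### Decompositions -/

theorem RightSplitting.exists_decomposition (s : RightSplitting B L) :
    ∃ Φ : Decomposition B L, ∀ m a l, (Φ.1 m).symm (a, l) = iota B L m a + s.1 m l := by
  obtain ⟨θ, hθ⟩ := s.exists_leftSplitting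
  have hσ (m : M) (a : (Ad K B).Fiber m) (l : L.Fiber m) :
      sigmaL B L m (iota B L m a + s.1 m l) = l := by
    rw [map_add, sigmaL_iota, zero_add]
    exact s.2.2 m l
  have hθ' (m : M) (a : (Ad K B).Fiber m) (l : L.Fiber m) :
      θ.1 m (iota B L m a + s.1 m l) = a := by
    apply iota_injective (B := B) (L := L) m
    have := hθ m (iota B L m a + s.1 m l)
    rw [hσ] at this
    exact add_right_cancel this
  -- The maps `(θ, σ_L)` and `ι + s` are inverse to each other, and each is smooth by its
  -- components.
  let Φ (m : M) : (AtL B L).Fiber m ≃ₗ[K] ((Ad K B).Fiber m × L.Fiber m) :=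
    LinearEquiv.ofLinearMap ((θ.1 m).prod (sigmaL B L m)) ((iota B L m).coprod (s.1 m))
      (LinearMap.ext fun y => Prod.ext (hθ' m y.1 y.2) (hσ m y.1 y.2))
      (LinearMap.ext fun x => hθ m x)
  refine ⟨⟨Φ, fun U hU x hx => ⟨θ.2.1 U hU x hx, isBundleMap_sigmaL U hU x hx⟩,
    fun U hU y hy => (isLocallyFree_AtL B L).add hU (isBundleMap_iota U hU _ hy.1)
      (s.2.1 U hU _ hy.2), fun m a => Prod.ext (θ.2.2 m a) (sigmaL_iota m a), fun m l => ?_⟩,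
    fun _ _ _ => rfl⟩
  exact hσ m 0 l

/-- The splitting is the restriction of `Φ⁻¹` to the summand `L`; the condition on `ι` fixes `Φ⁻¹`
on the other summand. -/
theorem Decomposition.exists_rightSplitting (Φ : Decomposition B L) :
    ∃ s : RightSplitting B L, ∀ m a l, (Φ.1 m).symm (a, l) = iota B L m a + s.1 m l := by
  refine ⟨⟨fun m => (Φ.1 m).symm.toLinearMap ∘ₗ
    LinearMap.inr K ((Ad K B).Fiber m) (L.Fiber m), fun U hU l hl => ?_, Φ.2.2.2.2⟩,
    fun m a l => ?_⟩
  · exact Φ.2.2.1 U hU (fun m => (0, l m)) ⟨(isLocallyFree_Ad K B).zero hU, hl⟩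
  · have h1 : (Φ.1 m).symm (a, 0) = iota B L m a :=
      (LinearEquiv.symm_apply_eq _).2 (Φ.2.2.2.1 m a).symm
    have h2 : ((a, l) : (Ad K B).Fiber m × L.Fiber m) = (a, 0) + (0, l) :=
      Prod.ext (add_zero a).symm (zero_add (show L.Fiber m from l)).symm
    exact (congrArg (Φ.1 m).symm h2).trans ((map_add (Φ.1 m).symm _ _).trans
      (congrArg (· + _) h1))

end Atiyah

end

end LAtiyah

theorem theorem3p9 {K : Type*} [RCLike K]
    {EM HM EG HG EP HP : Type*}
    [NormedAddCommGroup EM] [NormedSpace ℝ EM] [FiniteDimensional ℝ EM] [TopologicalSpace HM]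
    [NormedAddCommGroup EG] [NormedSpace ℝ EG] [FiniteDimensional ℝ EG] [TopologicalSpace HG]
    [NormedAddCommGroup EP] [NormedSpace ℝ EP] [FiniteDimensional ℝ EP] [TopologicalSpace HP]
    {IM : ModelWithCorners ℝ EM HM} [IM.Boundaryless]
    {IG : ModelWithCorners ℝ EG HG} [IG.Boundaryless]
    {IP : ModelWithCorners ℝ EP HP} [IP.Boundaryless]
    -- the base manifold
    {M : Type*} [TopologicalSpace M] [ChartedSpace HM M] [IsManifold IM ∞ M]
    [T2Space M] [ParacompactSpace M]
    -- the structure group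
    {G : Type*} [TopologicalSpace G] [ChartedSpace HG G] [Group G] [LieGroup IG ∞ G]
    [T2Space G] [ParacompactSpace G]
    -- the principal bundle
    {P : Type*} [TopologicalSpace P] [ChartedSpace HP P] [IsManifold IP ∞ P]
    [T2Space P] [ParacompactSpace P] [MulAction Gᵐᵒᵖ P]
    (B : PrincipalBundle IM M IG G IP P)
    -- the Lie algebroid
    (L : LieAlgebroid K IM M) :
    -- the Atiyah sequences consist of vector bundles and vector bundle maps
    (Ad K B).IsVectorBundle IM ∧ (At K B).IsVectorBundle IM ∧ (AtL B L).IsVectorBundle IM ∧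
    IsBundleMap (iota B L) ∧ IsBundleMap (sigmaL B L) ∧
    IsBundleMap (fL B L) ∧ IsBundleMap (atAnchor K B) ∧
    -- `0 → Ad(P) → At_L(P) → L → 0` is exact
    (∀ m, Function.Injective (iota B L m) ∧
      Function.Exact (iota B L m) (sigmaL B L m) ∧ Function.Surjective (sigmaL B L m)) ∧
    -- `At_L(P)` is the pullback of `At(P) → TM` along the anchor of `L`
    (∀ m, Set.BijOn (fun x => (fL B L m x, sigmaL B L m x)) Set.univ
      {y | atAnchor K B m y.1 = L.anchor m y.2}) ∧
    (∀ U : Set M, IsOpen U → ∀ x : ∀ m, (AtL B L).Fiber m, (AtL B L).IsSmoothOn x U ↔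
      (At K B).IsSmoothOn (fun m => fL B L m (x m)) U ∧
      L.family.IsSmoothOn (fun m => sigmaL B L m (x m)) U) ∧
    -- the equivalent data
    ∃ (e₁ : Connection B L ≃ AnchoredMap B L) (e₂ : RightSplitting B L ≃ AnchoredMap B L)
      (e₃ : RightSplitting B L ≃ LeftSplitting B L)
      (e₄ : RightSplitting B L ≃ Decomposition B L),
      (∀ h p l, (e₁ h).1 (B.proj p) l = (tangentE K B).orbit B p rfl (h.1 p l)) ∧
      (∀ s m l, (e₂ s).1 m l = fL B L m (s.1 m l)) ∧
      (∀ s m x, iota B L m ((e₃ s).1 m x) + s.1 m (sigmaL B L m x) = x) ∧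
      (∀ s m x, (e₄ s).1 m x = ((e₃ s).1 m x, sigmaL B L m x)) ∧
      (∀ s m a l, ((e₄ s).1 m).symm (a, l) = iota B L m a + s.1 m l) := by
  -- Each bijection is obtained from the formula relating the two kinds of data: partners exist on
  -- both sides and the formula determines each from the other. Here uniqueness of `s̄` uses a point
  -- of `P` over each `m`.
  obtain ⟨e₁, h₁⟩ := exists_equiv_of_rel
    (R := fun (h : Connection B L) (s : AnchoredMap B L) =>
      ∀ p l, s.1 (B.proj p) l = atEquiv K B p (h.1 p l))
    (fun h => h.exists_anchoredMap) (fun s => s.exists_connection)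
    (fun h s s' hs hs' => Subtype.ext <| funext fun m => LinearMap.ext fun l => by
      obtain ⟨p, rfl⟩ := B.proj_surjective m
      exact (hs p l).trans (hs' p l).symm)
    (fun h h' s hs hs' => Subtype.ext <| funext fun p => LinearMap.ext fun l =>
      (atEquiv K B p).injective ((hs p l).symm.trans (hs' p l)))
  obtain ⟨e₂, h₂⟩ := exists_equiv_of_rel
    (R := fun (r : RightSplitting B L) (s : AnchoredMap B L) =>
      ∀ m l, s.1 m l = fL B L m (r.1 m l))
    (fun r => r.exists_anchoredMap) (fun s => s.exists_rightSplitting)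
    (fun r s s' hs hs' => Subtype.ext <| funext fun m => LinearMap.ext fun l =>
      (hs m l).trans (hs' m l).symm)
    (fun r r' s hs hs' => Subtype.ext <| funext fun m => LinearMap.ext fun l =>
      fL_sigmaL_injective ((hs m l).symm.trans (hs' m l)) ((r.2.2 m l).trans (r'.2.2 m l).symm))
  obtain ⟨e₃, h₃⟩ := exists_equiv_of_rel
    (R := fun (s : RightSplitting B L) (θ : LeftSplitting B L) =>
      ∀ m x, iota B L m (θ.1 m x) + s.1 m (sigmaL B L m x) = x)
    (fun s => s.exists_leftSplitting) (fun θ => θ.exists_rightSplitting)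
    (fun s θ θ' h h' => Subtype.ext <| funext fun m => LinearMap.ext fun x =>
      iota_injective m (add_right_cancel ((h m x).trans (h' m x).symm)))
    (fun s s' θ h h' => Subtype.ext <| funext fun m => LinearMap.ext fun l => by
      -- The relation constrains `s` only on values of `σ_L`, which exhaust `L`.
      obtain ⟨x, rfl⟩ := sigmaL_surjective (B := B) m l
      exact add_left_cancel ((h m x).trans (h' m x).symm))
  obtain ⟨e₄, h₄⟩ := exists_equiv_of_rel
    (R := fun (s : RightSplitting B L) (Φ : Decomposition B L) =>
      ∀ m a l, (Φ.1 m).symm (a, l) = iota B L m a + s.1 m l)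
    (fun s => s.exists_decomposition) (fun Φ => Φ.exists_rightSplitting)
    (fun s Φ Φ' h h' => Subtype.ext <| funext fun m => LinearEquiv.symm_bijective.injective <|
      LinearEquiv.ext fun y => (h m y.1 y.2).trans (h' m y.1 y.2).symm)
    (fun s s' Φ h h' => Subtype.ext <| funext fun m => LinearMap.ext fun l =>
      add_left_cancel ((h m 0 l).symm.trans (h' m 0 l)))
  exact ⟨isVectorBundle_Ad K B, isVectorBundle_At K B, isVectorBundle_AtL B L, isBundleMap_iota,
    isBundleMap_sigmaL, isBundleMap_fL, isBundleMap_atAnchor,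
    fun m => ⟨iota_injective m, exact_iota_sigmaL m, sigmaL_surjective m⟩, bijOn_fL_sigmaL,
    fun U hU x => atL_isSmoothOn_iff_fL_sigmaL hU, e₁, e₂, e₃, e₄, h₁, h₂, h₃,
    -- The formula `Φ = θ ⊕ σ_L` follows by applying the formula for `Φ⁻¹` to `(θ x, σ_L x)`: the
    -- result `ι (θ x) + s (σ_L x)` is `x`.
    fun s m x => ((LinearEquiv.symm_apply_eq _).1 ((h₄ s m _ _).trans (h₃ s m x))).symm, h₄⟩
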